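/- Let $\mathcal S^{\mathrm{poly}}$ denote the class of meromorphic functions $L$ on $\mathbb C$ that satisfy the axioms of the Selberg class: (i) $L(s)=\sum_{n\ge1}a_L(n)n^{-s}$, absolutely convergent for $\Re s>1$; (ii) $(s-1)^mL(s)$ is entire of finite order for some integer $m\ge 0$; (iii) $\Phi(s)=\omega\,\overline{\Phi(1-\overline s)}$, where $\Phi(s)=L(s)Q^s\prod_{j=1}^f\Gamma(\lambda_js+\mu_j)$ for some $|\omega|=1$, $Q>0$, $\lambda_j>0$ and $\mu_j\in\mathbb C$ with $\Re\mu_j\ge0$; (iv) $a_L(n)=O_\varepsilon(n^\varepsilon)$ for every $\varepsilon>0$; (v) $L(s)=\prod_p\exp\big(\sum_{j\ge1}b_L(p^j)p^{-js}\big)$ for $\Re s>1$, where $b_L(p^j)=O(p^{j\eta})$ for some $\eta<1/2$; and which moreover have a polynomial Euler product: there are an integer $r_L\ge 0$ and complex numbers $\nu_{L,j}(p)$ such that $L(s)=\prod_p\prod_{j=1}^{r_L}\big(1-\nu_{L,j}(p)p^{-s}\big)^{-1}$ for $\Re s>1$. Let $\sigma_0\in(1/2,1)$ be fixed and let $L_1,\dots,L_k$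 be distinct elements of $\mathcal S^{\mathrm{poly}}$. Assume that there are real numbers $\kappa_1,\dots,\kappa_k>0$ such that, for every $A>0$ and all $i,j\in\{1,\dots,k\}$, as $x\to\infty$, $$\sum_{p\le x}a_{L_i}(p)\overline{a_{L_j}(p)}=\begin{cases}\kappa_j\operatorname{Li}(x)+O_A\big(x/\log^Ax\big)&\text{if } i=j,\\ O_A\big(x/\log^Ax\big)&\text{if } i\ne j,\end{cases}$$ where $p$ runs over primes and $\operatorname{Li}(x)=\int_2^x\frac{du}{\log u}$. Assume also that there is $\delta>0$ such that, for $j=1,\dots,k$, as $T\to\infty$, $$N_{L_j}(\sigma_0,T):=\sharp\{\rho=\beta+i\gamma:\ L_j(\rho)=0,\ \beta\ge\sigma_0,\ \gamma\in[0,T]\}\ll T^{1-\delta}.$$ Then there is a constant $c>0$ (depending on $\sigma_0$, the functions $L_j$ and $\delta$, but not on the angles below) such that for all real $\theta_1,\dots,\theta_k$ and all sufficiently large $T$ there are $t_1,\dots,t_k\in[T,2T]$ with $$|t_i-t_j|\le 2(\log T)^{(1+\sigma_0)/2}(\log\log T)^{1/2}\qquad(1\le i,j\le k)$$ such that, for every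 $j=1,\dots,k$, the function $L_j$ has no zero on the half-line $\{x+it_j: x\ge\sigma_0\}$ and $$\Re\big(e^{-i\theta_j}\log L_j(\sigma_0+it_j)\big)\ge c\,\frac{(\log T)^{1-\sigma_0}}{\log\log T}.$$ Here $\log L_j(\sigma_0+it_j)$ is the value obtained by continuous variation of $\log L_j(x+it_j)$ along this half-line, from the limit $0$ at $x=+\infty$. -/

import Mathlib

open Filter Topology Asymptotics Bornology
open scoped ComplexConjugate

noncomputable section

namespace JointExtreme

/-- The Selberg class: the meromorphic function `L`, with Dirichlet coefficients `a n` (`n ≥ 1`),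
satisfies the five axioms. The only possible pole is at `s = 1`; there the value `L 1` of the total
function `L : ℂ → ℂ` carries no information when `L` has a pole. -/
structure IsSelberg (L : ℂ → ℂ) (a : ℕ → ℂ) : Prop where
  /-- Absolutely convergent Dirichlet series for `Re s > 1`. -/
  dirichlet : ∀ s : ℂ, 1 < s.re → LSeriesHasSum a s (L s)
  /-- `(s - 1) ^ m * L s` is entire of finite order. -/
  continuation : ∃ (m : ℕ) (G : ℂ → ℂ), Differentiable ℂ G ∧
    (∀ s : ℂ, s ≠ 1 → G s = (s - 1) ^ m * L s) ∧
    ∃ B : ℝ, 0 < B ∧ G =O[cobounded ℂ] fun s : ℂ => Real.exp (‖s‖ ^ B)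
  /-- At `s = 1` the function `L` is continuous (hence analytic), unless it has a pole. -/
  at_one : ContinuousAt L 1 ∨ Tendsto L (𝓝[≠] 1) (cobounded ℂ)
  /-- Functional equation, stated at all points where neither side meets a pole of `L` or of one
  of the Gamma factors. -/
  functional : ∃ (f : ℕ) (Q : ℝ) (lam : Fin f → ℝ) (mu : Fin f → ℂ) (ω : ℂ),
    0 < Q ∧ (∀ j, 0 < lam j) ∧ (∀ j, 0 ≤ (mu j).re) ∧ ‖ω‖ = 1 ∧
    ∀ Φ : ℂ → ℂ,
      (∀ s, Φ s = L s * (Q : ℂ) ^ s * ∏ j, Complex.Gamma (lam j * s + mu j)) →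
      ∀ s : ℂ, s ≠ 0 → s ≠ 1 →
        (∀ (j : Fin f) (n : ℕ), (lam j : ℂ) * s + mu j ≠ -(n : ℂ)) →
        (∀ (j : Fin f) (n : ℕ), (lam j : ℂ) * (1 - conj s) + mu j ≠ -(n : ℂ)) →
        Φ s = ω * conj (Φ (1 - conj s))
  /-- Ramanujan hypothesis. -/
  ramanujan : ∀ ε : ℝ, 0 < ε → a =O[atTop] fun n : ℕ => (n : ℝ) ^ ε
  /-- Euler product. -/
  euler : ∃ (b : ℕ → ℂ) (η C : ℝ), η < 1 / 2 ∧
    (∀ p : ℕ, p.Prime → ∀ j : ℕ, 1 ≤ j → ‖b (p ^ j)‖ ≤ C * (p : ℝ) ^ ((j : ℝ) * η)) ∧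
    ∀ s : ℂ, 1 < s.re →
      HasProd (fun p : Nat.Primes =>
        Complex.exp (∑' j : ℕ, b ((p : ℕ) ^ (j + 1)) / ((p : ℕ) : ℂ) ^ (((j : ℂ) + 1) * s))) (L s)

/-- The Selberg class with polynomial Euler product. -/
structure IsSelbergPoly (L : ℂ → ℂ) (a : ℕ → ℂ) : Prop extends IsSelberg L a where
  poly_euler : ∃ (r : ℕ) (ν : Fin r → ℕ → ℂ), ∀ s : ℂ, 1 < s.re →
    HasProd (fun p : Nat.Primes =>
      ∏ j : Fin r, (1 - ν j p / ((p : ℕ) : ℂ) ^ s)⁻¹) (L s)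

/-- The logarithmic integral `∫_2^x dt / log t`. -/
def Li (x : ℝ) : ℝ := ∫ t in (2 : ℝ)..x, (Real.log t)⁻¹

/-- `∑_{p ≤ x} a(p) * conj (b(p))`, over primes. -/
def primeCorr (a b : ℕ → ℂ) (x : ℝ) : ℂ :=
  ∑ p ∈ Finset.Icc 1 ⌊x⌋₊ with p.Prime, a p * conj (b p)

/-- Strong Selberg orthonormality condition, with error `O_A(x / (log x) ^ A)` for every `A > 0`. -/
def SSOC {k : ℕ} (a : Fin k → ℕ → ℂ) (κ : Fin k → ℝ) : Prop :=
  ∀ A : ℝ, 0 < A → ∀ i j : Fin k,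
    (fun x : ℝ => primeCorr (a i) (a j) x - if i = j then ((κ j * Li x : ℝ) : ℂ) else 0)
      =O[atTop] fun x : ℝ => x / Real.log x ^ A

/-- Zeros `β + iγ` of `L` with `β ≥ σ` and `0 ≤ γ ≤ T`. (Analyticity only excludes a meaningless
value at a pole.) -/
def zeroSet (L : ℂ → ℂ) (σ T : ℝ) : Set ℂ :=
  {ρ | AnalyticAt ℂ L ρ ∧ L ρ = 0 ∧ σ ≤ ρ.re ∧ 0 ≤ ρ.im ∧ ρ.im ≤ T}

/-- `N_L(σ, T) ≪ T ^ (1 - δ)` as `T → ∞`. -/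
def ZeroDensity (L : ℂ → ℂ) (σ δ : ℝ) : Prop :=
  ∃ C : ℝ, ∀ᶠ T : ℝ in atTop,
    (zeroSet L σ T).Finite ∧ ((zeroSet L σ T).ncard : ℝ) ≤ C * T ^ (1 - δ)

/-- `w` is the value at `s` of `log L`, obtained by continuous variation along the horizontal
half-line from `s` to `+∞ + i Im s` (on which `L` must not vanish), starting from the value `0`
at `+∞`. -/
def IsLogValue (L : ℂ → ℂ) (s w : ℂ) : Prop :=
  ∃ g : ℝ → ℂ, ContinuousOn g (Set.Ici s.re) ∧
    (∀ x : ℝ, s.re ≤ x → Complex.exp (g x) = L (x + s.im * Complex.I)) ∧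
    Tendsto g atTop (𝓝 0) ∧ g s.re = w

end JointExtreme

end

namespace JointExtreme

/-! ### Local roots of a polynomial Euler product -/

/-! The local roots of the Euler products have norm at most 1 (`exists_local_roots`). Hence for Re s
> 1 a logarithm of L_j is the prime sum ∑ a_j(p) p^{-s} plus a tail which is holomorphic for Re s >
1/2 and bounded on every half-plane Re s ≥ σ > 1/2. Large values of log L_j on Re s = σ₀ are thus
large values of a continued prime sum.

Smoothing. Let t be the centre of a window |Im s - t| ≤ H + 3 in which L_j has no zero with Re s ≥
σ₀. The logarithm minus its tail is integrated over σ₀ + i[t - H, t + H] against exp(A z²) - exp(-A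
H²), and the segment is moved to Re s = 2, where the prime sum converges and Gaussian integration
turns it into `smoothSum`. The kernel is nonnegative on the original segment, so a large smoothed
value in the direction e^{iθ} forces a large value at some point of the segment. It also vanishes at
the corners ±iH. This matters because zeros may lie arbitrarily close to the left of the line Re s =
σ₀: Borel-Carathéodory bounds the logarithm on the horizontal edges only by a constant times t^B /
(x - σ₀), and the zero of the kernel cancels that singularity. For A = (log log T)² and H = √(log T)
the kernel decays faster than any power of T. The result is `exists_large_logValue`.

Resonance. The centre t is common to all j. It is found by weighting [T, 2T] with a Riesz product ∏
(1 + Re(β_p p^{it})) over the primes in (x/2, x], x = η log T. Under this weight p^{-it} has mean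
about β_p / 2 and different primes are nearly uncorrelated, by the quantitative independence of the
logarithms of primes in `inv_le_abs_sum_mul_log`. If β_p is proportional to ∑ e^{iθ_i} conj(a_i(p)),
orthonormality makes the mean of e^{-iθ_j} times the j-th smoothed sum at least a constant times
x^{1-σ₀} / log x, for every j at once (`re_mean_ge`). The variances stay bounded because ∑ p^{-2σ₀}
converges. The weight is at most e^x = T^η, so discarding the neighbourhoods of O(T^{1-8η})
ordinates of zeros is harmless, and Chebyshev's inequality provides t (`exists_ordinate`,
`SSOC.exists_centre`). Each L_j then has its own point t_j within H of t. -/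

/-- The factors of a convergent infinite product with nonzero value are bounded away from `0`
outside a finite set. -/
lemma HasProd.exists_finset_half_le_norm {ι : Type*} {f : ι → ℂ} {z : ℂ} (hf : HasProd f z)
    (hz : z ≠ 0) : ∃ s : Finset ι, ∀ i ∉ s, 1 / 2 ≤ ‖f i‖ := by
  classical
  have hz' : 0 < ‖z‖ := norm_pos_iff.mpr hz
  have h := Metric.tendsto_atTop.mp (show Tendsto (fun s => ∏ i ∈ s, f i) atTop (𝓝 z) from hf)
    (‖z‖ / 4) (by positivity)
  obtain ⟨s, hs⟩ := h
  refine ⟨s, fun i hi => ?_⟩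
  have h₁ := hs s le_rfl
  have h₂ := hs (insert i s) (Finset.subset_insert i s)
  rw [dist_eq_norm] at h₁ h₂
  rw [Finset.prod_insert hi] at h₂
  have h₃ : ‖∏ i ∈ s, f i‖ ≤ 5 / 4 * ‖z‖ := by
    have := norm_le_norm_add_norm_sub z (∏ i ∈ s, f i)
    rw [norm_sub_rev] at this
    linarith
  have h₄ : 3 / 4 * ‖z‖ ≤ ‖f i * ∏ i ∈ s, f i‖ := by
    have := norm_le_norm_add_norm_sub (f i * ∏ i ∈ s, f i) z
    linarith
  rw [norm_mul] at h₄
  by_contra hcon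
  push Not at hcon
  nlinarith [norm_nonneg (∏ i ∈ s, f i), norm_nonneg (f i)]

/-- As x → +∞ the first nonzero term of the Dirichlet series dominates. The value `a 0` plays no
role in the series and is replaced by 0, so that the least index found is positive. -/
lemma eventually_ne_zero_of_LSeriesHasSum {L : ℂ → ℂ} {a : ℕ → ℂ}
    (h : ∀ s : ℂ, 1 < s.re → LSeriesHasSum a s (L s)) (ha : ∃ n ≠ 0, a n ≠ 0) :
    ∀ᶠ x : ℝ in atTop, L x ≠ 0 := by
  classical
  set f : ℕ → ℂ := fun n => if n = 0 then 0 else a n with hf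
  have hex : ∃ n, f n ≠ 0 := by
    obtain ⟨n, hn, hn'⟩ := ha
    exact ⟨n, by simpa [hf, hn] using hn'⟩
  have hspec := Nat.find_spec hex
  set N := Nat.find hex with hN
  have hN0 : N ≠ 0 := fun h0 => by rw [h0] at hspec; simp [hf] at hspec
  obtain ⟨n, hn⟩ := Nat.exists_eq_succ_of_ne_zero hN0
  have hcongr : ∀ {n : ℕ}, n ≠ 0 → a n = f n := fun {n} hn => by simp [hf, hn]
  have habs : LSeries.abscissaOfAbsConv f < ⊤ := by
    have h2 : LSeriesSummable f 2 := (LSeriesSummable_congr 2 hcongr).mp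
      (h 2 (by norm_num)).LSeriesSummable
    exact (h2.abscissaOfAbsConv_le).trans_lt (EReal.coe_lt_top _)
  have hlim := LSeries.tendsto_cpow_mul_atTop (f := f) (n := n) (fun m hm => by
    by_contra hcon
    exact Nat.find_min hex (show m < Nat.find hex by omega) hcon) habs
  have hne : f (n + 1) ≠ 0 := by
    rw [show n + 1 = N from hn.symm]; exact hspec
  filter_upwards [hlim.eventually_ne hne, eventually_gt_atTop 1] with x hx hx1 h0
  apply hx
  rw [← LSeries_congr hcongr, (h x (by simpa using hx1)).LSeries_eq, h0, mul_zero]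

/-- If the product of `1 - z j * q ^ (-i)` is bounded at more points `i` than there are factors,
then the `z j` are bounded polynomially in `q`. -/
lemma norm_le_of_prod_one_sub_le {r : ℕ} (z : Fin r → ℂ) {q : ℝ} (hq : 2 ≤ q) (m : ℕ)
    (h : ∀ i : Fin (r + 1), ∏ j, ‖1 - z j / (q : ℂ) ^ (m + i : ℕ)‖ ≤ 2) (j : Fin r) :
    ‖z j‖ ≤ 3 * 4 ^ r * q ^ (m + r) := by
  have hq0 : 0 < q := by linarith
  have hnq : ∀ n : ℕ, ‖(q : ℂ) ^ n‖ = q ^ n := fun n => by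
    rw [norm_pow, Complex.norm_real, Real.norm_of_nonneg hq0.le]
  -- some exponent keeps all the factors away from `0`
  have hex : ∃ i : Fin (r + 1), ∀ j, 1 / 4 ≤ ‖1 - z j / (q : ℂ) ^ (m + i : ℕ)‖ := by
    by_contra hcon
    push Not at hcon
    choose f hf using hcon
    -- One z cannot make its factor small at two exponents i < i': its norm would be at most 5/4 of
    -- q^(m+i) and at least 3/4 of q^(m+i'), although q ≥ 2. By pigeonhole, r numbers cannot spoil r
    -- + 1 exponents.
    have hinj : Function.Injective f := by
      have key : ∀ i i' : Fin (r + 1), i < i' → f i ≠ f i' := by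
        intro i i' hii hff
        have h1 := hf i
        have h2 := hf i'
        rw [← hff] at h2
        set w := z (f i)
        have e1 : ‖w‖ ≤ 5 / 4 * q ^ (m + i : ℕ) := by
          have : ‖w / (q : ℂ) ^ (m + i : ℕ)‖ ≤ 5 / 4 := by
            have := norm_le_norm_add_norm_sub (1 : ℂ) (w / (q : ℂ) ^ (m + i : ℕ))
            rw [norm_one] at this
            linarith
          rwa [norm_div, hnq, div_le_iff₀ (by positivity)] at this
        have e2 : 3 / 4 * q ^ (m + i' : ℕ) ≤ ‖w‖ := by
          have : 3 / 4 ≤ ‖w / (q : ℂ) ^ (m + i' : ℕ)‖ := by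
            have := norm_le_norm_add_norm_sub (w / (q : ℂ) ^ (m + i' : ℕ)) (1 : ℂ)
            rw [norm_one, norm_sub_rev] at this
            linarith
          rwa [norm_div, hnq, le_div_iff₀ (by positivity)] at this
        have e3 : q ^ (m + i : ℕ) * q ≤ q ^ (m + i' : ℕ) := by
          rw [← pow_succ]
          exact pow_le_pow_right₀ (by linarith) (by have : (i : ℕ) < i' := hii; omega)
        have e4 : 0 < q ^ (m + i : ℕ) := by positivity
        nlinarith
      intro i i' hff
      rcases lt_trichotomy i i' with h' | h' | h'
      · exact absurd hff (key i i' h')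
      · exact h'
      · exact absurd hff.symm (key i' i h')
    have := Fintype.card_le_of_injective f hinj
    simp at this
  obtain ⟨i, hi⟩ := hex
  have hprod := h i
  have h1 : ‖1 - z j / (q : ℂ) ^ (m + i : ℕ)‖ ≤ 2 * 4 ^ r := by
    classical
    rw [← Finset.mul_prod_erase _ _ (Finset.mem_univ j)] at hprod
    have h2 : (1 / 4 : ℝ) ^ r ≤ ∏ x ∈ Finset.univ.erase j, ‖1 - z x / (q : ℂ) ^ (m + i : ℕ)‖ := by
      calc (1 / 4 : ℝ) ^ r ≤ (1 / 4 : ℝ) ^ (Finset.univ.erase j).card :=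
            pow_le_pow_of_le_one (by norm_num) (by norm_num)
              ((Finset.card_le_univ _).trans (by simp))
        _ = ∏ x ∈ Finset.univ.erase j, (1 / 4 : ℝ) := by rw [Finset.prod_const]
        _ ≤ _ := Finset.prod_le_prod (fun _ _ => by norm_num) (fun x _ => hi x)
    have h3 : ‖1 - z j / (q : ℂ) ^ (m + i : ℕ)‖ * (1 / 4 : ℝ) ^ r ≤ 2 :=
      (mul_le_mul_of_nonneg_left h2 (norm_nonneg _)).trans hprod
    rw [one_div, inv_pow, ← div_eq_mul_inv, div_le_iff₀ (by positivity)] at h3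
    exact h3
  have h4 : ‖z j / (q : ℂ) ^ (m + i : ℕ)‖ ≤ 3 * 4 ^ r := by
    have := norm_le_norm_add_norm_sub (1 : ℂ) (z j / (q : ℂ) ^ (m + i : ℕ))
    rw [norm_one] at this
    have h5 : (1 : ℝ) ≤ 4 ^ r := one_le_pow₀ (by norm_num)
    linarith
  rw [norm_div, hnq, div_le_iff₀ (by positivity)] at h4
  refine h4.trans ?_
  gcongr
  · linarith
  · omega

/-- Convergence of the product says nothing directly about single roots. But at each of the r + 1
integer points m, ..., m + r the product is nonzero, so outside a finite set of primes every local
factor has norm at least 1/2 and `norm_le_of_prod_one_sub_le` applies. The exceptional primes and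
the constants are absorbed by a larger exponent because p ≥ 2. -/
lemma exists_norm_le_pow {L : ℂ → ℂ} {r : ℕ} {ν : Fin r → ℕ → ℂ}
    (hL : ∀ᶠ x : ℝ in atTop, L x ≠ 0)
    (h : ∀ s : ℂ, 1 < s.re →
      HasProd (fun p : Nat.Primes => ∏ j : Fin r, (1 - ν j p / ((p : ℕ) : ℂ) ^ s)⁻¹) (L s)) :
    ∃ K : ℕ, ∀ p : ℕ, p.Prime → ∀ j, ‖ν j p‖ ≤ (p : ℝ) ^ K := by
  classical
  obtain ⟨x₀, hx₀⟩ := eventually_atTop.mp hL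
  obtain ⟨m, hm⟩ := exists_nat_ge (max x₀ 2)
  have hs : ∀ i : Fin (r + 1), ∃ s : Finset Nat.Primes, ∀ p ∉ s,
      1 / 2 ≤ ‖∏ j : Fin r, (1 - ν j p / ((p : ℕ) : ℂ) ^ (m + i : ℕ))⁻¹‖ := by
    intro i
    have hmi : max x₀ 2 ≤ ((m + i : ℕ) : ℝ) := hm.trans (by push_cast; simp)
    have h1 := h ((m + i : ℕ) : ℂ) (by
      rw [Complex.natCast_re]; linarith [le_max_right x₀ 2])
    have h2 : L ((m + i : ℕ) : ℂ) ≠ 0 := by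
      have := hx₀ ((m + i : ℕ) : ℝ) ((le_max_left _ _).trans hmi)
      simpa using this
    obtain ⟨s, hs⟩ := HasProd.exists_finset_half_le_norm h1 h2
    refine ⟨s, fun p hp => ?_⟩
    have := hs p hp
    simp only [Complex.cpow_natCast] at this
    exact this
  choose s hs using hs
  set S : Finset Nat.Primes := Finset.univ.biUnion s with hS
  have hbig : ∀ p : Nat.Primes, p ∉ S → ∀ j, ‖ν j p‖ ≤ 3 * 4 ^ r * ((p : ℕ) : ℝ) ^ (m + r) := by
    intro p hp j
    refine norm_le_of_prod_one_sub_le (fun j => ν j p) (by exact_mod_cast p.2.two_le) m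
      (fun i => ?_) j
    have hpi : p ∉ s i := fun hcon => hp (Finset.mem_biUnion.mpr ⟨i, Finset.mem_univ _, hcon⟩)
    have := hs i p hpi
    rw [norm_prod] at this
    simp only [norm_inv] at this
    rw [Finset.prod_inv_distrib] at this
    have h3 := le_inv_of_le_inv₀ (by norm_num) this
    norm_num at h3
    simpa using h3
  -- exceptional primes
  obtain ⟨M, hM⟩ : ∃ M : ℝ, ∀ p ∈ S, ∀ j, ‖ν j p‖ ≤ M := by
    refine ⟨∑ p ∈ S, ∑ j, ‖ν j p‖, fun p hp j => ?_⟩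
    calc ‖ν j p‖ ≤ ∑ j, ‖ν j p‖ :=
          Finset.single_le_sum (f := fun j => ‖ν j p‖) (fun _ _ => norm_nonneg _)
            (Finset.mem_univ j)
      _ ≤ _ := Finset.single_le_sum (f := fun p : Nat.Primes => ∑ j, ‖ν j p‖)
            (fun _ _ => Finset.sum_nonneg fun _ _ => norm_nonneg _) hp
  obtain ⟨K₁, hK₁⟩ := pow_unbounded_of_one_lt (max M (3 * 4 ^ r)) (by norm_num : (1 : ℝ) < 2)
  refine ⟨K₁ + (m + r), fun p hp j => ?_⟩
  have hp2 : (2 : ℝ) ≤ p := by exact_mod_cast hp.two_le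
  have hpK : (2 : ℝ) ^ K₁ ≤ (p : ℝ) ^ K₁ := pow_le_pow_left₀ (by norm_num) hp2 _
  have hp1 : (1 : ℝ) ≤ (p : ℝ) ^ (m + r) := one_le_pow₀ (by linarith)
  rw [pow_add]
  by_cases hpS : (⟨p, hp⟩ : Nat.Primes) ∈ S
  · calc ‖ν j p‖ ≤ M := hM _ hpS j
      _ ≤ (p : ℝ) ^ K₁ := (le_max_left _ _).trans (hK₁.le.trans hpK)
      _ ≤ _ := le_mul_of_one_le_right (by positivity) hp1
  · refine (hbig ⟨p, hp⟩ hpS j).trans ?_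
    gcongr
    exact (le_max_right _ _).trans (hK₁.le.trans hpK)

/-- The completely multiplicative function with prescribed values at the primes. -/
noncomputable def complMul (v : ℕ → ℂ) : ℕ →*₀ ℂ where
  toFun n := if n = 0 then 0 else n.factorization.prod fun p e => v p ^ e
  map_zero' := by simp
  map_one' := by simp
  map_mul' m n := by
    by_cases hm : m = 0
    · simp [hm]
    by_cases hn : n = 0
    · simp [hn]
    simp only [hm, hn, mul_eq_zero, or_self, if_false]
    rw [Nat.factorization_mul hm hn, Finsupp.prod_add_index' (by simp) (by simp [pow_add])]

lemma complMul_prime (v : ℕ → ℂ) {p : ℕ} (hp : p.Prime) : complMul v p = v p := by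
  change (if p = 0 then 0 else p.factorization.prod fun p e => v p ^ e) = v p
  simp [hp.ne_zero, hp.factorization]

lemma norm_complMul_le {v : ℕ → ℂ} {K : ℕ} (hv : ∀ p : ℕ, p.Prime → ‖v p‖ ≤ (p : ℝ) ^ K)
    (n : ℕ) (hn : n ≠ 0) : ‖complMul v n‖ ≤ (n : ℝ) ^ K := by
  induction n using Nat.recOnMul with
  | zero => simp
  | one => simp
  | prime p hp => rw [complMul_prime v hp]; exact hv p hp
  | mul m n hm hn' =>
    have hm0 : m ≠ 0 := fun h => hn (by simp [h])
    have hn0 : n ≠ 0 := fun h => hn (by simp [h])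
    rw [map_mul, norm_mul, Nat.cast_mul, mul_pow]
    exact mul_le_mul (hm hm0) (hn' hn0) (norm_nonneg _) (by positivity)

lemma complMul_LSeriesHasSum {v : ℕ → ℂ} {K : ℕ}
    (hv : ∀ p : ℕ, p.Prime → ‖v p‖ ≤ (p : ℝ) ^ K) {s : ℂ} (hs : (K : ℝ) + 1 < s.re) :
    LSeriesSummable (complMul v) s ∧
      HasProd (fun p : Nat.Primes => (1 - v p / ((p : ℕ) : ℂ) ^ s)⁻¹) (LSeries (complMul v) s) := by
  have hsum : LSeriesSummable (complMul v) s := by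
    refine LSeriesSummable_of_le_const_mul_rpow (x := K + 1) hs ⟨1, fun n hn => ?_⟩
    rw [one_mul, add_sub_cancel_right, Real.rpow_natCast]
    exact norm_complMul_le hv n hn
  refine ⟨hsum, ?_⟩
  have hs0 : s ≠ 0 := fun h => by
    rw [h, Complex.zero_re] at hs
    have : (0 : ℝ) ≤ K := Nat.cast_nonneg K
    linarith
  let f : ℕ →*₀ ℂ :=
    { toFun := fun n => complMul v n * (n : ℂ) ^ (-s)
      map_zero' := by simp
      map_one' := by simp
      map_mul' := fun m n => by
        rw [map_mul, Nat.cast_mul, Complex.natCast_mul_natCast_cpow]; ring }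
  have hterm : ∀ n, f n = LSeries.term (complMul v) s n := by
    intro n
    rcases eq_or_ne n 0 with rfl | hn
    · simp
    · rw [LSeries.term_of_ne_zero hn]
      change complMul v n * (n : ℂ) ^ (-s) = _
      rw [Complex.cpow_neg, div_eq_mul_inv]
  have hfs : Summable (‖f ·‖) := by
    simp only [hterm]
    exact hsum.norm
  have := EulerProduct.eulerProduct_completely_multiplicative_hasProd hfs
  convert this using 1
  · funext p
    change _ = (1 - complMul v p * ((p : ℕ) : ℂ) ^ (-s))⁻¹
    rw [complMul_prime v p.2, Complex.cpow_neg, div_eq_mul_inv]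
  · exact (tsum_congr hterm).symm

/-- The arithmetic function underlying `complMul`. -/
noncomputable def complMulArith (v : ℕ → ℂ) : ArithmeticFunction ℂ := ⟨complMul v, map_zero _⟩

/-- Values of an arithmetic function at the powers of `p`, as a power series. -/
noncomputable def localSeries (p : ℕ) (f : ℕ → ℂ) : PowerSeries ℂ :=
  PowerSeries.mk fun m => f (p ^ m)

/-- The divisors of p^m are powers of p, so Dirichlet convolution restricts to the Cauchy product.
-/
lemma localSeries_mul {p : ℕ} (hp : p.Prime) (f g : ArithmeticFunction ℂ) :
    localSeries p (f * g : ArithmeticFunction ℂ) = localSeries p f * localSeries p g := by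
  ext m
  rw [localSeries, PowerSeries.coeff_mk, PowerSeries.coeff_mul, ArithmeticFunction.mul_apply,
    Nat.sum_divisorsAntidiagonal (fun i j => f i * g j), Nat.sum_divisors_prime_pow hp,
    Finset.Nat.sum_antidiagonal_eq_sum_range_succ_mk]
  refine Finset.sum_congr rfl fun i hi => ?_
  have him : i ≤ m := by simpa [Nat.lt_succ_iff] using hi
  simp only [localSeries, PowerSeries.coeff_mk]
  rw [Nat.pow_div him hp.pos]

lemma localSeries_one {p : ℕ} (hp : p.Prime) :
    localSeries p (1 : ArithmeticFunction ℂ) = 1 := by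
  ext m
  rw [localSeries, PowerSeries.coeff_mk, PowerSeries.coeff_one, ArithmeticFunction.one_apply]
  congr 1
  simp [hp.ne_one]

lemma localSeries_complMul {p : ℕ} (hp : p.Prime) (v : ℕ → ℂ) :
    localSeries p (complMulArith v) * (1 - PowerSeries.C (v p) * PowerSeries.X) = 1 := by
  have hc : ∀ m, complMulArith v (p ^ m) = v p ^ m := fun m => by
    change complMul v (p ^ m) = _
    rw [map_pow, complMul_prime v hp]
  ext m
  rw [mul_sub, mul_one, ← mul_assoc, map_sub]
  rcases m with _ | m
  · simp [localSeries, hc, PowerSeries.coeff_zero_mul_X]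
  · rw [PowerSeries.coeff_succ_mul_X, PowerSeries.coeff_mul_C]
    simp [localSeries, hc, pow_succ, PowerSeries.coeff_one]

/-- Dirichlet coefficients at the prime powers are determined by the local Euler factors. -/
lemma localSeries_mul_prod_eq_one {L : ℂ → ℂ} {a : ℕ → ℂ} {r : ℕ} {ν : Fin r → ℕ → ℂ}
    (hd : ∀ s : ℂ, 1 < s.re → LSeriesHasSum a s (L s)) (ha : ∃ n ≠ 0, a n ≠ 0)
    (h : ∀ s : ℂ, 1 < s.re →
      HasProd (fun p : Nat.Primes => ∏ j : Fin r, (1 - ν j p / ((p : ℕ) : ℂ) ^ s)⁻¹) (L s))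
    {p : ℕ} (hp : p.Prime) :
    localSeries p a * ∏ j, (1 - PowerSeries.C (ν j p) * PowerSeries.X) = 1 := by
  classical
  obtain ⟨K, hK⟩ := exists_norm_le_pow (eventually_ne_zero_of_LSeriesHasSum hd ha) h
  have hsum : ∀ s : ℂ, (K : ℝ) + 1 < s.re → ∀ S : Finset (Fin r),
      LSeriesHasSum (∏ j ∈ S, complMulArith (ν j) : ArithmeticFunction ℂ) s
        (∏ j ∈ S, LSeries (complMul (ν j)) s) := by
    intro s hs S
    induction S using Finset.induction_on with
    | empty =>
      rw [Finset.prod_empty, Finset.prod_empty]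
      have h1 := hasSum_single (f := LSeries.term (1 : ArithmeticFunction ℂ) s) 1
        (fun n hn => by simp [LSeries.term, hn])
      rwa [show LSeries.term (1 : ArithmeticFunction ℂ) s 1 = 1 by simp [LSeries.term]] at h1
    | insert j S hj ih =>
      rw [Finset.prod_insert hj, Finset.prod_insert hj]
      exact ArithmeticFunction.LSeriesHasSum_mul
        (complMul_LSeriesHasSum (fun p hp => hK p hp j) hs).1.LSeriesHasSum ih
  have hprod : ∀ s : ℂ, (K : ℝ) + 1 < s.re →
      L s = ∏ j, LSeries (complMul (ν j)) s := by
    intro s hs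
    have hs1 : 1 < s.re := by
      have : (0 : ℝ) ≤ K := Nat.cast_nonneg K
      linarith
    exact (h s hs1).unique
      (hasProd_prod fun j _ => (complMul_LSeriesHasSum (fun p hp => hK p hp j) hs).2)
  set b : ArithmeticFunction ℂ := ∏ j, complMulArith (ν j) with hb
  -- Far to the right the Euler product splits into the r Dirichlet series of `complMul (ν j)`, and
  -- uniqueness of Dirichlet coefficients identifies `a` with their convolution.
  have hab : ∀ n ≠ 0, a n = b n := by
    intro n hn
    refine LSeries.eq_of_LSeries_eventually_eq (f := a) (g := b) ?_ ?_ ?_ hn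
    · exact ((hd 2 (by norm_num)).LSeriesSummable.abscissaOfAbsConv_le).trans_lt
        (EReal.coe_lt_top _)
    · exact ((hsum ((K : ℝ) + 2 : ℝ) (by rw [Complex.ofReal_re]; linarith)
        Finset.univ).LSeriesSummable.abscissaOfAbsConv_le).trans_lt (EReal.coe_lt_top _)
    · filter_upwards [eventually_gt_atTop ((K : ℝ) + 1)] with x hx
      have hx1 : 1 < x := by
        have : (0 : ℝ) ≤ K := Nat.cast_nonneg K
        linarith
      rw [(hd x (by simpa using hx1)).LSeries_eq, hprod x (by simpa using hx)]
      exact (hsum x (by simpa using hx) Finset.univ).LSeries_eq.symm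
  have hloc : localSeries p a = ∏ j, localSeries p (complMulArith (ν j)) := by
    have h1 : localSeries p a = localSeries p b := by
      ext m
      simp only [localSeries, PowerSeries.coeff_mk]
      exact hab _ (pow_ne_zero _ hp.ne_zero)
    rw [h1, hb]
    have : ∀ S : Finset (Fin r),
        localSeries p (∏ j ∈ S, complMulArith (ν j) : ArithmeticFunction ℂ) =
          ∏ j ∈ S, localSeries p (complMulArith (ν j)) := by
      intro S
      induction S using Finset.induction_on with
      | empty => rw [Finset.prod_empty, Finset.prod_empty]; exact localSeries_one hp
      | insert j S hj ih =>
        rw [Finset.prod_insert hj, Finset.prod_insert hj, localSeries_mul hp, ih]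
    exact this Finset.univ
  rw [hloc, ← Finset.prod_mul_distrib]
  exact Finset.prod_eq_one fun j _ => localSeries_complMul hp (ν j)

/-- The value of a power series multiplied by `1 - c X`. -/
lemma hasSum_mul_one_sub {A : PowerSeries ℂ} {z w : ℂ}
    (hA : HasSum (fun m => A.coeff m * z ^ m) w) (c : ℂ) :
    HasSum (fun m => (A * (1 - PowerSeries.C c * PowerSeries.X)).coeff m * z ^ m)
      (w * (1 - c * z)) := by
  have h1 : HasSum (fun m => (A * (PowerSeries.C c * PowerSeries.X)).coeff m * z ^ m)
      (w * (c * z)) := by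
    rw [← hasSum_nat_add_iff' 1]
    simp only [Finset.range_one, Finset.sum_singleton]
    rw [← mul_assoc, PowerSeries.coeff_zero_mul_X, zero_mul, sub_zero]
    have h2 := hA.mul_right (c * z)
    refine h2.congr_fun fun m => ?_
    rw [PowerSeries.coeff_succ_mul_X, PowerSeries.coeff_mul_C]
    ring
  have h2 := hA.sub h1
  rw [← mul_one_sub] at h2
  refine h2.congr_fun fun m => ?_
  rw [mul_sub, mul_one, map_sub, sub_mul]

lemma coeff_one_prod_one_sub {ι : Type*} (S : Finset ι) (c : ι → ℂ) :
    (∏ j ∈ S, (1 - PowerSeries.C (c j) * PowerSeries.X)).coeff 0 = 1 ∧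
    (∏ j ∈ S, (1 - PowerSeries.C (c j) * PowerSeries.X)).coeff 1 = -∑ j ∈ S, c j := by
  classical
  induction S using Finset.induction_on with
  | empty => simp [PowerSeries.coeff_one]
  | insert j S hj ih =>
    rw [Finset.prod_insert hj, sub_mul, one_mul, mul_assoc, mul_comm PowerSeries.X, ← mul_assoc,
      map_sub, map_sub, PowerSeries.coeff_zero_mul_X, ih.1, ih.2,
      PowerSeries.coeff_succ_mul_X 0, PowerSeries.coeff_C_mul, ih.1, Finset.sum_insert hj]
    constructor
    · ring
    · ring

/-- The Ramanujan bound makes the local series ∑ a(p^m) z^m converge for |z| < 1, while its product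
with ∏ (1 - ν_j z) is identically 1. A root with |ν_j| > 1 would make this product vanish at z =
1/ν_j inside the disc. Comparing coefficients of z gives a(p). -/
theorem exists_local_roots {L : ℂ → ℂ} {a : ℕ → ℂ} (h : IsSelbergPoly L a)
    (ha : ∃ n ≠ 0, a n ≠ 0) :
    ∃ (r : ℕ) (ν : Fin r → ℕ → ℂ), (∀ j p, p.Prime → ‖ν j p‖ ≤ 1) ∧
      (∀ p, p.Prime → a p = ∑ j, ν j p) ∧
      ∀ s : ℂ, 1 < s.re →
        HasProd (fun p : Nat.Primes => ∏ j : Fin r, (1 - ν j p / ((p : ℕ) : ℂ) ^ s)⁻¹) (L s) := by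
  classical
  obtain ⟨r, ν, hν⟩ := h.poly_euler
  have hloc : ∀ p : ℕ, p.Prime →
      localSeries p a * ∏ j, (1 - PowerSeries.C (ν j p) * PowerSeries.X) = 1 :=
    fun p hp => localSeries_mul_prod_eq_one h.dirichlet ha hν hp
  have ha1 : ∀ p : ℕ, p.Prime → a 1 = 1 := fun p hp => by
    have := congrArg (PowerSeries.coeff 0) (hloc p hp)
    rw [PowerSeries.coeff_mul] at this
    simpa [localSeries, (coeff_one_prod_one_sub Finset.univ fun j => ν j p).1,
      -PowerSeries.coeff_zero_eq_constantCoeff] using this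
  refine ⟨r, ν, fun j p hp => ?_, fun p hp => ?_, hν⟩
  · by_contra hcon
    push Not at hcon
    have hp1 : (1 : ℝ) < p := by exact_mod_cast hp.one_lt
    have hlogp : 0 < Real.log p := Real.log_pos hp1
    have hlogν : 0 < Real.log ‖ν j p‖ := Real.log_pos hcon
    -- Chosen so that p^ε is the square root of the norm of the root, hence smaller than it.
    set ε : ℝ := Real.log ‖ν j p‖ / (2 * Real.log p) with hε
    have hε0 : 0 < ε := by positivity
    have hpε : (p : ℝ) ^ ε < ‖ν j p‖ := by
      rw [Real.rpow_def_of_pos (by linarith), hε,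
        show Real.log p * (Real.log ‖ν j p‖ / (2 * Real.log p)) = Real.log ‖ν j p‖ / 2 by
          field_simp]
      calc Real.exp (Real.log ‖ν j p‖ / 2) < Real.exp (Real.log ‖ν j p‖) :=
            Real.exp_lt_exp.mpr (by linarith)
        _ = _ := Real.exp_log (by linarith)
    set z : ℂ := (ν j p)⁻¹ with hz
    have hsum : Summable fun m => (localSeries p a).coeff m * z ^ m := by
      have hO := (h.ramanujan ε hε0).comp_tendsto
        (tendsto_pow_atTop_atTop_of_one_lt hp.one_lt)
      have hO2 : (fun m => (localSeries p a).coeff m * z ^ m) =O[atTop]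
          fun m : ℕ => ((p : ℝ) ^ ε * ‖z‖) ^ m := by
        have h2 := hO.mul (isBigO_refl (fun m : ℕ => z ^ m) atTop).norm_right
        refine (h2.congr' ?_ ?_)
        · exact Eventually.of_forall fun m => by simp [localSeries]
        · exact Eventually.of_forall fun m => by
            simp only [Function.comp, Nat.cast_pow, norm_pow, mul_pow]
            rw [← Real.rpow_natCast, ← Real.rpow_natCast ((p : ℝ) ^ ε),
              ← Real.rpow_mul (by linarith), ← Real.rpow_mul (by linarith), mul_comm ε]
      refine summable_of_isBigO_nat (summable_geometric_of_lt_one (by positivity) ?_) hO2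
      rw [hz, norm_inv, ← div_eq_mul_inv, div_lt_one (by linarith)]
      exact hpε
    have hval : ∀ S : Finset (Fin r), HasSum (fun m =>
        (localSeries p a * ∏ i ∈ S, (1 - PowerSeries.C (ν i p) * PowerSeries.X)).coeff m * z ^ m)
        ((∑' m, (localSeries p a).coeff m * z ^ m) * ∏ i ∈ S, (1 - ν i p * z)) := by
      intro S
      induction S using Finset.induction_on with
      | empty => simpa using hsum.hasSum
      | insert i S hi ih =>
        have := hasSum_mul_one_sub ih (ν i p)
        rw [Finset.prod_insert hi, Finset.prod_insert hi]
        convert this using 1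
        · funext m; congr 2; ring
        · ring
    have h0 := hval Finset.univ
    rw [hloc p hp, Finset.prod_eq_zero (Finset.mem_univ j), mul_zero] at h0
    · have h1 : HasSum (fun m => (PowerSeries.coeff m (1 : PowerSeries ℂ)) * z ^ m) 1 := by
        convert hasSum_single (f := fun m => (PowerSeries.coeff m (1 : PowerSeries ℂ)) * z ^ m) 0 ?_
          using 1
        · simp
        · intro m hm; simp [PowerSeries.coeff_one, hm]
      exact zero_ne_one (h0.unique h1)
    · rw [hz, mul_inv_cancel₀, sub_self]
      intro h0; rw [h0, norm_zero] at hcon; linarith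
  · have := congrArg (PowerSeries.coeff 1) (hloc p hp)
    rw [PowerSeries.coeff_mul, Finset.Nat.sum_antidiagonal_eq_sum_range_succ_mk,
      Finset.sum_range_succ, Finset.sum_range_one] at this
    obtain ⟨e0, e1⟩ := coeff_one_prod_one_sub Finset.univ fun j => ν j p
    simp only [localSeries, PowerSeries.coeff_mk, pow_zero, pow_one, Nat.sub_zero, Nat.sub_self,
      e0, e1, ha1 p hp, PowerSeries.coeff_one, one_ne_zero, if_false] at this
    linear_combination this

/-! ### The logarithm of the Euler product -/

/-- The prime part `∑ a(p) p⁻ˢ` of the logarithm. -/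
noncomputable def primeSum (a : ℕ → ℂ) (s : ℂ) : ℂ := ∑' p : Nat.Primes, a p / ((p : ℕ) : ℂ) ^ s

/-- The contribution of the higher prime powers to the logarithm at `p`. -/
noncomputable def logTailTerm {r : ℕ} (ν : Fin r → ℕ → ℂ) (p : ℕ) (s : ℂ) : ℂ :=
  ∑ j, (-Complex.log (1 - ν j p / (p : ℂ) ^ s) - ν j p / (p : ℂ) ^ s)

/-- The contribution of the higher prime powers to the logarithm. -/
noncomputable def logTail {r : ℕ} (ν : Fin r → ℕ → ℂ) (s : ℂ) : ℂ :=
  ∑' p : Nat.Primes, logTailTerm ν p s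

lemma summable_primes_rpow {x : ℝ} (hx : 1 < x) :
    Summable fun p : Nat.Primes => ((p : ℕ) : ℝ) ^ (-x) :=
  Nat.Primes.summable_rpow.mpr (by linarith)

lemma norm_div_prime_cpow_le {p : ℕ} (hp : p.Prime) {w s : ℂ} {B : ℝ} (hw : ‖w‖ ≤ B) {σ : ℝ}
    (hs : σ ≤ s.re) : ‖w / (p : ℂ) ^ s‖ ≤ B * (p : ℝ) ^ (-σ) := by
  have hp0 : 0 < p := hp.pos
  have hp1 : (1 : ℝ) ≤ p := by exact_mod_cast hp0
  rw [norm_div, Complex.norm_natCast_cpow_of_pos hp0, div_eq_mul_inv,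
    ← Real.rpow_neg (by positivity)]
  have hB : 0 ≤ B := (norm_nonneg w).trans hw
  gcongr

lemma differentiableAt_div_prime_cpow {p : ℕ} (hp : p.Prime) (w s : ℂ) :
    DifferentiableAt ℂ (fun s => w / (p : ℂ) ^ s) s := by
  have hp0 : (p : ℂ) ≠ 0 := by exact_mod_cast hp.ne_zero
  refine DifferentiableAt.div (by fun_prop) ?_ (by simp [Complex.cpow_eq_zero_iff, hp0])
  exact differentiableAt_id.const_cpow (Or.inl hp0)

/-- The bound 2^(-1/2) ≤ 3/4 < 1 keeps 1 - ν / p^s in a disc about 1 for every prime, including p =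
2. No prime is exceptional for the principal logarithm. -/
lemma norm_div_prime_cpow_le_of_half {p : ℕ} (hp : p.Prime) {w s : ℂ} (hw : ‖w‖ ≤ 1)
    (hs : 1 / 2 ≤ s.re) : ‖w / (p : ℂ) ^ s‖ ≤ 3 / 4 := by
  have h := norm_div_prime_cpow_le hp hw hs
  rw [one_mul] at h
  refine h.trans ?_
  have h2 : (p : ℝ) ^ (-(1 / 2) : ℝ) ≤ (2 : ℝ) ^ (-(1 / 2) : ℝ) :=
    Real.rpow_le_rpow_of_nonpos (by norm_num) (by exact_mod_cast hp.two_le) (by norm_num)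
  refine h2.trans ?_
  rw [Real.rpow_neg (by norm_num), ← Real.sqrt_eq_rpow]
  have h3 : (4 / 3 : ℝ) ≤ √2 := Real.le_sqrt_of_sq_le (by norm_num)
  calc (√2)⁻¹ ≤ (4 / 3 : ℝ)⁻¹ := inv_anti₀ (by norm_num) h3
    _ = 3 / 4 := by norm_num

/-- Only the quadratic Taylor remainder of the logarithm is left, so the sum over primes converges
for Re s > 1/2. The exponent σ is separate from Re s so that the bound can be uniform on
half-planes. -/
lemma norm_logTailTerm_le {r : ℕ} {ν : Fin r → ℕ → ℂ} (hν : ∀ j p, p.Prime → ‖ν j p‖ ≤ 1)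
    {p : ℕ} (hp : p.Prime) {σ : ℝ} {s : ℂ} (hs : 1 / 2 ≤ s.re) (hσ : σ ≤ s.re) :
    ‖logTailTerm ν p s‖ ≤ r * (2 * (p : ℝ) ^ (-(2 * σ))) := by
  have key : ∀ j, ‖-Complex.log (1 - ν j p / (p : ℂ) ^ s) - ν j p / (p : ℂ) ^ s‖ ≤
      2 * (p : ℝ) ^ (-(2 * σ)) := by
    intro j
    set z := ν j p / (p : ℂ) ^ s with hz
    have hz1 : ‖z‖ ≤ 3 / 4 := norm_div_prime_cpow_le_of_half hp (hν j p hp) hs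
    have hz2 : ‖z‖ ≤ (p : ℝ) ^ (-σ) := by
      rw [← one_mul ((p : ℝ) ^ (-σ))]
      exact norm_div_prime_cpow_le hp (hν j p hp) hσ
    have h1 := Complex.norm_log_one_add_sub_self_le (z := -z) (by rw [norm_neg]; linarith)
    rw [norm_neg] at h1
    have h2 : ‖-Complex.log (1 - z) - z‖ = ‖Complex.log (1 + -z) - -z‖ := by
      rw [← norm_neg]; congr 1; ring_nf
    rw [h2]
    refine h1.trans ?_
    have h3 : (1 - ‖z‖)⁻¹ ≤ 4 := by
      rw [inv_le_comm₀ (by linarith) (by norm_num)]; linarith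
    have h4 : ‖z‖ ^ 2 ≤ (p : ℝ) ^ (-(2 * σ)) := by
      calc ‖z‖ ^ 2 ≤ ((p : ℝ) ^ (-σ)) ^ 2 := by gcongr
        _ = _ := by rw [← Real.rpow_natCast, ← Real.rpow_mul (by positivity)]; ring_nf
    calc ‖z‖ ^ 2 * (1 - ‖z‖)⁻¹ / 2 ≤ (p : ℝ) ^ (-(2 * σ)) * 4 / 2 := by
          gcongr
          exact inv_nonneg.mpr (by linarith)
      _ = _ := by ring
  calc ‖logTailTerm ν p s‖ ≤ ∑ j : Fin r, 2 * (p : ℝ) ^ (-(2 * σ)) :=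
        norm_sum_le_of_le _ fun j _ => key j
    _ = _ := by simp

lemma differentiableAt_logTailTerm {r : ℕ} {ν : Fin r → ℕ → ℂ}
    (hν : ∀ j p, p.Prime → ‖ν j p‖ ≤ 1) {p : ℕ} (hp : p.Prime) {s : ℂ} (hs : 1 / 2 ≤ s.re) :
    DifferentiableAt ℂ (logTailTerm ν p) s := by
  unfold logTailTerm
  refine DifferentiableAt.fun_sum fun j _ => ?_
  have h1 := differentiableAt_div_prime_cpow hp (ν j p) s
  refine (((differentiableAt_const 1).sub h1).clog ?_).neg.sub h1
  refine Or.inl ?_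
  have h2 := norm_div_prime_cpow_le_of_half hp (hν j p hp) hs
  have h3 := (Complex.abs_re_le_norm _).trans h2
  have h4 := le_abs_self (ν j p / (p : ℂ) ^ s).re
  simp only [Pi.sub_apply, Complex.sub_re, Complex.one_re]
  linarith

lemma isOpen_re_gt (x : ℝ) : IsOpen {s : ℂ | x < s.re} :=
  isOpen_lt continuous_const Complex.continuous_re

lemma differentiableOn_logTail {r : ℕ} {ν : Fin r → ℕ → ℂ}
    (hν : ∀ j p, p.Prime → ‖ν j p‖ ≤ 1) {σ : ℝ} (hσ : 1 / 2 < σ) :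
    DifferentiableOn ℂ (logTail ν) {s | σ < s.re} := by
  refine Complex.differentiableOn_tsum_of_summable_norm
    (u := fun p : Nat.Primes => r * (2 * ((p : ℕ) : ℝ) ^ (-(2 * σ)))) ?_ ?_ (isOpen_re_gt σ) ?_
  · exact ((summable_primes_rpow (by linarith)).mul_left _).mul_left _
  · intro p s hs
    have hs' : σ < s.re := hs
    exact (differentiableAt_logTailTerm hν p.2 (by linarith)).differentiableWithinAt
  · intro p s hs
    have hs' : σ < s.re := hs
    exact norm_logTailTerm_le hν p.2 (by linarith) hs'.le

lemma summable_logTailTerm {r : ℕ} {ν : Fin r → ℕ → ℂ} (hν : ∀ j p, p.Prime → ‖ν j p‖ ≤ 1)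
    {s : ℂ} (hs : 1 / 2 < s.re) : Summable fun p : Nat.Primes => logTailTerm ν p s :=
  Summable.of_norm_bounded
    (((summable_primes_rpow (x := 2 * s.re) (by linarith)).mul_left 2).mul_left (r : ℝ))
    fun p => norm_logTailTerm_le hν p.2 hs.le le_rfl

lemma exists_norm_logTail_le {r : ℕ} {ν : Fin r → ℕ → ℂ} (hν : ∀ j p, p.Prime → ‖ν j p‖ ≤ 1)
    {σ : ℝ} (hσ : 1 / 2 < σ) : ∃ C, 0 ≤ C ∧ ∀ s : ℂ, σ ≤ s.re → ‖logTail ν s‖ ≤ C := by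
  have hsum := ((summable_primes_rpow (x := 2 * σ) (by linarith)).mul_left 2).mul_left (r : ℝ)
  refine ⟨∑' p : Nat.Primes, r * (2 * ((p : ℕ) : ℝ) ^ (-(2 * σ))),
    tsum_nonneg fun p => by positivity, fun s hs => ?_⟩
  exact tsum_of_norm_bounded hsum.hasSum fun p => norm_logTailTerm_le hν p.2 (by linarith) hs

lemma summable_primeSum {a : ℕ → ℂ} {B : ℝ} (ha : ∀ p, p.Prime → ‖a p‖ ≤ B) {s : ℂ}
    (hs : 1 < s.re) : Summable fun p : Nat.Primes => a p / ((p : ℕ) : ℂ) ^ s :=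
  Summable.of_norm_bounded ((summable_primes_rpow hs).mul_left B)
    fun p => norm_div_prime_cpow_le p.2 (ha p p.2) le_rfl

lemma differentiableOn_primeSum {a : ℕ → ℂ} {B : ℝ} (ha : ∀ p, p.Prime → ‖a p‖ ≤ B) {σ : ℝ}
    (hσ : 1 < σ) : DifferentiableOn ℂ (primeSum a) {s | σ < s.re} := by
  refine Complex.differentiableOn_tsum_of_summable_norm
    (u := fun p : Nat.Primes => B * ((p : ℕ) : ℝ) ^ (-σ)) ?_ ?_ (isOpen_re_gt σ) ?_
  · exact (summable_primes_rpow hσ).mul_left _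
  · intro p s _
    exact (differentiableAt_div_prime_cpow p.2 _ s).differentiableWithinAt
  · intro p s hs
    exact norm_div_prime_cpow_le p.2 (ha p p.2) (le_of_lt hs)

lemma exists_norm_primeSum_le {a : ℕ → ℂ} {B : ℝ} (ha : ∀ p, p.Prime → ‖a p‖ ≤ B) :
    ∃ C, 0 ≤ C ∧ ∀ s : ℂ, 2 ≤ s.re → ‖primeSum a s‖ ≤ C := by
  have hsum := (summable_primes_rpow (x := 2) (by norm_num)).mul_left B
  have hB : 0 ≤ B := (norm_nonneg _).trans (ha 2 Nat.prime_two)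
  refine ⟨∑' p : Nat.Primes, B * ((p : ℕ) : ℝ) ^ (-2 : ℝ),
    tsum_nonneg fun p => by positivity, fun s hs => ?_⟩
  exact tsum_of_norm_bounded hsum.hasSum fun p => norm_div_prime_cpow_le p.2 (ha p p.2) hs

/-- In the half-plane of absolute convergence, `primeSum a + logTail ν` is a logarithm. -/
lemma exp_primeSum_add_logTail {L : ℂ → ℂ} {a : ℕ → ℂ} {r : ℕ} {ν : Fin r → ℕ → ℂ}
    (hν : ∀ j p, p.Prime → ‖ν j p‖ ≤ 1) (ha : ∀ p, p.Prime → a p = ∑ j, ν j p) {s : ℂ}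
    (hs : 1 < s.re)
    (h : HasProd (fun p : Nat.Primes => ∏ j : Fin r, (1 - ν j p / ((p : ℕ) : ℂ) ^ s)⁻¹) (L s)) :
    Complex.exp (primeSum a s + logTail ν s) = L s := by
  have hB : ∀ p, p.Prime → ‖a p‖ ≤ r := fun p hp => by
    rw [ha p hp]
    calc ‖∑ j, ν j p‖ ≤ ∑ j : Fin r, (1 : ℝ) := norm_sum_le_of_le _ fun j _ => hν j p hp
      _ = r := by simp
  have h1 : HasSum (fun p : Nat.Primes => a p / ((p : ℕ) : ℂ) ^ s + logTailTerm ν p s)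
      (primeSum a s + logTail ν s) :=
    (summable_primeSum hB hs).hasSum.add (summable_logTailTerm hν (by linarith)).hasSum
  refine (h1.cexp.congr_fun fun p => ?_).unique h |>.symm ▸ rfl
  have hp := p.2
  simp only [Function.comp]
  have h2 : a p / ((p : ℕ) : ℂ) ^ s + logTailTerm ν p s =
      ∑ j, -Complex.log (1 - ν j p / ((p : ℕ) : ℂ) ^ s) := by
    rw [logTailTerm, Finset.sum_sub_distrib, ha p hp, Finset.sum_div]
    ring
  rw [h2, Complex.exp_sum]
  refine Finset.prod_congr rfl fun j _ => ?_
  rw [Complex.exp_neg, Complex.exp_log]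
  intro h0
  have h3 := norm_div_prime_cpow_le_of_half hp (hν j p hp) (s := s) (by linarith)
  rw [← sub_eq_zero.mp h0, norm_one] at h3
  norm_num at h3

lemma tendsto_primeSum_add_logTail {a : ℕ → ℂ} {r : ℕ} {ν : Fin r → ℕ → ℂ} {B : ℝ}
    (hν : ∀ j p, p.Prime → ‖ν j p‖ ≤ 1) (ha : ∀ p, p.Prime → ‖a p‖ ≤ B) (y : ℝ) :
    Tendsto (fun x : ℝ => primeSum a (x + y * Complex.I) + logTail ν (x + y * Complex.I))
      atTop (𝓝 0) := by
  have hre : ∀ x : ℝ, ((x : ℂ) + y * Complex.I).re = x := fun x => by simp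
  have hB : 0 ≤ B := (norm_nonneg _).trans (ha 2 Nat.prime_two)
  have hbound : ∀ x : ℝ, 2 ≤ x → ∀ p : Nat.Primes,
      ((p : ℕ) : ℝ) ^ (-x) ≤ ((p : ℕ) : ℝ) ^ (-2 : ℝ) := fun x hx p =>
    Real.rpow_le_rpow_of_exponent_le (by exact_mod_cast p.2.one_le) (by linarith)
  have hlim : ∀ p : Nat.Primes, Tendsto (fun x : ℝ => ((p : ℕ) : ℝ) ^ (-x)) atTop (𝓝 0) :=
    fun p => (tendsto_rpow_atBot_of_base_gt_one _ (by exact_mod_cast p.2.one_lt)).comp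
      tendsto_neg_atTop_atBot
  have h1 : Tendsto (fun x : ℝ => primeSum a (x + y * Complex.I)) atTop (𝓝 0) := by
    rw [show (0 : ℂ) = ∑' _ : Nat.Primes, (0 : ℂ) by simp]
    refine tendsto_tsum_of_dominated_convergence
      (bound := fun p : Nat.Primes => B * ((p : ℕ) : ℝ) ^ (-2 : ℝ))
      ((summable_primes_rpow (by norm_num)).mul_left B) (fun p => ?_) ?_
    · refine squeeze_zero_norm (a := fun x : ℝ => B * ((p : ℕ) : ℝ) ^ (-x)) (fun x => ?_) ?_
      · exact norm_div_prime_cpow_le p.2 (ha p p.2) (hre x).ge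
      · simpa using (hlim p).const_mul B
    · filter_upwards [eventually_ge_atTop 2] with x hx p
      refine (norm_div_prime_cpow_le p.2 (ha p p.2) (hre x).ge).trans ?_
      exact mul_le_mul_of_nonneg_left (hbound x hx p) hB
  have h2 : Tendsto (fun x : ℝ => logTail ν (x + y * Complex.I)) atTop (𝓝 0) := by
    rw [show (0 : ℂ) = ∑' _ : Nat.Primes, (0 : ℂ) by simp]
    refine tendsto_tsum_of_dominated_convergence
      (bound := fun p : Nat.Primes => r * (2 * ((p : ℕ) : ℝ) ^ (-2 : ℝ)))
      (((summable_primes_rpow (by norm_num)).mul_left 2).mul_left (r : ℝ)) (fun p => ?_) ?_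
    · refine squeeze_zero_norm' (a := fun x : ℝ => r * (2 * ((p : ℕ) : ℝ) ^ (-x))) ?_ ?_
      · filter_upwards [eventually_ge_atTop 2] with x hx
        -- With σ = x/2 the factor p^(-2σ) is p^(-x), the same majorant as for the prime sum.
        have := norm_logTailTerm_le hν p.2 (s := x + y * Complex.I) (σ := x / 2)
          (by rw [hre]; linarith) (by rw [hre]; linarith)
        rwa [mul_div_cancel₀ x (two_ne_zero)] at this
      · simpa using ((hlim p).const_mul 2).const_mul (r : ℝ)
    · filter_upwards [eventually_ge_atTop 2] with x hx p
      have := norm_logTailTerm_le hν p.2 (s := x + y * Complex.I) (σ := x / 2)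
          (by rw [hre]; linarith) (by rw [hre]; linarith)
      rw [mul_div_cancel₀ x (two_ne_zero)] at this
      refine this.trans ?_
      have := hbound x hx p
      gcongr r * (2 * ?_)
  simpa using h1.add h2

/-! ### Branches of the logarithm on half-strips -/

/-- A nonvanishing holomorphic function on a convex open set has a holomorphic logarithm. -/
lemma exists_differentiableOn_log {U : Set ℂ} (hU : IsOpen U) (hc : Convex ℝ U) (hne : U.Nonempty)
    {g : ℂ → ℂ} (hg : DifferentiableOn ℂ g U) (hg0 : ∀ s ∈ U, g s ≠ 0) :
    ∃ F : ℂ → ℂ, DifferentiableOn ℂ F U ∧ ∀ s ∈ U, Complex.exp (F s) = g s := by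
  have hsc : IsSimplyConnected U := by
    have := hc.contractibleSpace hne
    exact SimplyConnectedSpace.ofContractible U
  obtain ⟨F, hFc, hF⟩ := Complex.exists_continuousOn_eqOn_exp_comp hsc hU hg.continuousOn
    (by rintro ⟨s, hs, h0⟩; exact hg0 s hs h0)
  refine ⟨F, fun z hz => ?_, fun s hs => hF hs⟩
  have hFz : ContinuousAt F z := hFc.continuousAt (hU.mem_nhds hz)
  -- The lifting gives only a continuous F. Near z it equals F z + Log (g w / g z), because F w - F
  -- z has imaginary part below π in absolute value; hence F is holomorphic.
  have hlog : DifferentiableAt ℂ (fun w => F z + Complex.log (g w / g z)) z := by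
    refine (differentiableAt_const _).add (DifferentiableAt.clog ?_ ?_)
    · exact (hg.differentiableAt (hU.mem_nhds hz)).div_const _
    · rw [div_self (hg0 z hz)]; exact Complex.one_mem_slitPlane
  refine (hlog.congr_of_eventuallyEq ?_).differentiableWithinAt
  have hnear : ∀ᶠ w in 𝓝 z, ‖F w - F z‖ < 1 := by
    have h := Metric.continuousAt_iff'.mp hFz 1 one_pos
    simpa [dist_eq_norm] using h
  filter_upwards [hnear, hU.mem_nhds hz] with w hw hwU
  have h1 : g w / g z = Complex.exp (F w - F z) := by
    rw [Complex.exp_sub]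
    exact congrArg₂ _ (hF hwU).symm (hF hz).symm
  have him : |(F w - F z).im| < 1 := (Complex.abs_im_le_norm _).trans_lt hw
  have hpi := Real.pi_gt_three
  rw [h1, Complex.log_exp (by linarith [(abs_lt.mp him).1]) (by linarith [(abs_lt.mp him).2])]
  ring

/-- The open half-strip `Re s > σ`, `|Im s - t| < h`. -/
def halfStrip (σ t h : ℝ) : Set ℂ := {s | σ < s.re ∧ |s.im - t| < h}

lemma isOpen_halfStrip (σ t h : ℝ) : IsOpen (halfStrip σ t h) := by
  have h1 : IsOpen {s : ℂ | |s.im - t| < h} :=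
    isOpen_lt (Complex.continuous_im.sub continuous_const).abs continuous_const
  exact (isOpen_re_gt σ).inter h1

lemma convex_halfStrip (σ t h : ℝ) : Convex ℝ (halfStrip σ t h) := by
  have : halfStrip σ t h = {s | σ < s.re} ∩ ({s | t - h < s.im} ∩ {s | s.im < t + h}) := by
    ext s
    simp only [halfStrip, Set.mem_ofPred_eq, Set.mem_inter_iff, abs_lt]
    constructor
    · rintro ⟨h1, h2, h3⟩; exact ⟨h1, by linarith, by linarith⟩
    · rintro ⟨h1, h2, h3⟩; exact ⟨h1, by linarith, by linarith⟩
  rw [this]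
  exact (convex_halfSpace_re_gt σ).inter
    ((convex_halfSpace_im_gt _).inter (convex_halfSpace_im_lt _))

/-- Compactness of [σ, 2] × [t - h, t + h] pushes the zero-free region a little to the left, and h <
t keeps it off the possible pole at 1. The width ε is not controlled, so no later estimate may
depend on it; it only makes the logarithm holomorphic across the line Re s = σ. -/
lemma exists_halfStrip_ne_zero {L : ℂ → ℂ} (hL : ∀ s, s ≠ 1 → DifferentiableAt ℂ L s)
    (hL1 : ∀ s : ℂ, 1 < s.re → L s ≠ 0) {σ t h : ℝ} (hσ2 : σ ≤ 2) (ht : h < t)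
    (h0 : ∀ s : ℂ, σ ≤ s.re → |s.im - t| ≤ h → L s ≠ 0) :
    ∃ ε > 0, ∀ s ∈ halfStrip (σ - ε) t h, L s ≠ 0 := by
  set K : Set ℂ := Set.Icc σ 2 ×ℂ Set.Icc (t - h) (t + h) with hK
  have hKc : IsCompact K := isCompact_Icc.reProdIm isCompact_Icc
  set O : Set ℂ := {1}ᶜ ∩ L ⁻¹' {0}ᶜ with hO
  have hOo : IsOpen O := by
    refine ContinuousOn.isOpen_inter_preimage (fun s hs => ?_) isOpen_compl_singleton
      isOpen_compl_singleton
    exact (hL s hs).continuousAt.continuousWithinAt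
  have hKO : K ⊆ O := by
    intro s hs
    obtain ⟨⟨h1, h2⟩, h3, h4⟩ := hs
    refine ⟨fun hs1 => ?_, h0 s h1 (abs_le.mpr ⟨by linarith, by linarith⟩)⟩
    rw [Set.mem_singleton_iff.mp hs1, Complex.one_im] at h3
    linarith
  obtain ⟨ε, hε, hεO⟩ := hKc.exists_thickening_subset_open hOo hKO
  refine ⟨ε, hε, fun s hs => ?_⟩
  obtain ⟨hs1, hs2⟩ := hs
  by_cases hσ : σ ≤ s.re
  · exact h0 s hσ hs2.le
  by_cases h2 : 1 < s.re
  · exact hL1 s h2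
  push Not at hσ h2
  have him := abs_lt.mp hs2
  have hmem : s ∈ Metric.thickening ε K := by
    refine Metric.mem_thickening_iff.mpr ⟨σ + s.im * Complex.I, ⟨?_, ?_⟩, ?_⟩
    · simpa using hσ2
    · simp only [Set.mem_preimage, Complex.add_im, Complex.ofReal_im, Complex.mul_im,
        Complex.ofReal_re, Complex.I_im, Complex.I_re, mul_one, mul_zero, zero_add, add_zero,
        Set.mem_Icc]
      constructor <;> linarith
    · have : s - (σ + s.im * Complex.I) = ((s.re - σ : ℝ) : ℂ) := by
        apply Complex.ext <;> simp
      rw [dist_eq_norm, this, Complex.norm_real, Real.norm_eq_abs, abs_lt]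
      constructor <;> linarith
  exact (hεO hmem).2

/-- A holomorphic logarithm on a zero-free half-strip can be normalised to agree with a given
logarithm in the half-plane `Re s > 1`. -/
lemma exists_log_halfStrip {L ℓ : ℂ → ℂ} {σ t h : ℝ} (hh : 0 < h) (hσ : σ ≤ 1)
    (hL : DifferentiableOn ℂ L (halfStrip σ t h)) (h0 : ∀ s ∈ halfStrip σ t h, L s ≠ 0)
    (hℓ : ∀ s : ℂ, 1 < s.re → DifferentiableAt ℂ ℓ s)
    (hℓL : ∀ s : ℂ, 1 < s.re → Complex.exp (ℓ s) = L s) :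
    ∃ F : ℂ → ℂ, DifferentiableOn ℂ F (halfStrip σ t h) ∧
      (∀ s ∈ halfStrip σ t h, Complex.exp (F s) = L s) ∧
      ∀ s ∈ halfStrip σ t h, 1 < s.re → F s = ℓ s := by
  set s₁ : ℂ := 2 + t * Complex.I with hs₁
  have hs₁V : s₁ ∈ halfStrip 1 t h := by
    refine ⟨?_, ?_⟩ <;> simp [hs₁, hh]
  have hsub : halfStrip 1 t h ⊆ halfStrip σ t h := fun s hs => ⟨hσ.trans_lt hs.1, hs.2⟩
  obtain ⟨F, hFd, hF⟩ := exists_differentiableOn_log (isOpen_halfStrip σ t h)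
    (convex_halfStrip σ t h) ⟨s₁, hsub hs₁V⟩ hL h0
  have hD : DifferentiableOn ℂ (fun s => F s - ℓ s) (halfStrip 1 t h) := fun s hs =>
    ((hFd.mono hsub) s hs).sub (hℓ s hs.1).differentiableWithinAt
  have hexp : ∀ s ∈ halfStrip 1 t h, Complex.exp (F s - ℓ s) = 1 := fun s hs => by
    rw [Complex.exp_sub, hF s (hsub hs), hℓL s hs.1, div_self (h0 s (hsub hs))]
  -- Since exp (F - ℓ) is constant, the derivative of F - ℓ vanishes. The two logarithms differ by a
  -- constant on the connected half-strip Re s > 1, and this constant is subtracted from F.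
  have hderiv : (halfStrip 1 t h).EqOn (deriv fun s => F s - ℓ s) 0 := by
    intro s hs
    have hnh := (isOpen_halfStrip 1 t h).mem_nhds hs
    have h1 := (hD.differentiableAt hnh).hasDerivAt.cexp
    have h2 : HasDerivAt (fun s => Complex.exp (F s - ℓ s)) 0 s := by
      refine (hasDerivAt_const s (1 : ℂ)).congr_of_eventuallyEq ?_
      filter_upwards [hnh] with w hw using hexp w hw
    have h3 := h1.unique h2
    simpa [hexp s hs] using h3
  have hconst : ∀ s ∈ halfStrip 1 t h, F s - ℓ s = F s₁ - ℓ s₁ := fun s hs =>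
    (isOpen_halfStrip 1 t h).is_const_of_deriv_eq_zero (convex_halfStrip 1 t h).isPreconnected
      hD hderiv hs hs₁V
  refine ⟨fun s => F s - (F s₁ - ℓ s₁), hFd.sub_const _, fun s hs => ?_, fun s hs hs1 => ?_⟩
  · rw [Complex.exp_sub, hexp s₁ hs₁V, div_one, hF s hs]
  · rw [← hconst s ⟨hs1, hs.2⟩]; ring

/-- The bound `O(1 / d)` for a logarithm at distance `d` from the left edge of a half-strip. -/
lemma norm_le_div_of_re_le {F : ℂ → ℂ} {σ t h M C₀ : ℝ} (hσ0 : 0 ≤ σ) (hσ2 : σ < 2) (hM : 0 < M)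
    (hF : DifferentiableOn ℂ F (halfStrip σ t h))
    (hre : ∀ s ∈ halfStrip σ t h, s.re ≤ 4 → (F s).re ≤ M)
    (h2 : ∀ s ∈ halfStrip σ t h, s.re = 2 → ‖F s‖ ≤ C₀)
    {x y : ℝ} (hx : σ < x) (hx2 : x ≤ 2) (hy : |y - t| + 2 ≤ h) :
    ‖F (x + y * Complex.I)‖ ≤ (4 * M + 4 * C₀) / (x - σ) := by
  have hball : ∀ z ∈ Metric.ball (0 : ℂ) (2 - σ),
      (2 + y * Complex.I + z) ∈ halfStrip σ t h ∧ (2 + y * Complex.I + z).re ≤ 4 := by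
    intro z hz
    rw [mem_ball_zero_iff] at hz
    have h1 := (Complex.abs_re_le_norm z).trans_lt hz
    have h3 := (Complex.abs_im_le_norm z).trans_lt hz
    rw [abs_lt] at h1
    refine ⟨⟨?_, ?_⟩, ?_⟩
    · simp; linarith
    · have : (2 + y * Complex.I + z).im - t = (y - t) + z.im := by simp; ring
      rw [this]
      calc |(y - t) + z.im| ≤ |y - t| + |z.im| := abs_add_le _ _
        _ < h := by linarith
    · simp; linarith
  -- The disc about 2 + iy of radius 2 - σ touches the left edge, so the distance from x + iy to its
  -- boundary circle is x - σ. Its radius is at most 2, which explains the bounds Re s ≤ 4 and |y -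
  -- t| + 2 ≤ h.
  have hBC := Complex.borelCaratheodory (f := fun z => F (2 + y * Complex.I + z)) (M := M)
    (R := 2 - σ) (z := ((x - 2 : ℝ) : ℂ)) hM ?_ ?_ (by linarith) ?_
  · have hnorm : ‖((x - 2 : ℝ) : ℂ)‖ = 2 - x := by
      rw [Complex.norm_real, Real.norm_eq_abs, abs_of_nonpos (by linarith)]; ring
    have hpt : 2 + y * Complex.I + ((x - 2 : ℝ) : ℂ) = x + y * Complex.I := by push_cast; ring
    simp only [hpt, hnorm, add_zero] at hBC
    refine hBC.trans ?_
    have hC : ‖F (2 + y * Complex.I)‖ ≤ C₀ := by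
      refine h2 _ ?_ (by simp)
      have := (hball 0 (by simpa using hσ2)).1
      simpa using this
    have hC0 : 0 ≤ C₀ := (norm_nonneg _).trans hC
    rw [← add_div, show 2 - σ - (2 - x) = x - σ by ring]
    have hd : 0 < x - σ := by linarith
    refine div_le_div_of_nonneg_right (add_le_add ?_ ?_) hd.le
    · nlinarith
    · calc ‖F (2 + y * Complex.I)‖ * (2 - σ + (2 - x)) ≤ C₀ * 4 := by
            gcongr
            linarith
        _ = 4 * C₀ := by ring
  · intro z hz
    have h1 := (hball z hz).1
    have hd := hF.differentiableAt ((isOpen_halfStrip σ t h).mem_nhds h1)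
    have : DifferentiableAt ℂ (fun z => 2 + y * Complex.I + z) z := by fun_prop
    exact (DifferentiableAt.comp z hd this).differentiableWithinAt
  · intro z hz
    exact hre _ (hball z hz).1 (hball z hz).2
  · rw [mem_ball_zero_iff, Complex.norm_real, Real.norm_eq_abs, abs_of_nonpos (by linarith)]
    linarith

/-! ### Analyticity away from 1 and growth of finite order. -/

lemma IsSelberg.differentiableAt {L : ℂ → ℂ} {a : ℕ → ℂ} (h : IsSelberg L a) {s : ℂ}
    (hs : s ≠ 1) : DifferentiableAt ℂ L s := by
  obtain ⟨m, G, hG, hGL, -⟩ := h.continuation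
  have h1 : DifferentiableAt ℂ (fun s => G s / (s - 1) ^ m) s :=
    (hG s).div (by fun_prop) (pow_ne_zero _ (sub_ne_zero.mpr hs))
  refine h1.congr_of_eventuallyEq ?_
  filter_upwards [isOpen_compl_singleton.mem_nhds hs] with w hw
  rw [hGL w hw, mul_div_cancel_left₀ _ (pow_ne_zero _ (sub_ne_zero.mpr hw))]

/-- Dividing by (s - 1)^m costs nothing once |s - 1| ≥ 1. Finite order bounds log |L(s)| by a power
of |s|, and this is enough because the kernel beats every power of t. -/
lemma IsSelberg.exists_growth {L : ℂ → ℂ} {a : ℕ → ℂ} (h : IsSelberg L a) :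
    ∃ B C R : ℝ, 0 < B ∧ 0 < C ∧ 2 ≤ R ∧ ∀ s : ℂ, R ≤ ‖s‖ → ‖L s‖ ≤ Real.exp (C * ‖s‖ ^ B) := by
  obtain ⟨m, G, -, hGL, B, hB, hO⟩ := h.continuation
  obtain ⟨c, hc⟩ := hO.bound
  rw [← comap_norm_atTop, eventually_comap, eventually_atTop] at hc
  obtain ⟨R, hR⟩ := hc
  refine ⟨B, |Real.log (|c| + 1)| + 1, max R 2, hB, by positivity, le_max_right _ _,
    fun s hs => ?_⟩
  have hs2 : 2 ≤ ‖s‖ := (le_max_right _ _).trans hs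
  have h1 := hR ‖s‖ ((le_max_left _ _).trans hs) s rfl
  have hs1 : 1 ≤ ‖s - 1‖ := by
    have := norm_le_norm_add_norm_sub (1 : ℂ) s
    rw [norm_one, norm_sub_rev] at this
    linarith
  have hne : s ≠ 1 := fun h0 => by rw [h0, sub_self, norm_zero] at hs1; linarith
  rw [hGL s hne, norm_mul, norm_pow, Real.norm_of_nonneg (Real.exp_pos _).le] at h1
  have h2 : 1 ≤ ‖s - 1‖ ^ m := one_le_pow₀ hs1
  have h3 : (1 : ℝ) ≤ ‖s‖ ^ B := Real.one_le_rpow (by linarith) hB.le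
  calc ‖L s‖ ≤ ‖s - 1‖ ^ m * ‖L s‖ := le_mul_of_one_le_left (norm_nonneg _) h2
    _ ≤ c * Real.exp (‖s‖ ^ B) := h1
    _ ≤ (|c| + 1) * Real.exp (‖s‖ ^ B) := by
        gcongr
        linarith [le_abs_self c]
    _ = Real.exp (Real.log (|c| + 1) + ‖s‖ ^ B) := by
        rw [Real.exp_add, Real.exp_log (by positivity)]
    _ ≤ _ := by
        gcongr
        have := le_abs_self (Real.log (|c| + 1))
        have := abs_nonneg (Real.log (|c| + 1))
        nlinarith

/-! ### A Gaussian kernel and the contour shift -/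

/-- The kernel `exp (A z²) - exp (-A H²)`: it vanishes at `z = ± i H` and is nonnegative on the
segment between these points. -/
noncomputable def kernel (A H : ℝ) (z : ℂ) : ℂ := Complex.exp (A * z ^ 2) - Real.exp (-(A * H ^ 2))

lemma kernel_I (A H u : ℝ) :
    kernel A H (u * Complex.I) = ((Real.exp (-(A * u ^ 2)) - Real.exp (-(A * H ^ 2)) : ℝ) : ℂ) := by
  rw [kernel, mul_pow, Complex.I_sq]
  push_cast
  ring_nf

lemma differentiable_kernel (A H : ℝ) : Differentiable ℂ (kernel A H) := by
  unfold kernel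
  fun_prop

/-- For z = d ± iH one has exp(A z²) = exp(-A H²) e^w with w = O(d), so the kernel vanishes to first
order as d → 0. The factor d is what pays for the bound O(1/d) of the logarithm. -/
lemma norm_kernel_corner_le {A H d y : ℝ} (hA : 0 ≤ A) (hH : 0 ≤ H) (hd : 0 ≤ d) (hd2 : d ≤ 2)
    (hy : y = H ∨ y = -H) :
    ‖kernel A H (d + y * Complex.I)‖ ≤
      d * (A * (2 + 2 * H) * Real.exp (A * (4 + 4 * H - H ^ 2))) := by
  have hy2 : y ^ 2 = H ^ 2 := by rcases hy with rfl | rfl <;> ring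
  have hyabs : |y| = H := by rcases hy with rfl | rfl <;> simp [abs_of_nonneg hH]
  set w : ℂ := A * (d * (d + 2 * y * Complex.I)) with hw
  have h1 : kernel A H (d + y * Complex.I) =
      Real.exp (-(A * H ^ 2)) * (Complex.exp w - 1) := by
    rw [kernel, mul_sub, mul_one, Complex.ofReal_exp, ← Complex.exp_add]
    congr 2
    have : (y : ℂ) ^ 2 = (H : ℂ) ^ 2 := by exact_mod_cast hy2
    rw [hw]
    push_cast
    linear_combination (A : ℂ) * (y : ℂ) ^ 2 * Complex.I_sq - (A : ℂ) * this
  have h2 : ‖w‖ ≤ d * (A * (2 + 2 * H)) := by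
    have h3 : ‖(d : ℂ) + 2 * y * Complex.I‖ ≤ 2 + 2 * H := by
      calc ‖(d : ℂ) + 2 * y * Complex.I‖ ≤ ‖(d : ℂ)‖ + ‖(2 * y * Complex.I : ℂ)‖ := norm_add_le _ _
        _ = d + 2 * H := by
          simp [abs_of_nonneg hd, hyabs]
        _ ≤ _ := by linarith
    calc ‖w‖ = A * (d * ‖(d : ℂ) + 2 * y * Complex.I‖) := by
          rw [hw, norm_mul, norm_mul, Complex.norm_real, Complex.norm_real,
            Real.norm_of_nonneg hA, Real.norm_of_nonneg hd]
      _ ≤ A * (d * (2 + 2 * H)) := by gcongr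
      _ = _ := by ring
  have h4 : ‖Complex.exp w - 1‖ ≤ ‖w‖ * Real.exp ‖w‖ := by
    simpa using Complex.norm_exp_sub_sum_le_norm_mul_exp w 1
  have h5 : d * (A * (2 + 2 * H)) ≤ A * (4 + 4 * H) := by
    have : d * (A * (2 + 2 * H)) ≤ 2 * (A * (2 + 2 * H)) := by gcongr
    linarith
  rw [h1, norm_mul, Complex.norm_real, Real.norm_of_nonneg (Real.exp_pos _).le]
  calc Real.exp (-(A * H ^ 2)) * ‖Complex.exp w - 1‖
      ≤ Real.exp (-(A * H ^ 2)) * (d * (A * (2 + 2 * H)) * Real.exp (A * (4 + 4 * H))) := by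
        gcongr
        refine h4.trans ?_
        gcongr
        exact h2.trans h5
    _ = d * (A * (2 + 2 * H)) * (Real.exp (-(A * H ^ 2)) * Real.exp (A * (4 + 4 * H))) := by ring
    _ = _ := by
        rw [← Real.exp_add]
        ring_nf

/-- Cauchy's theorem on [σ, 2] × [t - H, t + H]. On the two horizontal edges f may grow like Q / (x
- σ), and the first-order zero of the kernel at the left corners makes the integrand bounded there.
-/
lemma norm_integral_left_sub_right_le {f : ℂ → ℂ} {σ t H A Q : ℝ} (hσ0 : 0 ≤ σ) (hσ2' : σ < 2)
    (hH : 0 ≤ H) (hA : 0 ≤ A)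
    (hf : DifferentiableOn ℂ f (Set.Icc σ 2 ×ℂ Set.Icc (t - H) (t + H)))
    (hedge : ∀ x y : ℝ, σ < x → x ≤ 2 → |y - t| = H → ‖f (x + y * Complex.I)‖ ≤ Q / (x - σ)) :
    ‖(∫ y in (t - H)..(t + H),
        f (σ + y * Complex.I) * kernel A H (((y - t : ℝ) : ℂ) * Complex.I)) -
      ∫ y in (t - H)..(t + H), f (2 + y * Complex.I) *
        kernel A H ((2 - σ : ℝ) + ((y - t : ℝ) : ℂ) * Complex.I)‖ ≤
      4 * (Q * (A * (2 + 2 * H) * Real.exp (A * (4 + 4 * H - H ^ 2)))) := by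
  have hσ2 := hσ2'.le
  set E : ℝ := Q * (A * (2 + 2 * H) * Real.exp (A * (4 + 4 * H - H ^ 2))) with hE
  set g : ℂ → ℂ := fun s => f s * kernel A H (s - (σ + t * Complex.I)) with hg
  have hgd : DifferentiableOn ℂ g (Set.Icc σ 2 ×ℂ Set.Icc (t - H) (t + H)) := by
    refine hf.mul (Differentiable.differentiableOn ?_)
    exact (differentiable_kernel A H).comp (by fun_prop)
  have hrect := Complex.integral_boundary_rect_eq_zero_of_differentiableOn g
    (σ + (t - H : ℝ) * Complex.I) (2 + (t + H : ℝ) * Complex.I) (by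
      have e1 : ((σ : ℂ) + (t - H : ℝ) * Complex.I).re = σ := by simp
      have e2 : ((σ : ℂ) + (t - H : ℝ) * Complex.I).im = t - H := by simp
      have e3 : ((2 : ℂ) + (t + H : ℝ) * Complex.I).re = 2 := by simp
      have e4 : ((2 : ℂ) + (t + H : ℝ) * Complex.I).im = t + H := by simp
      rw [e1, e2, e3, e4, Set.uIcc_of_le hσ2, Set.uIcc_of_le (by linarith)]
      exact hgd)
  have e1 : ((σ : ℂ) + (t - H : ℝ) * Complex.I).re = σ := by simp
  have e2 : ((σ : ℂ) + (t - H : ℝ) * Complex.I).im = t - H := by simp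
  have e3 : ((2 : ℂ) + (t + H : ℝ) * Complex.I).re = 2 := by simp
  have e4 : ((2 : ℂ) + (t + H : ℝ) * Complex.I).im = t + H := by simp
  rw [e1, e2, e3, e4] at hrect
  have hhor : ∀ y : ℝ, |y - t| = H → ‖∫ x in σ..2, g (x + y * Complex.I)‖ ≤ 2 * E := by
    intro y hy
    have hb : ∀ x ∈ Set.uIoc σ 2, ‖g (x + y * Complex.I)‖ ≤ E := by
      intro x hx
      rw [Set.uIoc_of_le hσ2] at hx
      have h1 := hedge x y hx.1 hx.2 hy
      have hyy : y - t = H ∨ y - t = -H := by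
        rcases abs_choice (y - t) with h | h
        · left; linarith
        · right; linarith
      have h2 := norm_kernel_corner_le (d := x - σ) hA hH (by linarith [hx.1])
        (by linarith [hx.2]) hyy
      have h3 : (x : ℂ) + y * Complex.I - (σ + t * Complex.I) =
          ((x - σ : ℝ) : ℂ) + ((y - t : ℝ) : ℂ) * Complex.I := by push_cast; ring
      have hd : 0 < x - σ := by linarith [hx.1]
      simp only [hg]
      rw [norm_mul, h3]
      calc _ ≤ Q / (x - σ) * ((x - σ) *
            (A * (2 + 2 * H) * Real.exp (A * (4 + 4 * H - H ^ 2)))) :=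
            mul_le_mul h1 h2 (norm_nonneg _) ((norm_nonneg _).trans h1)
        _ = E := by rw [hE]; field_simp
    have hE0 : 0 ≤ E :=
      (norm_nonneg _).trans (hb 2 (by rw [Set.uIoc_of_le hσ2]; exact ⟨hσ2', le_rfl⟩))
    refine (intervalIntegral.norm_integral_le_of_norm_le_const hb).trans ?_
    rw [abs_of_nonneg (by linarith)]
    nlinarith
  have hbot := hhor (t - H) (by rw [show t - H - t = -H by ring, abs_neg, abs_of_nonneg hH])
  have htop := hhor (t + H) (by rw [show t + H - t = H by ring, abs_of_nonneg hH])
  have hleft : (∫ y in (t - H)..(t + H), g ((σ : ℂ) + y * Complex.I)) =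
      ∫ y in (t - H)..(t + H),
        f (σ + y * Complex.I) * kernel A H (((y - t : ℝ) : ℂ) * Complex.I) := by
    refine intervalIntegral.integral_congr fun y _ => ?_
    simp only [hg]
    congr 2
    push_cast; ring
  have hright : (∫ y in (t - H)..(t + H), g (((2 : ℝ) : ℂ) + y * Complex.I)) =
      ∫ y in (t - H)..(t + H), f (2 + y * Complex.I) *
        kernel A H ((2 - σ : ℝ) + ((y - t : ℝ) : ℂ) * Complex.I) := by
    refine intervalIntegral.integral_congr fun y _ => ?_
    simp only [hg]
    push_cast
    congr 2
    ring
  rw [hleft, hright] at hrect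
  set Lf := ∫ y in (t - H)..(t + H),
        f (σ + y * Complex.I) * kernel A H (((y - t : ℝ) : ℂ) * Complex.I)
  set Rt := ∫ y in (t - H)..(t + H), f (2 + y * Complex.I) *
        kernel A H ((2 - σ : ℝ) + ((y - t : ℝ) : ℂ) * Complex.I)
  have hI : Complex.I * (Lf - Rt) = (∫ x in σ..2, g (x + (t - H : ℝ) * Complex.I)) -
      ∫ x in σ..2, g (x + (t + H : ℝ) * Complex.I) := by
    simp only [smul_eq_mul] at hrect
    linear_combination -hrect
  calc ‖Lf - Rt‖ = ‖Complex.I * (Lf - Rt)‖ := by simp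
    _ ≤ 2 * E + 2 * E := by rw [hI]; exact (norm_sub_le _ _).trans (add_le_add hbot htop)
    _ = 4 * E := by ring

/-! ### Gaussian smoothing of the prime sum -/

/-- The sum `∑ a(p) p^{-σ-it} exp (-(log p)² / (4 * A))` over primes. -/
noncomputable def smoothSum (a : ℕ → ℂ) (A σ t : ℝ) : ℂ :=
  ∑' p : Nat.Primes, a p / ((p : ℕ) : ℂ) ^ (σ + t * Complex.I : ℂ) *
    (Real.exp (-(Real.log p ^ 2 / (4 * A))) : ℂ)

lemma norm_cexp_mul_sq (A d u : ℝ) :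
    ‖Complex.exp (A * (d + u * Complex.I) ^ 2)‖ =
      Real.exp (A * d ^ 2) * Real.exp (-A * u ^ 2) := by
  rw [Complex.norm_exp, ← Real.exp_add]
  congr 1
  simp [pow_two]
  ring

lemma integrable_exp_neg_mul_sub_sq {A : ℝ} (hA : 0 < A) (t : ℝ) :
    MeasureTheory.Integrable fun y : ℝ => Real.exp (-A * (y - t) ^ 2) :=
  (integrable_exp_neg_mul_sq hA).comp_sub_right t

lemma integral_exp_neg_mul_sub_sq (A t : ℝ) :
    ∫ y : ℝ, Real.exp (-A * (y - t) ^ 2) = √(Real.pi / A) := by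
  rw [MeasureTheory.integral_sub_right_eq_self (fun y : ℝ => Real.exp (-A * y ^ 2)) t,
    integral_gaussian]

/-- The Fourier transform of a Gaussian. Completing the square brings the abscissa 2 back to σ, so
the outcome carries p^(-σ-it) although the integral runs over Re s = 2. -/
lemma integral_cpow_mul_gauss {A : ℝ} (hA : 0 < A) (σ t : ℝ) {p : ℕ} (hp : 0 < p) :
    ∫ y : ℝ, ((p : ℂ) ^ ((2 : ℂ) + y * Complex.I))⁻¹ *
        Complex.exp (A * (((2 - σ : ℝ) : ℂ) + ((y - t : ℝ) : ℂ) * Complex.I) ^ 2) =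
      (√(Real.pi / A) : ℂ) * (((p : ℂ) ^ (σ + t * Complex.I : ℂ))⁻¹ *
        (Real.exp (-(Real.log p ^ 2 / (4 * A))) : ℂ)) := by
  have hpc : (p : ℂ) ≠ 0 := by exact_mod_cast hp.ne'
  have hAc : (A : ℂ) ≠ 0 := by exact_mod_cast hA.ne'
  have hlog : Complex.log (p : ℂ) = (Real.log p : ℂ) := (Complex.natCast_log).symm
  set ℓ : ℝ := Real.log p with hℓ
  have hcongr : ∀ y : ℝ, ((p : ℂ) ^ ((2 : ℂ) + y * Complex.I))⁻¹ *
        Complex.exp (A * (((2 - σ : ℝ) : ℂ) + ((y - t : ℝ) : ℂ) * Complex.I) ^ 2) =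
      Complex.exp (-(A : ℂ) * (y : ℂ) ^ 2 +
        (2 * Complex.I * A * ((2 - σ) - t * Complex.I) - Complex.I * ℓ) * y +
        (A * ((2 - σ) - t * Complex.I) ^ 2 - 2 * ℓ)) := by
    intro y
    rw [Complex.cpow_def_of_ne_zero hpc, hlog, ← Complex.exp_neg, ← Complex.exp_add]
    congr 1
    push_cast
    linear_combination (A : ℂ) * (y : ℂ) ^ 2 * Complex.I_sq
  simp_rw [hcongr]
  rw [integral_cexp_quadratic (by simpa using hA), neg_neg]
  have hsqrt : ((Real.pi : ℂ) / A) ^ (1 / 2 : ℂ) = (√(Real.pi / A) : ℂ) := by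
    rw [Real.sqrt_eq_rpow, Complex.ofReal_cpow (by positivity)]
    push_cast
    rfl
  rw [hsqrt]
  congr 1
  rw [Complex.cpow_def_of_ne_zero hpc, hlog, ← Complex.exp_neg, Complex.ofReal_exp,
    ← Complex.exp_add]
  congr 1
  push_cast
  field_simp
  linear_combination ((2 * (A : ℂ) * (2 - σ - t * Complex.I) - ℓ) ^ 2) * Complex.I_sq

lemma integral_primeSum_mul_gauss {a : ℕ → ℂ} {B : ℝ} (ha : ∀ p, p.Prime → ‖a p‖ ≤ B) {A : ℝ}
    (hA : 0 < A) (σ t : ℝ) :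
    ∫ y : ℝ, primeSum a (2 + y * Complex.I) *
        Complex.exp (A * (((2 - σ : ℝ) : ℂ) + ((y - t : ℝ) : ℂ) * Complex.I) ^ 2) =
      (√(Real.pi / A) : ℂ) * smoothSum a A σ t := by
  have hB : 0 ≤ B := (norm_nonneg _).trans (ha 2 Nat.prime_two)
  set F : Nat.Primes → ℝ → ℂ := fun p y => a p / ((p : ℕ) : ℂ) ^ ((2 : ℂ) + y * Complex.I) *
    Complex.exp (A * (((2 - σ : ℝ) : ℂ) + ((y - t : ℝ) : ℂ) * Complex.I) ^ 2) with hF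
  have hpc : ∀ p : Nat.Primes, ((p : ℕ) : ℂ) ≠ 0 := fun p => by exact_mod_cast p.2.ne_zero
  have hbound : ∀ (p : Nat.Primes) (y : ℝ), ‖F p y‖ ≤ B * ((p : ℕ) : ℝ) ^ (-2 : ℝ) *
      (Real.exp (A * (2 - σ) ^ 2) * Real.exp (-A * (y - t) ^ 2)) := by
    intro p y
    simp only [hF]
    rw [norm_mul, norm_cexp_mul_sq]
    gcongr
    exact norm_div_prime_cpow_le p.2 (ha p p.2) (by simp)
  have hcont : ∀ p, Continuous (F p) := by
    intro p
    simp only [hF]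
    refine Continuous.mul (Continuous.div (by fun_prop) ?_ ?_) (by fun_prop)
    · exact Continuous.const_cpow (by fun_prop) (Or.inl (hpc p))
    · intro y; simp [Complex.cpow_eq_zero_iff, hpc p]
  have hgint : ∀ p : Nat.Primes, MeasureTheory.Integrable fun y : ℝ =>
      B * ((p : ℕ) : ℝ) ^ (-2 : ℝ) *
      (Real.exp (A * (2 - σ) ^ 2) * Real.exp (-A * (y - t) ^ 2)) := fun p =>
    ((integrable_exp_neg_mul_sub_sq hA t).const_mul _).const_mul _
  have hInt : ∀ p, MeasureTheory.Integrable (F p) := fun p =>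
    (hgint p).mono' (hcont p).aestronglyMeasurable (Eventually.of_forall (hbound p))
  have hsum : Summable fun p => ∫ y, ‖F p y‖ := by
    refine Summable.of_nonneg_of_le (fun p => MeasureTheory.integral_nonneg fun y => norm_nonneg _)
      (fun p => MeasureTheory.integral_mono (hInt p).norm (hgint p) (hbound p)) ?_
    simp_rw [MeasureTheory.integral_const_mul]
    exact ((summable_primes_rpow (by norm_num)).mul_left B).mul_right _
  have hex := MeasureTheory.integral_tsum_of_summable_integral_norm hInt hsum
  have hlhs : (fun y : ℝ => primeSum a (2 + y * Complex.I) *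
        Complex.exp (A * (((2 - σ : ℝ) : ℂ) + ((y - t : ℝ) : ℂ) * Complex.I) ^ 2)) =
      fun y => ∑' p, F p y := by
    funext y
    simp only [hF, primeSum]
    rw [tsum_mul_right]
  rw [hlhs, ← hex, smoothSum, ← tsum_mul_left]
  refine tsum_congr fun p => ?_
  have := integral_cpow_mul_gauss hA σ t p.2.pos
  have h2 : ∀ y : ℝ, F p y = a p * (((p : ℂ) ^ ((2 : ℂ) + y * Complex.I))⁻¹ *
        Complex.exp (A * (((2 - σ : ℝ) : ℂ) + ((y - t : ℝ) : ℂ) * Complex.I) ^ 2)) := by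
    intro y; simp only [hF]; ring
  simp_rw [h2]
  rw [MeasureTheory.integral_const_mul, this]
  ring

/-- On Re s = 2 the prime sum is bounded, so extending the segment to the whole line and dropping
the constant exp(-A H²) of the kernel are both cheap. The factor exp(4A) is the size of exp(A (2 -
σ)²). -/
lemma norm_integral_right_sub_smoothSum_le {a : ℕ → ℂ} {B C₁ : ℝ}
    (ha : ∀ p, p.Prime → ‖a p‖ ≤ B) (hC₁ : ∀ s : ℂ, 2 ≤ s.re → ‖primeSum a s‖ ≤ C₁) {A H σ : ℝ}
    (hA : 1 ≤ A) (hH : 0 ≤ H) (hσ0 : 0 ≤ σ) (hσ2 : σ ≤ 2) (t : ℝ) :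
    ‖(∫ y in (t - H)..(t + H), primeSum a (2 + y * Complex.I) *
        kernel A H ((2 - σ : ℝ) + ((y - t : ℝ) : ℂ) * Complex.I)) -
      (√(Real.pi / A) : ℂ) * smoothSum a A σ t‖ ≤
      C₁ * (2 * H + 3) * Real.exp (A * (4 - H ^ 2 / 2)) := by
  have hA0 : 0 < A := by linarith
  have hC₁0 : 0 ≤ C₁ := (norm_nonneg _).trans (hC₁ 2 (by simp))
  set e : ℝ → ℂ := fun y =>
    Complex.exp (A * (((2 - σ : ℝ) : ℂ) + ((y - t : ℝ) : ℂ) * Complex.I) ^ 2) with he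
  set P : ℝ → ℂ := fun y => primeSum a (2 + y * Complex.I) with hP
  have hPc : Continuous P := by
    rw [continuous_iff_continuousAt]
    intro y
    have h1 : (2 + y * Complex.I : ℂ) ∈ {s : ℂ | 3 / 2 < s.re} := by
      simp; norm_num
    have h2 : ContinuousAt (primeSum a) (2 + y * Complex.I) :=
      ((differentiableOn_primeSum ha (σ := 3 / 2) (by norm_num)).differentiableAt
        ((isOpen_re_gt _).mem_nhds h1)).continuousAt
    exact ContinuousAt.comp (f := fun y : ℝ => (2 + y * Complex.I : ℂ)) h2 (by fun_prop)
  have hec : Continuous e := by simp only [he]; fun_prop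
  have hPn : ∀ y, ‖P y‖ ≤ C₁ := fun y => hC₁ _ (by simp)
  have hen : ∀ y, ‖e y‖ ≤ Real.exp (4 * A) * Real.exp (-A * (y - t) ^ 2) := by
    intro y
    simp only [he]
    rw [norm_cexp_mul_sq]
    gcongr ?_ * _
    rw [Real.exp_le_exp]
    have : (2 - σ) ^ 2 ≤ 4 := by nlinarith
    nlinarith
  have hInt : MeasureTheory.Integrable fun y => P y * e y := by
    refine MeasureTheory.Integrable.mono'
      (((integrable_exp_neg_mul_sub_sq hA0 t).const_mul (Real.exp (4 * A))).const_mul C₁)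
      (hPc.mul hec).aestronglyMeasurable (Eventually.of_forall fun y => ?_)
    rw [norm_mul]
    exact mul_le_mul (hPn y) (hen y) (norm_nonneg _) hC₁0
  have hfull := integral_primeSum_mul_gauss ha hA0 σ t
  have hle : t - H ≤ t + H := by linarith
  have hker : (∫ y in (t - H)..(t + H), P y *
        kernel A H ((2 - σ : ℝ) + ((y - t : ℝ) : ℂ) * Complex.I)) =
      (∫ y in (t - H)..(t + H), P y * e y) -
        ∫ y in (t - H)..(t + H), P y * (Real.exp (-(A * H ^ 2)) : ℂ) := by
    have i₁ : IntervalIntegrable (fun y => P y * e y) MeasureTheory.volume (t - H) (t + H) :=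
      (hPc.mul hec).intervalIntegrable _ _
    have i₂ : IntervalIntegrable (fun y => P y * (Real.exp (-(A * H ^ 2)) : ℂ))
        MeasureTheory.volume (t - H) (t + H) :=
      (hPc.mul continuous_const).intervalIntegrable _ _
    rw [← intervalIntegral.integral_sub i₁ i₂]
    refine intervalIntegral.integral_congr fun y _ => ?_
    simp only [kernel, he]
    ring
  have hconst : ‖∫ y in (t - H)..(t + H), P y * (Real.exp (-(A * H ^ 2)) : ℂ)‖ ≤
      C₁ * (2 * H) * Real.exp (A * (4 - H ^ 2 / 2)) := by
    have := intervalIntegral.norm_integral_le_of_norm_le_const (a := t - H) (b := t + H)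
      (f := fun y => P y * (Real.exp (-(A * H ^ 2)) : ℂ))
      (C := C₁ * Real.exp (A * (4 - H ^ 2 / 2))) (fun y _ => by
        rw [norm_mul, Complex.norm_real, Real.norm_of_nonneg (Real.exp_pos _).le]
        refine mul_le_mul (hPn y) ?_ (Real.exp_pos _).le hC₁0
        rw [Real.exp_le_exp]
        nlinarith [sq_nonneg H])
    rw [show t + H - (t - H) = 2 * H by ring, abs_of_nonneg (by linarith)] at this
    linarith
  have htail : ‖(∫ y in (t - H)..(t + H), P y * e y) - ∫ y, P y * e y‖ ≤
      C₁ * 3 * Real.exp (A * (4 - H ^ 2 / 2)) := by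
    rw [intervalIntegral.integral_of_le hle,
      ← MeasureTheory.integral_add_compl (measurableSet_Ioc (a := t - H) (b := t + H)) hInt,
      sub_add_cancel_left, norm_neg]
    have hgi := ((integrable_exp_neg_mul_sub_sq (half_pos hA0) t).const_mul
      (C₁ * Real.exp (A * (4 - H ^ 2 / 2))))
    calc ‖∫ y in (Set.Ioc (t - H) (t + H))ᶜ, P y * e y‖
        ≤ ∫ y in (Set.Ioc (t - H) (t + H))ᶜ, C₁ * Real.exp (A * (4 - H ^ 2 / 2)) *
            Real.exp (-(A / 2) * (y - t) ^ 2) := by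
          refine MeasureTheory.norm_integral_le_of_norm_le hgi.integrableOn ?_
          refine (MeasureTheory.ae_restrict_iff' measurableSet_Ioc.compl).mpr
            (Eventually.of_forall fun y hy => ?_)
          have hy2 : H ^ 2 ≤ (y - t) ^ 2 := by
            rw [Set.mem_compl_iff, Set.mem_Ioc, not_and_or, not_lt, not_le] at hy
            rcases hy with h | h <;> nlinarith
          rw [norm_mul, mul_assoc]
          refine mul_le_mul (hPn y) ((hen y).trans ?_) (norm_nonneg _) hC₁0
          rw [← Real.exp_add, ← Real.exp_add, Real.exp_le_exp]
          -- For |y - t| ≥ H, half of the exponent is traded for -A H² / 2 and the other half is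
          -- kept to integrate over the line.
          nlinarith
      _ ≤ ∫ y, C₁ * Real.exp (A * (4 - H ^ 2 / 2)) * Real.exp (-(A / 2) * (y - t) ^ 2) :=
          MeasureTheory.setIntegral_le_integral hgi (Eventually.of_forall fun y => by positivity)
      _ = C₁ * Real.exp (A * (4 - H ^ 2 / 2)) * √(Real.pi / (A / 2)) := by
          rw [MeasureTheory.integral_const_mul, integral_exp_neg_mul_sub_sq]
      _ ≤ C₁ * Real.exp (A * (4 - H ^ 2 / 2)) * 3 := by
          gcongr
          rw [Real.sqrt_le_left (by norm_num), div_le_iff₀ (by positivity)]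
          nlinarith [Real.pi_lt_four]
      _ = _ := by ring
  have hsplit : (∫ y in (t - H)..(t + H), P y *
        kernel A H ((2 - σ : ℝ) + ((y - t : ℝ) : ℂ) * Complex.I)) -
      (√(Real.pi / A) : ℂ) * smoothSum a A σ t =
      ((∫ y in (t - H)..(t + H), P y * e y) - ∫ y, P y * e y) -
        ∫ y in (t - H)..(t + H), P y * (Real.exp (-(A * H ^ 2)) : ℂ) := by
    rw [hker, ← hfull]; ring
  rw [hsplit]
  refine (norm_sub_le _ _).trans ((add_le_add htail hconst).trans (le_of_eq ?_))
  ring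

/-! ### Large values near a point above a zero-free half-strip -/

lemma exists_logBranch {L : ℂ → ℂ} {a : ℕ → ℂ} (hL : IsSelberg L a) {r : ℕ} {ν : Fin r → ℕ → ℂ}
    (hν : ∀ j p, p.Prime → ‖ν j p‖ ≤ 1) (haν : ∀ p, p.Prime → a p = ∑ j, ν j p)
    (hprod : ∀ s : ℂ, 1 < s.re →
      HasProd (fun p : Nat.Primes => ∏ j : Fin r, (1 - ν j p / ((p : ℕ) : ℂ) ^ s)⁻¹) (L s))
    {B : ℝ} (hB : ∀ p, p.Prime → ‖a p‖ ≤ B) {σ t h : ℝ} (hσ : σ < 1) (hh : 0 < h) (ht : h < t)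
    (h0 : ∀ s : ℂ, σ ≤ s.re → |s.im - t| ≤ h → L s ≠ 0) :
    ∃ ε > 0, ∃ F : ℂ → ℂ, DifferentiableOn ℂ F (halfStrip (σ - ε) t h) ∧
      (∀ s ∈ halfStrip (σ - ε) t h, Complex.exp (F s) = L s) ∧
      ∀ s ∈ halfStrip (σ - ε) t h, 1 < s.re → F s = primeSum a s + logTail ν s := by
  have hexp : ∀ s : ℂ, 1 < s.re → Complex.exp (primeSum a s + logTail ν s) = L s :=
    fun s hs => exp_primeSum_add_logTail hν haν hs (hprod s hs)
  obtain ⟨ε, hε, hεL⟩ := exists_halfStrip_ne_zero (fun s hs => hL.differentiableAt hs)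
    (fun s hs => hexp s hs ▸ Complex.exp_ne_zero _) (by linarith) ht h0
  refine ⟨ε, hε, exists_log_halfStrip hh (by linarith) (fun s hs => ?_) hεL (fun s hs => ?_) hexp⟩
  · refine (hL.differentiableAt fun h1 => ?_).differentiableWithinAt
    have := (abs_lt.mp hs.2).1
    rw [h1, Complex.one_im] at this
    linarith
  · obtain ⟨x, hx1, hx2⟩ := exists_between hs
    have hn := (isOpen_re_gt x).mem_nhds hx2
    exact ((differentiableOn_primeSum hB hx1).differentiableAt hn).add
      ((differentiableOn_logTail hν (by linarith)).differentiableAt hn)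

lemma integral_weight_le {A H : ℝ} (hA : 0 < A) (hH : 0 ≤ H) (t : ℝ) :
    ∫ y in (t - H)..(t + H), (Real.exp (-(A * (y - t) ^ 2)) - Real.exp (-(A * H ^ 2))) ≤
      √(Real.pi / A) := by
  have hle : t - H ≤ t + H := by linarith
  have hi := integrable_exp_neg_mul_sub_sq hA t
  calc ∫ y in (t - H)..(t + H), (Real.exp (-(A * (y - t) ^ 2)) - Real.exp (-(A * H ^ 2)))
      ≤ ∫ y in (t - H)..(t + H), Real.exp (-A * (y - t) ^ 2) := by
        refine intervalIntegral.integral_mono_on hle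
          (Continuous.intervalIntegrable (by fun_prop) _ _)
          (Continuous.intervalIntegrable (by fun_prop) _ _) fun y _ => ?_
        rw [neg_mul]
        linarith [Real.exp_pos (-(A * H ^ 2))]
    _ ≤ ∫ y, Real.exp (-A * (y - t) ^ 2) := by
        rw [intervalIntegral.integral_of_le hle]
        exact MeasureTheory.setIntegral_le_integral hi
          (Eventually.of_forall fun y => (Real.exp_pos _).le)
    _ = _ := integral_exp_neg_mul_sub_sq A t

/-- If the integral of `f` against the kernel is large, so is `f` somewhere. -/
lemma exists_le_re_of_integral {f : ℝ → ℂ} {A H t V Err : ℝ} {S ζ : ℂ} (hA : 1 ≤ A) (hH : 0 ≤ H)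
    (hf : ContinuousOn f (Set.Icc (t - H) (t + H))) (hV : 0 ≤ V) (hErr : 0 < Err) (hζ : ‖ζ‖ ≤ 1)
    (hInt : ‖(∫ y in (t - H)..(t + H), f y * kernel A H (((y - t : ℝ) : ℂ) * Complex.I)) -
      (√(Real.pi / A) : ℂ) * S‖ ≤ Err)
    (hS : V + A * Err ≤ (ζ * S).re) :
    ∃ y ∈ Set.Icc (t - H) (t + H), V ≤ (ζ * f y).re := by
  by_contra hcon
  push Not at hcon
  have hA0 : 0 < A := by linarith
  have hle : t - H ≤ t + H := by linarith
  set k : ℝ → ℝ := fun y => Real.exp (-(A * (y - t) ^ 2)) - Real.exp (-(A * H ^ 2)) with hk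
  have hkc : Continuous k := by simp only [hk]; fun_prop
  have hk0 : ∀ y ∈ Set.Icc (t - H) (t + H), 0 ≤ k y := by
    intro y hy
    simp only [hk]
    rw [sub_nonneg, Real.exp_le_exp]
    have : (y - t) ^ 2 ≤ H ^ 2 := by
      rw [sq_le_sq, abs_of_nonneg hH, abs_le]
      constructor <;> linarith [hy.1, hy.2]
    nlinarith
  have hfk : ContinuousOn (fun y => f y * (k y : ℂ)) (Set.Icc (t - H) (t + H)) :=
    hf.mul (Complex.continuous_ofReal.comp hkc).continuousOn
  have hker : (∫ y in (t - H)..(t + H), f y * kernel A H (((y - t : ℝ) : ℂ) * Complex.I)) =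
      ∫ y in (t - H)..(t + H), f y * (k y : ℂ) := by
    refine intervalIntegral.integral_congr fun y _ => ?_
    simp only [kernel_I, hk]
  rw [hker] at hInt
  set J := ∫ y in (t - H)..(t + H), f y * (k y : ℂ) with hJ
  have hre : (ζ * J).re = ∫ y in (t - H)..(t + H), (ζ * f y).re * k y := by
    rw [hJ, ← intervalIntegral.integral_const_mul]
    have hii : IntervalIntegrable (fun y => ζ * (f y * (k y : ℂ))) MeasureTheory.volume
        (t - H) (t + H) := by
      refine ContinuousOn.intervalIntegrable ?_
      rw [Set.uIcc_of_le hle]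
      exact continuousOn_const.mul hfk
    have := Complex.reCLM.intervalIntegral_comp_comm hii
    simp only [Complex.reCLM_apply] at this
    rw [← this]
    refine intervalIntegral.integral_congr fun y _ => ?_
    simp only [← mul_assoc, Complex.re_mul_ofReal]
  have hupper : (ζ * J).re ≤ V * √(Real.pi / A) := by
    rw [hre]
    calc ∫ y in (t - H)..(t + H), (ζ * f y).re * k y
        ≤ ∫ y in (t - H)..(t + H), V * k y := by
          refine intervalIntegral.integral_mono_on hle ?_
            ((continuous_const.mul hkc).intervalIntegrable _ _) fun y hy => ?_
          · refine ContinuousOn.intervalIntegrable ?_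
            rw [Set.uIcc_of_le hle]
            exact (Complex.continuous_re.comp_continuousOn (continuousOn_const.mul hf)).mul
              hkc.continuousOn
          · exact mul_le_mul_of_nonneg_right (hcon y hy).le (hk0 y hy)
      _ = V * ∫ y in (t - H)..(t + H), k y := intervalIntegral.integral_const_mul _ _
      _ ≤ _ := mul_le_mul_of_nonneg_left (integral_weight_le hA0 hH t) hV
  have hlower : √(Real.pi / A) * (ζ * S).re - Err ≤ (ζ * J).re := by
    have h1 : |(ζ * (J - (√(Real.pi / A) : ℂ) * S)).re| ≤ Err := by
      refine (Complex.abs_re_le_norm _).trans ?_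
      rw [norm_mul]
      calc _ ≤ 1 * Err := mul_le_mul hζ hInt (norm_nonneg _) zero_le_one
        _ = Err := one_mul _
    have h2 : (ζ * (J - (√(Real.pi / A) : ℂ) * S)).re =
        (ζ * J).re - √(Real.pi / A) * (ζ * S).re := by
      rw [← Complex.re_ofReal_mul, ← Complex.sub_re]; congr 1; ring
    rw [h2] at h1
    linarith [(abs_le.mp h1).1]
  -- This is √(π A) > 1, so a margin of A * Err in the hypothesis on S outweighs Err after
  -- multiplication by √(π / A).
  have hs1 : 1 < √(Real.pi / A) * A := by
    have hs0 : 0 ≤ √(Real.pi / A) * A := by positivity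
    have : (√(Real.pi / A) * A) ^ 2 = Real.pi * A := by
      rw [mul_pow, Real.sq_sqrt (by positivity)]; field_simp
    nlinarith [Real.pi_gt_three]
  have hs : 0 < √(Real.pi / A) := Real.sqrt_pos.mpr (by positivity)
  nlinarith [mul_le_mul_of_nonneg_left hS hs.le]

/-- Transfers a large smoothed prime sum at t to a large logarithm at some nearby y. The constants
depend only on L, its coefficients, its local roots and σ. The extra D absorbs the bounded tail of
the logarithm, and the 3 added to H leaves room for the discs of radius at most 2 in
`norm_le_div_of_re_le`. -/
theorem exists_large_logValue {L : ℂ → ℂ} {a : ℕ → ℂ} (hL : IsSelberg L a) {r : ℕ}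
    {ν : Fin r → ℕ → ℂ} (hν : ∀ j p, p.Prime → ‖ν j p‖ ≤ 1)
    (haν : ∀ p, p.Prime → a p = ∑ j, ν j p)
    (hprod : ∀ s : ℂ, 1 < s.re →
      HasProd (fun p : Nat.Primes => ∏ j : Fin r, (1 - ν j p / ((p : ℕ) : ℂ) ^ s)⁻¹) (L s))
    {σ : ℝ} (hσ : 1 / 2 < σ) (hσ1 : σ < 1) :
    ∃ D B R : ℝ, 0 < D ∧ 0 < B ∧ ∀ A H t V : ℝ, ∀ ζ : ℂ, 1 ≤ A → 1 ≤ H → R + H ≤ t →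
      0 ≤ V → ‖ζ‖ ≤ 1 →
      (∀ s : ℂ, σ ≤ s.re → |s.im - t| ≤ H + 3 → L s ≠ 0) →
      V + D + D * t ^ B * (A ^ 2 * (H + 1) * Real.exp (A * (4 + 4 * H - H ^ 2 / 2))) ≤
        (ζ * smoothSum a A σ t).re →
      ∃ y ∈ Set.Icc (t - H) (t + H), ∃ w, IsLogValue L (σ + y * Complex.I) w ∧
        V ≤ (ζ * w).re := by
  have hB : ∀ p, p.Prime → ‖a p‖ ≤ r := fun p hp => by
    rw [haν p hp]
    calc ‖∑ j, ν j p‖ ≤ ∑ j : Fin r, (1 : ℝ) := norm_sum_le_of_le _ fun j _ => hν j p hp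
      _ = r := by simp
  obtain ⟨B, C, R, hB0, hC0, hR2, hgrowth⟩ := hL.exists_growth
  obtain ⟨C₁, hC₁0, hC₁⟩ := exists_norm_primeSum_le hB
  obtain ⟨Ch, hCh0, hCh⟩ := exists_norm_logTail_le hν hσ
  -- The first two terms are the Borel-Carathéodory bound with Re F ≤ C (3t)^B. The last one is the
  -- tail, written as at most 2 Ch / (x - σ) because x - σ ≤ 2.
  set Q₀ : ℝ := 4 * (C * 3 ^ B) + 4 * (C₁ + Ch) + 2 * Ch with hQ₀
  have hQ₀0 : 0 ≤ Q₀ := by positivity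
  set D : ℝ := 8 * Q₀ + 3 * C₁ + Ch + 1 with hD
  refine ⟨D, B, R + 10, by positivity, hB0, ?_⟩
  intro A H t V ζ hA hH hRt hV hζ hzero hS
  have hA0 : 0 < A := by linarith
  have ht1 : 1 ≤ t := by linarith
  have htB : 1 ≤ t ^ B := Real.one_le_rpow ht1 hB0.le
  obtain ⟨ε, hε, F, hFd, hFexp, hFℓ⟩ := exists_logBranch hL hν haν hprod hB hσ1
    (by linarith : 0 < H + 3) (by linarith) hzero
  have hsub : halfStrip σ t (H + 3) ⊆ halfStrip (σ - ε) t (H + 3) := fun s hs =>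
    ⟨by linarith [hs.1], hs.2⟩
  -- the bound for `F` inside the strip
  have hre : ∀ s ∈ halfStrip σ t (H + 3), s.re ≤ 4 → (F s).re ≤ C * 3 ^ B * t ^ B := by
    intro s hs hs4
    have him := abs_lt.mp hs.2
    have hsn1 : R ≤ ‖s‖ := by
      have := (le_abs_self _).trans (Complex.abs_im_le_norm s)
      linarith
    have hsn2 : ‖s‖ ≤ 3 * t := by
      refine (Complex.norm_le_abs_re_add_abs_im s).trans ?_
      rw [abs_of_nonneg (by linarith [hs.1]), abs_of_nonneg (by linarith)]
      linarith
    have h1 := hgrowth s hsn1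
    -- Re F = log |L|, so growth of L bounds the real part of F from above, which is all that
    -- Borel-Carathéodory needs.
    rw [← hFexp s (hsub hs), Complex.norm_exp, Real.exp_le_exp] at h1
    refine h1.trans ?_
    rw [mul_assoc, ← Real.mul_rpow (by norm_num) (by linarith)]
    gcongr
  have h2 : ∀ s ∈ halfStrip σ t (H + 3), s.re = 2 → ‖F s‖ ≤ C₁ + Ch := by
    intro s hs hs2
    rw [hFℓ s (hsub hs) (by linarith)]
    exact (norm_add_le _ _).trans (add_le_add (hC₁ s hs2.ge) (hCh s (by linarith)))
  set f : ℂ → ℂ := fun s => F s - logTail ν s with hf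
  have hrectU : ∀ s ∈ Set.Icc σ 2 ×ℂ Set.Icc (t - H) (t + H), s ∈ halfStrip (σ - ε) t (H + 3) := by
    intro s hs
    obtain ⟨⟨hs1, hs2⟩, hs3, hs4⟩ := hs
    exact ⟨by linarith, abs_lt.mpr ⟨by linarith, by linarith⟩⟩
  have hfd : DifferentiableOn ℂ f (Set.Icc σ 2 ×ℂ Set.Icc (t - H) (t + H)) := by
    intro s hs
    obtain ⟨x, hx1, hx2⟩ := exists_between hσ
    have hsx : s ∈ {s : ℂ | x < s.re} := lt_of_lt_of_le hx2 hs.1.1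
    exact ((hFd.differentiableAt ((isOpen_halfStrip _ _ _).mem_nhds (hrectU s hs))).sub
      ((differentiableOn_logTail hν hx1).differentiableAt
        ((isOpen_re_gt x).mem_nhds hsx))).differentiableWithinAt
  have hedge : ∀ x y : ℝ, σ < x → x ≤ 2 → |y - t| = H →
      ‖f (x + y * Complex.I)‖ ≤ Q₀ * t ^ B / (x - σ) := by
    intro x y hx hx2 hy
    have hd : 0 < x - σ := by linarith
    have h3 := norm_le_div_of_re_le (by linarith) (by linarith) (by positivity)
      (hFd.mono hsub) hre h2 hx hx2 (by rw [hy]; linarith)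
    have h4 : ‖logTail ν (x + y * Complex.I)‖ ≤ 2 * Ch / (x - σ) := by
      refine (hCh _ (by simp; linarith)).trans ?_
      rw [le_div_iff₀ hd]
      nlinarith
    refine (norm_sub_le _ _).trans ((add_le_add h3 h4).trans ?_)
    rw [← add_div]
    refine div_le_div_of_nonneg_right ?_ hd.le
    rw [hQ₀]
    have : 4 * (C₁ + Ch) + 2 * Ch ≤ (4 * (C₁ + Ch) + 2 * Ch) * t ^ B :=
      le_mul_of_one_le_right (by positivity) htB
    linarith
  have hleft := norm_integral_left_sub_right_le (A := A) (by linarith : 0 ≤ σ)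
    (by linarith : σ < 2) (by linarith : 0 ≤ H) hA0.le hfd hedge
  have hright := norm_integral_right_sub_smoothSum_le hB hC₁ hA (by linarith : 0 ≤ H)
    (by linarith : 0 ≤ σ) (by linarith) t
  have hfr : (∫ y in (t - H)..(t + H), f (2 + y * Complex.I) *
        kernel A H ((2 - σ : ℝ) + ((y - t : ℝ) : ℂ) * Complex.I)) =
      ∫ y in (t - H)..(t + H), primeSum a (2 + y * Complex.I) *
        kernel A H ((2 - σ : ℝ) + ((y - t : ℝ) : ℂ) * Complex.I) := by
    refine intervalIntegral.integral_congr fun y hy => ?_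
    rw [Set.uIcc_of_le (by linarith)] at hy
    have hmem : (2 + y * Complex.I : ℂ) ∈ Set.Icc σ 2 ×ℂ Set.Icc (t - H) (t + H) := by
      refine ⟨?_, ?_⟩
      · simp; linarith
      · simpa using hy
    have h1 := hFℓ _ (hrectU _ hmem) (by simp)
    simp only [hf, h1, add_sub_cancel_right]
  rw [hfr] at hleft
  set X : ℝ := Real.exp (A * (4 + 4 * H - H ^ 2 / 2)) with hX
  have hX0 : 0 < X := Real.exp_pos _
  set Err : ℝ := D * t ^ B * (A * (H + 1) * X) with hErr
  have hErr0 : 0 < Err := by positivity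
  have hInt := norm_sub_le_norm_sub_add_norm_sub
    (∫ y in (t - H)..(t + H), f (σ + y * Complex.I) *
      kernel A H (((y - t : ℝ) : ℂ) * Complex.I))
    (∫ y in (t - H)..(t + H), primeSum a (2 + y * Complex.I) *
        kernel A H ((2 - σ : ℝ) + ((y - t : ℝ) : ℂ) * Complex.I))
    ((√(Real.pi / A) : ℂ) * smoothSum a A σ t)
  have hInt2 := hInt.trans ((add_le_add hleft hright).trans (show _ ≤ Err by
    have e1 : Real.exp (A * (4 + 4 * H - H ^ 2)) ≤ X := by
      rw [hX, Real.exp_le_exp]; nlinarith [sq_nonneg H]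
    have e2 : Real.exp (A * (4 - H ^ 2 / 2)) ≤ X := by
      rw [hX, Real.exp_le_exp]; nlinarith
    have e3 : 4 * (Q₀ * t ^ B * (A * (2 + 2 * H) * Real.exp (A * (4 + 4 * H - H ^ 2)))) ≤
        8 * Q₀ * (t ^ B * (A * (H + 1) * X)) := by
      calc _ ≤ 4 * (Q₀ * t ^ B * (A * (2 + 2 * H) * X)) := by gcongr
        _ = _ := by ring
    have e4 : C₁ * (2 * H + 3) * Real.exp (A * (4 - H ^ 2 / 2)) ≤
        3 * C₁ * (t ^ B * (A * (H + 1) * X)) := by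
      calc _ ≤ C₁ * (3 * (H + 1)) * X := by gcongr; linarith
        _ = 3 * C₁ * (1 * (1 * (H + 1) * X)) := by ring
        _ ≤ _ := by gcongr
    have e5 : 0 ≤ t ^ B * (A * (H + 1) * X) := by positivity
    calc _ ≤ (8 * Q₀ + 3 * C₁) * (t ^ B * (A * (H + 1) * X)) := by linarith
      _ ≤ D * (t ^ B * (A * (H + 1) * X)) := by
          gcongr
          linarith
      _ = Err := by rw [hErr]; ring))
  have hfcont : ContinuousOn (fun y : ℝ => f (σ + y * Complex.I)) (Set.Icc (t - H) (t + H)) := by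
    refine hfd.continuousOn.comp (by fun_prop) fun y hy => ⟨?_, ?_⟩
    · simp; linarith
    · simpa using hy
  obtain ⟨y, hy, hVy⟩ := exists_le_re_of_integral (V := V + Ch) (ζ := ζ) hA (by linarith : 0 ≤ H)
    hfcont (by positivity) hErr0 hζ hInt2 (by
      have : A * Err = D * t ^ B * (A ^ 2 * (H + 1) * X) := by rw [hErr]; ring
      rw [this]
      have : Ch ≤ D := by rw [hD]; linarith
      linarith)
  have hyt : |y - t| < H + 3 := abs_lt.mpr ⟨by linarith [hy.1], by linarith [hy.2]⟩
  refine ⟨y, hy, F (σ + y * Complex.I), ⟨fun x => F (x + y * Complex.I), ?_, ?_, ?_, ?_⟩, ?_⟩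
  · intro x hx
    have hx' : σ ≤ x := by simpa using hx
    have hmem : (x + y * Complex.I : ℂ) ∈ halfStrip (σ - ε) t (H + 3) :=
      ⟨by simp; linarith, by simpa using hyt⟩
    have hc := (hFd.differentiableAt ((isOpen_halfStrip _ _ _).mem_nhds hmem)).continuousAt
    exact (ContinuousAt.comp (f := fun x : ℝ => (x + y * Complex.I : ℂ)) hc
      (by fun_prop)).continuousWithinAt
  · intro x hx
    have hx' : σ ≤ x := by simpa using hx
    have hmem : (x + y * Complex.I : ℂ) ∈ halfStrip (σ - ε) t (H + 3) :=
      ⟨by simp; linarith, by simpa using hyt⟩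
    simpa using hFexp _ hmem
  · refine (tendsto_primeSum_add_logTail hν hB y).congr' ?_
    filter_upwards [eventually_gt_atTop 1] with x hx
    exact (hFℓ _ ⟨by simp; linarith, by simpa using hyt⟩ (by simpa using hx)).symm
  · simp
  · simp only [hf, mul_sub, Complex.sub_re] at hVy
    have h1 : |(ζ * logTail ν (σ + y * Complex.I)).re| ≤ Ch := by
      refine (Complex.abs_re_le_norm _).trans ?_
      rw [norm_mul]
      calc _ ≤ 1 * Ch := mul_le_mul hζ (hCh _ (by simp)) (norm_nonneg _) zero_le_one
        _ = Ch := one_mul _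
    linarith [(abs_le.mp h1).1]

/-! ### Mean values of Riesz products over primes -/

lemma norm_integral_cexp_le {lam : ℝ} (hlam : lam ≠ 0) (a b : ℝ) :
    ‖∫ t in a..b, Complex.exp ((lam * t : ℝ) * Complex.I)‖ ≤ 2 / |lam| := by
  have hc : (lam * Complex.I : ℂ) ≠ 0 := by simp [hlam]
  have h1 : ∀ t : ℝ, Complex.exp ((lam * t : ℝ) * Complex.I) =
      Complex.exp (lam * Complex.I * t) := fun t => by push_cast; ring_nf
  simp_rw [h1]
  rw [integral_exp_mul_complex hc, norm_div]
  have h2 : ∀ t : ℝ, ‖Complex.exp (lam * Complex.I * t)‖ = 1 := fun t => by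
    rw [← h1]; exact Complex.norm_exp_ofReal_mul_I _
  have h3 : ‖(lam * Complex.I : ℂ)‖ = |lam| := by simp
  rw [h3]
  gcongr
  refine (norm_sub_le _ _).trans ?_
  rw [h2, h2]; norm_num

lemma inv_le_abs_log_sub_log {a b Y : ℕ} (ha : 0 < a) (hb : 0 < b) (hab : a ≠ b) (haY : a ≤ Y)
    (hbY : b ≤ Y) : (1 : ℝ) / Y ≤ |Real.log a - Real.log b| := by
  have key : ∀ a b : ℕ, 0 < b → b < a → a ≤ Y → (1 : ℝ) / Y ≤ Real.log a - Real.log b := by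
    intro a b hb hba haY
    have hb' : (0 : ℝ) < b := by exact_mod_cast hb
    have ha' : (0 : ℝ) < a := by exact_mod_cast hb.trans hba
    have hba' : (b : ℝ) + 1 ≤ a := by exact_mod_cast hba
    rw [← Real.log_div ha'.ne' hb'.ne']
    have h1 := Real.one_sub_inv_le_log_of_pos (div_pos ha' hb')
    refine le_trans ?_ h1
    rw [inv_div, ← sub_nonneg]
    have haY' : (a : ℝ) ≤ Y := by exact_mod_cast haY
    have h2 : (1 : ℝ) / Y ≤ 1 / a := one_div_le_one_div_of_le ha' haY'
    have h3 : (1 : ℝ) / a ≤ 1 - b / a := by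
      rw [one_sub_div ha'.ne']
      gcongr
      linarith
    linarith
  rcases lt_or_gt_of_ne hab with h | h
  · rw [abs_sub_comm]
    exact (key b a ha h hbY).trans (le_abs_self _)
  · exact (key a b hb h haY).trans (le_abs_self _)

/-- The positive and negative parts of x define two integers, different by unique factorization and
each at most ∏ q_i². Logarithms of distinct integers up to Y differ by at least 1/Y. Exponents up to
2 occur because a Riesz factor times a centred variable has Laurent degrees from -2 to 2. -/
lemma inv_le_abs_sum_mul_log {ι : Type*} [Fintype ι] [DecidableEq ι] {q : ι → ℕ}
    (hq : ∀ i, (q i).Prime) (hinj : Function.Injective q) {x : ι → ℤ} (hx : ∀ i, |x i| ≤ 2)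
    (hx0 : x ≠ 0) :
    (1 : ℝ) / ((∏ i, q i ^ 2 : ℕ) : ℝ) ≤ |∑ i, (x i : ℝ) * Real.log (q i)| := by
  obtain ⟨i₀, hi₀⟩ := Function.ne_iff.mp hx0
  have hle : ∀ y : ι → ℤ, (∀ i, |y i| ≤ 2) → ∏ i, q i ^ (y i).toNat ≤ ∏ i, q i ^ 2 := by
    intro y hy
    refine Finset.prod_le_prod' fun i _ => Nat.pow_le_pow_right (hq i).pos ?_
    have := abs_le.mp (hy i)
    omega
  have hpos : ∀ y : ι → ℤ, 0 < ∏ i, q i ^ (y i).toNat := fun y =>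
    Finset.prod_pos fun i _ => pow_pos (hq i).pos _
  -- a positive exponent of `x` gives a prime factor of one side only
  have hdvd : ∀ y : ι → ℤ, 0 < y i₀ → q i₀ ∣ ∏ i, q i ^ (y i).toNat := fun y hy =>
    dvd_trans (dvd_pow_self _ (by omega)) (Finset.dvd_prod_of_mem _ (Finset.mem_univ i₀))
  have hndvd : ∀ y : ι → ℤ, y i₀ < 0 → ¬ q i₀ ∣ ∏ i, q i ^ (y i).toNat := by
    intro y hy hcon
    obtain ⟨i, -, hi⟩ := (Prime.dvd_finsetProd_iff (hq i₀).prime _).mp hcon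
    have h1 := (hq i₀).dvd_of_dvd_pow hi
    have h2 : i₀ = i := hinj ((Nat.prime_dvd_prime_iff_eq (hq i₀) (hq i)).mp h1)
    subst h2
    rw [Int.toNat_of_nonpos hy.le, pow_zero] at hi
    exact (hq i₀).one_lt.ne' (Nat.dvd_one.mp hi)
  have hne : ∏ i, q i ^ (x i).toNat ≠ ∏ i, q i ^ ((-x) i).toNat := by
    intro heq
    rcases lt_or_gt_of_ne hi₀ with h | h
    · have hxi : 0 < (-x) i₀ := by simpa using h
      exact hndvd x (by simpa using h) (heq ▸ hdvd (-x) hxi)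
    · have hxi : (-x) i₀ < 0 := by simpa using h
      exact hndvd (-x) hxi (heq ▸ hdvd x (by simpa using h))
  have hlog : ∀ y : ι → ℤ, Real.log ((∏ i, q i ^ (y i).toNat : ℕ) : ℝ) =
      ∑ i, ((y i).toNat : ℝ) * Real.log (q i) := by
    intro y
    push_cast
    rw [Real.log_prod (fun i _ => pow_ne_zero _ (by exact_mod_cast (hq i).ne_zero))]
    exact Finset.sum_congr rfl fun i _ => Real.log_pow _ _
  have hsum : ∑ i, (x i : ℝ) * Real.log (q i) =
      Real.log ((∏ i, q i ^ (x i).toNat : ℕ) : ℝ) -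
        Real.log ((∏ i, q i ^ ((-x) i).toNat : ℕ) : ℝ) := by
    rw [hlog, hlog, ← Finset.sum_sub_distrib]
    refine Finset.sum_congr rfl fun i _ => ?_
    rw [← sub_mul]
    congr 1
    have h1 : (x i : ℤ) = ((x i).toNat : ℤ) - (((-x) i).toNat : ℤ) := by
      simp only [Pi.neg_apply]; omega
    exact_mod_cast congrArg (Int.cast : ℤ → ℝ) h1
  rw [hsum]
  exact inv_le_abs_log_sub_log (hpos x) (hpos _) hne (hle x hx)
    (hle _ fun i => by simpa using hx i)

/-- The mean value of a product of Laurent polynomials in distinct `q i ^ (i t)` is the product of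
the constant terms. -/
lemma norm_integral_prod_laurent_sub_le {ι : Type*} [Fintype ι] [DecidableEq ι] {q : ι → ℕ}
    (hq : ∀ i, (q i).Prime) (hinj : Function.Injective q) (c : ι → ℤ → ℂ) (T : ℝ) :
    ‖(∫ t in T..(2 * T), ∏ i, ∑ e ∈ Finset.Icc (-2 : ℤ) 2,
        c i e * Complex.exp ((t * Real.log (q i) : ℝ) * Complex.I) ^ e) - T * ∏ i, c i 0‖ ≤
      2 * ((∏ i, q i ^ 2 : ℕ) : ℝ) * ∏ i, ∑ e ∈ Finset.Icc (-2 : ℤ) 2, ‖c i e‖ := by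
  set R : ι → Finset ℤ := fun _ => Finset.Icc (-2 : ℤ) 2 with hR
  set Y : ℝ := ((∏ i, q i ^ 2 : ℕ) : ℝ) with hY
  have hY0 : 0 < Y := by
    rw [hY]; exact_mod_cast Finset.prod_pos fun i _ => pow_pos (hq i).pos _
  set lam : (ι → ℤ) → ℝ := fun x => ∑ i, (x i : ℝ) * Real.log (q i) with hlam
  set J : (ι → ℤ) → ℂ := fun x => ∫ t in T..(2 * T),
    Complex.exp ((lam x * t : ℝ) * Complex.I) with hJ
  have hexpand : (∫ t in T..(2 * T), ∏ i, ∑ e ∈ Finset.Icc (-2 : ℤ) 2,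
        c i e * Complex.exp ((t * Real.log (q i) : ℝ) * Complex.I) ^ e) =
      ∑ x ∈ Fintype.piFinset R, (∏ i, c i (x i)) * J x := by
    have h1 : ∀ t : ℝ, ∏ i, ∑ e ∈ Finset.Icc (-2 : ℤ) 2,
        c i e * Complex.exp ((t * Real.log (q i) : ℝ) * Complex.I) ^ e =
        ∑ x ∈ Fintype.piFinset R, (∏ i, c i (x i)) *
          Complex.exp ((lam x * t : ℝ) * Complex.I) := by
      intro t
      rw [Finset.prod_univ_sum]
      refine Finset.sum_congr rfl fun x _ => ?_
      rw [Finset.prod_mul_distrib]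
      congr 1
      simp_rw [← Complex.exp_int_mul]
      rw [← Complex.exp_sum]
      congr 1
      simp only [hlam]
      push_cast
      rw [Finset.sum_mul, Finset.sum_mul]
      exact Finset.sum_congr rfl fun i _ => by ring
    simp_rw [h1]
    rw [intervalIntegral.integral_finsetSum fun x _ => Continuous.intervalIntegrable
      (by fun_prop) _ _]
    exact Finset.sum_congr rfl fun x _ => intervalIntegral.integral_const_mul _ _
  have h0mem : (0 : ι → ℤ) ∈ Fintype.piFinset R := by
    simp [hR, Fintype.mem_piFinset]
  have hJ0 : J 0 = T := by
    simp only [hJ, hlam]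
    simp
    ring
  have hdiff : (∑ x ∈ Fintype.piFinset R, (∏ i, c i (x i)) * J x) - T * ∏ i, c i 0 =
      ∑ x ∈ (Fintype.piFinset R).erase 0, (∏ i, c i (x i)) * J x := by
    rw [← Finset.add_sum_erase _ _ h0mem, hJ0]
    simp only [Pi.zero_apply]
    ring
  rw [hexpand, hdiff]
  calc ‖∑ x ∈ (Fintype.piFinset R).erase 0, (∏ i, c i (x i)) * J x‖
      ≤ ∑ x ∈ (Fintype.piFinset R).erase 0, (∏ i, ‖c i (x i)‖) * (2 * Y) := by
        refine norm_sum_le_of_le _ fun x hx => ?_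
        obtain ⟨hx0, hxR⟩ := Finset.mem_erase.mp hx
        have hx2 : ∀ i, |x i| ≤ 2 := fun i => by
          have := Fintype.mem_piFinset.mp hxR i
          simp only [hR, Finset.mem_Icc] at this
          exact abs_le.mpr this
        have hl := inv_le_abs_sum_mul_log hq hinj hx2 hx0
        have hl0 : 0 < |lam x| := lt_of_lt_of_le (by positivity) hl
        rw [norm_mul, norm_prod]
        gcongr
        refine (norm_integral_cexp_le (abs_pos.mp hl0) _ _).trans ?_
        rw [div_le_iff₀ hl0]
        have : 1 ≤ Y * |lam x| := by
          rw [div_le_iff₀ hY0] at hl; linarith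
        linarith
    _ ≤ ∑ x ∈ Fintype.piFinset R, (∏ i, ‖c i (x i)‖) * (2 * Y) :=
        Finset.sum_le_sum_of_subset_of_nonneg (Finset.erase_subset _ _) fun _ _ _ => by positivity
    _ = 2 * Y * ∏ i, ∑ e ∈ Finset.Icc (-2 : ℤ) 2, ‖c i e‖ := by
        rw [← Finset.sum_mul, Finset.prod_univ_sum]; ring

/-- The Riesz product `∏ (1 + Re (β_p p^{it}))`. -/
noncomputable def riesz (β : ℕ → ℂ) (S : Finset ℕ) (t : ℝ) : ℝ :=
  ∏ p ∈ S, (1 + (β p * Complex.exp ((t * Real.log p : ℝ) * Complex.I)).re)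

lemma abs_riesz_factor_le {b : ℂ} (hb : ‖b‖ ≤ 1) (x : ℝ) :
    |(b * Complex.exp (x * Complex.I)).re| ≤ 1 := by
  refine (Complex.abs_re_le_norm _).trans ?_
  rw [norm_mul, Complex.norm_exp_ofReal_mul_I, mul_one]
  exact hb

lemma riesz_nonneg {β : ℕ → ℂ} (hβ : ∀ p, ‖β p‖ ≤ 1) (S : Finset ℕ) (t : ℝ) : 0 ≤ riesz β S t :=
  Finset.prod_nonneg fun p _ => by 
    linarith [(abs_le.mp (abs_riesz_factor_le (hβ p) (t * Real.log p))).1]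

lemma riesz_le {β : ℕ → ℂ} (hβ : ∀ p, ‖β p‖ ≤ 1) (S : Finset ℕ) (t : ℝ) :
    riesz β S t ≤ 2 ^ S.card := by
  rw [← Finset.prod_const]
  refine Finset.prod_le_prod
    (fun p _ => by linarith [(abs_le.mp (abs_riesz_factor_le (hβ p) (t * Real.log p))).1])
    fun p _ => by linarith [(abs_le.mp (abs_riesz_factor_le (hβ p) (t * Real.log p))).2]

lemma continuous_riesz (β : ℕ → ℂ) (S : Finset ℕ) : Continuous (riesz β S) := by
  unfold riesz
  fun_prop

/-- Laurent coefficients of a factor of the Riesz product. -/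
noncomputable def rieszCoeff (b : ℂ) (e : ℤ) : ℂ :=
  if e = 0 then 1 else if e = 1 then b / 2 else if e = -1 then conj b / 2 else 0

/-- Laurent coefficients of `(1 + Re (b z)) (z⁻¹ - b / 2)`, for `|z| = 1`. -/
noncomputable def centredCoeff (b : ℂ) (e : ℤ) : ℂ :=
  if e = -2 then conj b / 2 else if e = -1 then 1 - b * conj b / 4 else
    if e = 1 then -(b ^ 2 / 4) else 0

lemma sum_Icc_neg_two_two {M : Type*} [AddCommMonoid M] (f : ℤ → M) :
    ∑ e ∈ Finset.Icc (-2 : ℤ) 2, f e = f (-2) + (f (-1) + (f 0 + (f 1 + f 2))) := by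
  rw [show Finset.Icc (-2 : ℤ) 2 = {-2, -1, 0, 1, 2} by decide]
  simp

lemma conj_cexp_mul_I (x : ℝ) :
    conj (Complex.exp (x * Complex.I)) = (Complex.exp (x * Complex.I))⁻¹ := by
  rw [← Complex.exp_conj, ← Complex.exp_neg]
  simp

lemma sum_rieszCoeff (b : ℂ) (x : ℝ) :
    ∑ e ∈ Finset.Icc (-2 : ℤ) 2, rieszCoeff b e * Complex.exp (x * Complex.I) ^ e =
      ((1 + (b * Complex.exp (x * Complex.I)).re : ℝ) : ℂ) := by
  have hz := Complex.exp_ne_zero (x * Complex.I)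
  rw [sum_Icc_neg_two_two]
  push_cast
  rw [Complex.re_eq_add_conj, map_mul, conj_cexp_mul_I]
  simp [rieszCoeff]
  ring

lemma sum_centredCoeff (b : ℂ) (x : ℝ) :
    ∑ e ∈ Finset.Icc (-2 : ℤ) 2, centredCoeff b e * Complex.exp (x * Complex.I) ^ e =
      ((1 + (b * Complex.exp (x * Complex.I)).re : ℝ) : ℂ) *
        ((Complex.exp (x * Complex.I))⁻¹ - b / 2) := by
  have hz := Complex.exp_ne_zero (x * Complex.I)
  rw [sum_Icc_neg_two_two]
  push_cast
  rw [Complex.re_eq_add_conj, map_mul, conj_cexp_mul_I]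
  simp only [centredCoeff]
  norm_num
  field_simp
  ring

lemma sum_norm_rieszCoeff_le {b : ℂ} (hb : ‖b‖ ≤ 1) :
    ∑ e ∈ Finset.Icc (-2 : ℤ) 2, ‖rieszCoeff b e‖ ≤ 2 := by
  rw [sum_Icc_neg_two_two]
  simp [rieszCoeff]
  linarith

lemma sum_norm_centredCoeff_le {b : ℂ} (hb : ‖b‖ ≤ 1) :
    ∑ e ∈ Finset.Icc (-2 : ℤ) 2, ‖centredCoeff b e‖ ≤ 2 := by
  rw [sum_Icc_neg_two_two]
  have h1 : ‖(1 : ℂ) - b * conj b / 4‖ ≤ 1 := by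
    rw [Complex.mul_conj, Complex.normSq_eq_norm_sq]
    have : (1 : ℂ) - ((‖b‖ ^ 2 : ℝ) : ℂ) / 4 = ((1 - ‖b‖ ^ 2 / 4 : ℝ) : ℂ) := by push_cast; ring
    rw [this, Complex.norm_real, Real.norm_eq_abs, abs_le]
    constructor <;> nlinarith [norm_nonneg b]
  have h2 : ‖b‖ ^ 2 ≤ 1 := by nlinarith [norm_nonneg b]
  simp only [centredCoeff]
  norm_num
  have h3 : ‖(starRingEnd ℂ) b‖ = ‖b‖ := Complex.norm_conj b
  linarith

/-- The centred variable `p^{-it} - β_p / 2`. -/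
noncomputable def centred (β : ℕ → ℂ) (p : ℕ) (t : ℝ) : ℂ :=
  (Complex.exp ((t * Real.log p : ℝ) * Complex.I))⁻¹ - β p / 2

lemma continuous_centred (β : ℕ → ℂ) (p : ℕ) : Continuous (centred β p) := by
  unfold centred
  exact (Continuous.inv₀ (by fun_prop) fun t => Complex.exp_ne_zero _).sub continuous_const

lemma norm_centred_le {β : ℕ → ℂ} (hβ : ∀ p, ‖β p‖ ≤ 1) (p : ℕ) (t : ℝ) :
    ‖centred β p t‖ ≤ 2 := by
  refine (norm_sub_le _ _).trans ?_
  rw [norm_inv, Complex.norm_exp_ofReal_mul_I, norm_div]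
  have := hβ p
  norm_num
  linarith

lemma abs_integral_riesz_sub_le {β : ℕ → ℂ} (hβ : ∀ p, ‖β p‖ ≤ 1) {S : Finset ℕ}
    (hS : ∀ p ∈ S, p.Prime) (T : ℝ) :
    |(∫ t in T..(2 * T), riesz β S t) - T| ≤
      2 * ((∏ p ∈ S, p ^ 2 : ℕ) : ℝ) * 2 ^ S.card := by
  have h := norm_integral_prod_laurent_sub_le (ι := S) (q := fun p => p) (fun p => hS p p.2)
    Subtype.val_injective (fun p => rieszCoeff (β p)) T
  simp_rw [sum_rieszCoeff] at h
  have h1 : ∀ t : ℝ, ∏ p : S, ((1 + (β p * Complex.exp ((t * Real.log (p : ℕ) : ℝ) *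
      Complex.I)).re : ℝ) : ℂ) = (riesz β S t : ℂ) := by
    intro t
    rw [riesz, Complex.ofReal_prod]
    exact Finset.prod_coe_sort S (fun p => ((1 + (β p * Complex.exp ((t * Real.log (p : ℕ) : ℝ) *
      Complex.I)).re : ℝ) : ℂ))
  simp_rw [h1] at h
  have h2 : ∏ p : S, rieszCoeff (β p) 0 = 1 := Finset.prod_eq_one fun p _ => by simp [rieszCoeff]
  rw [h2, mul_one, intervalIntegral.integral_ofReal, ← Complex.ofReal_sub, Complex.norm_real,
    Real.norm_eq_abs, Finset.prod_coe_sort S (fun p => p ^ 2)] at h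
  refine h.trans ?_
  gcongr
  calc ∏ p : S, ∑ e ∈ Finset.Icc (-2 : ℤ) 2, ‖rieszCoeff (β p) e‖ ≤ ∏ _p : S, (2 : ℝ) :=
        Finset.prod_le_prod (fun p _ => Finset.sum_nonneg fun e _ => norm_nonneg _)
          fun p _ => sum_norm_rieszCoeff_le (hβ p)
    _ = 2 ^ S.card := by simp

lemma norm_integral_riesz_mul_centred_le {β : ℕ → ℂ} (hβ : ∀ p, ‖β p‖ ≤ 1) {S : Finset ℕ}
    (hS : ∀ p ∈ S, p.Prime) (hβS : ∀ p ∉ S, β p = 0) {p q N : ℕ} (hp : p.Prime) (hq : q.Prime)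
    (hpq : p ≠ q) (hpN : p ≤ N) (hqN : q ≤ N) (T : ℝ) :
    ‖∫ t in T..(2 * T), (riesz β S t : ℂ) * (centred β p t * conj (centred β q t))‖ ≤
      8 * (N : ℝ) ^ 4 * ((∏ p ∈ S, p ^ 2 : ℕ) : ℝ) * 2 ^ S.card := by
  classical
  -- The primes p and q may lie outside S; there β vanishes and the Riesz factor is 1, so enlarging
  -- the index set changes nothing.
  set V : Finset ℕ := insert p (insert q S) with hV
  have hVp : ∀ v ∈ V, v.Prime := by
    intro v hv
    simp only [hV, Finset.mem_insert] at hv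
    rcases hv with rfl | rfl | hv
    exacts [hp, hq, hS v hv]
  -- The variable at q enters conjugated. On the unit circle this conjugates the Laurent
  -- coefficients and reverses the sign of their degrees.
  set c : ℕ → ℤ → ℂ := fun v e => if v = p then centredCoeff (β v) e else
    if v = q then conj (centredCoeff (β v) (-e)) else rieszCoeff (β v) e with hc
  have hfac : ∀ (t : ℝ) (v : ℕ), ∑ e ∈ Finset.Icc (-2 : ℤ) 2,
      c v e * Complex.exp ((t * Real.log v : ℝ) * Complex.I) ^ e =
      ((1 + (β v * Complex.exp ((t * Real.log v : ℝ) * Complex.I)).re : ℝ) : ℂ) *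
        ((if v = p then centred β p t else 1) * (if v = q then conj (centred β q t) else 1)) := by
    intro t v
    by_cases hvp : v = p
    · subst hvp
      simp only [hc, if_true, hpq, if_false, mul_one]
      exact sum_centredCoeff _ _
    · by_cases hvq : v = q
      · subst hvq
        simp only [hc, hvp, if_false, if_true, one_mul]
        have h := congrArg conj (sum_centredCoeff (β v) (t * Real.log v))
        rw [map_mul, Complex.conj_ofReal] at h
        rw [centred, ← h, sum_Icc_neg_two_two, sum_Icc_neg_two_two]
        simp only [map_add, map_mul, map_zpow₀, conj_cexp_mul_I, inv_zpow', neg_neg, neg_zero]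
        ring
      · simp only [hc, hvp, hvq, if_false, mul_one]
        exact sum_rieszCoeff _ _
  have h := norm_integral_prod_laurent_sub_le (ι := V) (q := fun p => p) (fun p => hVp p p.2)
    Subtype.val_injective (fun p => c p) T
  simp_rw [hfac] at h
  have hprod : ∀ t : ℝ, ∏ v : V, (((1 + (β v * Complex.exp ((t * Real.log (v : ℕ) : ℝ) *
      Complex.I)).re : ℝ) : ℂ) * ((if (v : ℕ) = p then centred β p t else 1) *
        (if (v : ℕ) = q then conj (centred β q t) else 1))) =
      (riesz β S t : ℂ) * (centred β p t * conj (centred β q t)) := by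
    intro t
    rw [Finset.prod_coe_sort V (fun v => (((1 + (β v * Complex.exp ((t * Real.log v : ℝ) *
      Complex.I)).re : ℝ) : ℂ) * ((if v = p then centred β p t else 1) *
        (if v = q then conj (centred β q t) else 1)))), Finset.prod_mul_distrib,
        Finset.prod_mul_distrib]
    congr 1
    · rw [riesz, Complex.ofReal_prod]
      refine (Finset.prod_subset ?_ ?_).symm
      · exact (Finset.subset_insert _ _).trans (Finset.subset_insert _ _)
      · intro v _ hv
        simp [hβS v hv]
    · rw [Finset.prod_ite_eq' V p (fun _ => centred β p t), Finset.prod_ite_eq' V q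
        (fun _ => conj (centred β q t)), if_pos (by simp [hV]), if_pos (by simp [hV])]
  simp_rw [hprod] at h
  -- The constant term of (1 + Re(b z))(z⁻¹ - b/2) is b/2 - b/2 = 0. Thus β_p / 2 is the mean of
  -- p^{-it} under the weight and the cross terms have no main term.
  have h0 : ∏ v : V, c v 0 = 0 := by
    refine Finset.prod_eq_zero (Finset.mem_univ (⟨p, by simp [hV]⟩ : V)) ?_
    simp [hc, centredCoeff]
  rw [h0, mul_zero, sub_zero, Finset.prod_coe_sort V (fun p => p ^ 2)] at h
  refine h.trans ?_
  have hins : ∀ (v : ℕ) (W : Finset ℕ) (g : ℕ → ℝ), (∀ v, 1 ≤ g v) →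
      ∏ w ∈ insert v W, g w ≤ g v * ∏ w ∈ W, g w := by
    intro v W g hg
    by_cases hv : v ∈ W
    · rw [Finset.insert_eq_of_mem hv]
      exact le_mul_of_one_le_left (Finset.prod_nonneg fun w _ => zero_le_one.trans (hg w)) (hg v)
    · rw [Finset.prod_insert hv]
  have hY : ((∏ v ∈ V, v ^ 2 : ℕ) : ℝ) ≤ (N : ℝ) ^ 4 * ((∏ p ∈ S, p ^ 2 : ℕ) : ℝ) := by
    -- `hins` asks for values at least 1 at every natural number, including 0; at primes the maximum
    -- is v².
    set g : ℕ → ℝ := fun v => max ((v : ℝ) ^ 2) 1 with hg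
    have hg1 : ∀ v, 1 ≤ g v := fun v => le_max_right _ _
    have hgp : ∀ v : ℕ, v.Prime → g v = (v : ℝ) ^ 2 := fun v hv =>
      max_eq_left (one_le_pow₀ (by exact_mod_cast hv.one_le))
    have e1 : ((∏ v ∈ V, v ^ 2 : ℕ) : ℝ) = ∏ v ∈ V, g v := by
      push_cast
      exact Finset.prod_congr rfl fun v hv => (hgp v (hVp v hv)).symm
    have e2 : ((∏ v ∈ S, v ^ 2 : ℕ) : ℝ) = ∏ v ∈ S, g v := by
      push_cast
      exact Finset.prod_congr rfl fun v hv => (hgp v (hS v hv)).symm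
    have hpos : 0 ≤ ∏ v ∈ S, g v := Finset.prod_nonneg fun v _ => zero_le_one.trans (hg1 v)
    rw [e1, e2]
    calc ∏ v ∈ V, g v ≤ g p * ∏ w ∈ insert q S, g w := hins p _ g hg1
      _ ≤ g p * (g q * ∏ w ∈ S, g w) :=
          mul_le_mul_of_nonneg_left (hins q _ g hg1) (zero_le_one.trans (hg1 p))
      _ = ((p : ℝ) ^ 2 * (q : ℝ) ^ 2) * ∏ w ∈ S, g w := by rw [hgp p hp, hgp q hq]; ring
      _ ≤ ((N : ℝ) ^ 2 * (N : ℝ) ^ 2) * ∏ w ∈ S, g w := by gcongr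
      _ = _ := by ring
  have hC : ∏ v : V, ∑ e ∈ Finset.Icc (-2 : ℤ) 2, ‖c v e‖ ≤ 4 * 2 ^ S.card := by
    calc ∏ v : V, ∑ e ∈ Finset.Icc (-2 : ℤ) 2, ‖c v e‖ ≤ ∏ _v : V, (2 : ℝ) := by
          refine Finset.prod_le_prod (fun p _ => Finset.sum_nonneg fun e _ => norm_nonneg _)
            fun v _ => ?_
          simp only [hc]
          split_ifs
          · exact sum_norm_centredCoeff_le (hβ v)
          · simp only [Complex.norm_conj]
            refine le_trans (le_of_eq ?_) (sum_norm_centredCoeff_le (hβ v))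
            rw [sum_Icc_neg_two_two, sum_Icc_neg_two_two]
            simp only [neg_neg, neg_zero]
            ring
          · exact sum_norm_rieszCoeff_le (hβ v)
      _ = ∏ _v ∈ V, (2 : ℝ) := Finset.prod_coe_sort V (fun _ => (2 : ℝ))
      _ ≤ 2 * ∏ _w ∈ insert q S, (2 : ℝ) := hins p _ (fun _ => 2) (fun _ => by norm_num)
      _ ≤ 2 * (2 * ∏ _w ∈ S, (2 : ℝ)) :=
          mul_le_mul_of_nonneg_left (hins q _ (fun _ => 2) (fun _ => by norm_num)) (by norm_num)
      _ = 4 * 2 ^ S.card := by rw [Finset.prod_const]; ring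
  calc _ ≤ 2 * ((N : ℝ) ^ 4 * ((∏ p ∈ S, p ^ 2 : ℕ) : ℝ)) * (4 * 2 ^ S.card) := by
        refine mul_le_mul (mul_le_mul_of_nonneg_left hY (by norm_num)) hC ?_ (by positivity)
        exact Finset.prod_nonneg fun v _ => Finset.sum_nonneg fun e _ => norm_nonneg _
    _ = _ := by ring

/-- The second moment of a prime polynomial about its mean, with respect to a Riesz product. -/
lemma integral_riesz_mul_sq_le {β : ℕ → ℂ} (hβ : ∀ p, ‖β p‖ ≤ 1) {S S' : Finset ℕ}
    (hS : ∀ p ∈ S, p.Prime) (hβS : ∀ p ∉ S, β p = 0) {N : ℕ}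
    (hS' : ∀ p ∈ S', p.Prime ∧ p ≤ N) (d : ℕ → ℂ) {T : ℝ} (hT : 0 ≤ T) :
    ∫ t in T..(2 * T), riesz β S t * ‖∑ p ∈ S', d p * centred β p t‖ ^ 2 ≤
      4 * (∑ p ∈ S', ‖d p‖ ^ 2) * (∫ t in T..(2 * T), riesz β S t) +
        (∑ p ∈ S', ‖d p‖) ^ 2 * (8 * (N : ℝ) ^ 4 * ((∏ p ∈ S, p ^ 2 : ℕ) : ℝ) * 2 ^ S.card) := by
  classical
  set E : ℝ := 8 * (N : ℝ) ^ 4 * ((∏ p ∈ S, p ^ 2 : ℕ) : ℝ) * 2 ^ S.card with hE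
  have hE0 : 0 ≤ E := by positivity
  set I : ℝ := ∫ t in T..(2 * T), riesz β S t with hI
  have hTT : T ≤ 2 * T := by linarith
  have hI0 : 0 ≤ I := intervalIntegral.integral_nonneg hTT fun t _ => riesz_nonneg hβ S t
  have hrc : Continuous fun t => (riesz β S t : ℂ) :=
    Complex.continuous_ofReal.comp (continuous_riesz β S)
  have hcc : ∀ p q, Continuous fun t =>
      (riesz β S t : ℂ) * (centred β p t * conj (centred β q t)) := fun p q =>
    hrc.mul ((continuous_centred β p).mul
      (Complex.continuous_conj.comp (continuous_centred β q)))
  have hexp : ((∫ t in T..(2 * T), riesz β S t * ‖∑ p ∈ S', d p * centred β p t‖ ^ 2 : ℝ) : ℂ) =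
      ∑ p ∈ S', ∑ q ∈ S', d p * conj (d q) *
        ∫ t in T..(2 * T), (riesz β S t : ℂ) * (centred β p t * conj (centred β q t)) := by
    rw [← intervalIntegral.integral_ofReal]
    have h1 : ∀ t : ℝ, ((riesz β S t * ‖∑ p ∈ S', d p * centred β p t‖ ^ 2 : ℝ) : ℂ) =
        ∑ p ∈ S', ∑ q ∈ S', d p * conj (d q) *
          ((riesz β S t : ℂ) * (centred β p t * conj (centred β q t))) := by
      intro t
      rw [Complex.ofReal_mul, ← Complex.normSq_eq_norm_sq, ← Complex.mul_conj, map_sum,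
        Finset.sum_mul_sum, Finset.mul_sum]
      refine Finset.sum_congr rfl fun p _ => ?_
      rw [Finset.mul_sum]
      refine Finset.sum_congr rfl fun q _ => ?_
      rw [map_mul]; ring
    simp_rw [h1]
    have hcd : ∀ p q, Continuous fun t => d p * conj (d q) *
        ((riesz β S t : ℂ) * (centred β p t * conj (centred β q t))) := fun p q =>
      continuous_const.mul (hcc p q)
    have hcs : ∀ p, Continuous fun t => ∑ q ∈ S', d p * conj (d q) *
        ((riesz β S t : ℂ) * (centred β p t * conj (centred β q t))) := fun p =>
      continuous_finsetSum _ fun q _ => hcd p q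
    rw [intervalIntegral.integral_finsetSum fun p _ => (hcs p).intervalIntegrable _ _]
    refine Finset.sum_congr rfl fun p _ => ?_
    rw [intervalIntegral.integral_finsetSum fun q _ => (hcd p q).intervalIntegrable _ _]
    exact Finset.sum_congr rfl fun q _ => intervalIntegral.integral_const_mul _ _
  -- The diagonal is bounded trivially by |centred|² ≤ 4, and the rest by near-orthogonality.
  -- Allowing the error also on the diagonal lets the double sum factor as a square.
  have hterm : ∀ p ∈ S', ∀ q ∈ S', ‖d p * conj (d q) *
        ∫ t in T..(2 * T), (riesz β S t : ℂ) * (centred β p t * conj (centred β q t))‖ ≤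
      (if p = q then 4 * ‖d p‖ ^ 2 * I else 0) + ‖d p‖ * ‖d q‖ * E := by
    intro p hp q hq
    rw [norm_mul, norm_mul, Complex.norm_conj]
    by_cases hpq : p = q
    · subst hpq
      rw [if_pos rfl]
      have h2 : ‖∫ t in T..(2 * T), (riesz β S t : ℂ) *
          (centred β p t * conj (centred β p t))‖ ≤ 4 * I := by
        rw [hI, ← intervalIntegral.integral_const_mul]
        refine intervalIntegral.norm_integral_le_of_norm_le hTT
          (Eventually.of_forall fun t _ => ?_)
          ((continuous_const.mul (continuous_riesz β S)).intervalIntegrable _ _)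
        have h3 := norm_centred_le hβ p t
        have h4 := riesz_nonneg hβ S t
        rw [norm_mul, norm_mul, Complex.norm_conj, Complex.norm_real, Real.norm_of_nonneg h4]
        have h5 : ‖centred β p t‖ * ‖centred β p t‖ ≤ 4 := by
          nlinarith [norm_nonneg (centred β p t)]
        nlinarith
      calc ‖d p‖ * ‖d p‖ * _ ≤ ‖d p‖ * ‖d p‖ * (4 * I) := by gcongr
        _ = 4 * ‖d p‖ ^ 2 * I := by ring
        _ ≤ _ := le_add_of_nonneg_right (by positivity)
    · rw [if_neg hpq, zero_add]
      gcongr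
      exact norm_integral_riesz_mul_centred_le hβ hS hβS (hS' p hp).1 (hS' q hq).1 hpq
        (hS' p hp).2 (hS' q hq).2 T
  calc ∫ t in T..(2 * T), riesz β S t * ‖∑ p ∈ S', d p * centred β p t‖ ^ 2
      ≤ ‖((∫ t in T..(2 * T), riesz β S t * ‖∑ p ∈ S', d p * centred β p t‖ ^ 2 : ℝ) : ℂ)‖ := by
        rw [Complex.norm_real]; exact Real.le_norm_self _
    _ ≤ ∑ p ∈ S', ∑ q ∈ S',
          ((if p = q then 4 * ‖d p‖ ^ 2 * I else 0) + ‖d p‖ * ‖d q‖ * E) := by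
        rw [hexp]
        refine norm_sum_le_of_le _ fun p hp => norm_sum_le_of_le _ fun q hq => hterm p hp q hq
    _ = _ := by
        simp_rw [Finset.sum_add_distrib]
        congr 1
        · rw [Finset.mul_sum, Finset.sum_mul]
          refine Finset.sum_congr rfl fun p hp => ?_
          rw [Finset.sum_ite_eq, if_pos hp]
        · rw [sq, Finset.sum_mul_sum, Finset.sum_mul]
          exact Finset.sum_congr rfl fun p _ => by rw [Finset.sum_mul]

/-! ### Selecting a good ordinate -/

lemma measureReal_biUnion_Icc_le (F : Finset ℝ) {h : ℝ} (hh : 0 ≤ h) :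
    MeasureTheory.volume.real (⋃ x ∈ F, Set.Icc (x - h) (x + h)) ≤ F.card * (2 * h) := by
  refine (MeasureTheory.measureReal_biUnion_finset_le F _).trans ?_
  rw [← nsmul_eq_mul]
  refine Finset.sum_le_card_nsmul _ _ _ fun x _ => ?_
  rw [Real.volume_real_Icc_of_le (by linarith)]
  linarith

/-- Outside the `h`-neighbourhood of few points there is an ordinate at which all the prime
polynomials are close to their means. -/
lemma exists_ordinate {k : ℕ} {β : ℕ → ℂ} (hβ : ∀ p, ‖β p‖ ≤ 1) {S S' : Finset ℕ}
    (hS : ∀ p ∈ S, p.Prime) (hβS : ∀ p ∉ S, β p = 0) {N : ℕ}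
    (hS' : ∀ p ∈ S', p.Prime ∧ p ≤ N) (d : Fin k → ℕ → ℂ) {T h G : ℝ} (hT : 0 < T) (hh : 0 ≤ h)
    (hG : 0 ≤ G) (F : Finset ℝ)
    (hF : 2 ^ S.card * (F.card * (2 * h)) ≤ T / 8)
    (hP : 2 * ((∏ p ∈ S, p ^ 2 : ℕ) : ℝ) * 2 ^ S.card ≤ T / 8)
    (hd2 : ∀ j, 4 * ∑ p ∈ S', ‖d j p‖ ^ 2 ≤ G)
    (hd1 : ∀ j, (∑ p ∈ S', ‖d j p‖) ^ 2 *
      (8 * (N : ℝ) ^ 4 * ((∏ p ∈ S, p ^ 2 : ℕ) : ℝ) * 2 ^ S.card) ≤ T) :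
    ∃ t ∈ Set.Ioc T (2 * T), (∀ x ∈ F, h < |t - x|) ∧
      ∀ j, ‖∑ p ∈ S', d j p * centred β p t‖ ^ 2 ≤ 2 * (k * (2 * G + 1)) + 1 := by
  classical
  -- Chebyshev's inequality for the weight: its mass off the bad set is at least T - T/8 - T/8 =
  -- 3T/4, the k second moments add up to at most k (2G + 1) T, and 3K/4 exceeds k (2G + 1).
  set K : ℝ := 2 * (k * (2 * G + 1)) + 1 with hK
  have hK0 : 0 ≤ K := by positivity
  by_contra hcon
  push Not at hcon
  set Bad : Set ℝ := ⋃ x ∈ F, Set.Icc (x - h) (x + h) with hBad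
  have hBadm : MeasurableSet Bad := Finset.measurableSet_biUnion _ fun x _ => measurableSet_Icc
  set P : ℝ → ℝ := riesz β S with hPdef
  have hPc : Continuous P := continuous_riesz β S
  have hP0 : ∀ t, 0 ≤ P t := riesz_nonneg hβ S
  set Q : Fin k → ℝ → ℝ := fun j t => P t * ‖∑ p ∈ S', d j p * centred β p t‖ ^ 2 with hQ
  have hQc : ∀ j, Continuous (Q j) := fun j =>
    hPc.mul ((continuous_finsetSum _ fun p _ =>
      continuous_const.mul (continuous_centred β p)).norm.pow 2)
  have hQ0 : ∀ j t, 0 ≤ Q j t := fun j t => mul_nonneg (hP0 t) (by positivity)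
  have hQsc : Continuous fun t => ∑ j, Q j t := continuous_finsetSum _ fun j _ => hQc j
  have hTT : T ≤ 2 * T := by linarith
  have hInt : ∀ f : ℝ → ℝ, Continuous f →
      MeasureTheory.IntegrableOn f (Set.Ioc T (2 * T)) := fun f hf =>
    (intervalIntegrable_iff_integrableOn_Ioc_of_le hTT).mp (hf.intervalIntegrable _ _)
  -- a large square sum at every good point
  have hgood : ∀ t ∈ Set.Ioc T (2 * T) \ Bad, K * P t ≤ ∑ j, Q j t := by
    rintro t ⟨ht, htB⟩
    obtain ⟨j, hj⟩ := hcon t ht (fun x hx => by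
      by_contra hle
      push Not at hle
      refine htB (Set.mem_biUnion hx ?_)
      have := abs_le.mp hle
      exact ⟨by linarith, by linarith⟩)
    calc K * P t ≤ Q j t := by
          simp only [hQ]
          rw [mul_comm]
          exact mul_le_mul_of_nonneg_left hj.le (hP0 t)
      _ ≤ _ := Finset.single_le_sum (f := fun j => Q j t) (fun j _ => hQ0 j t) (Finset.mem_univ j)
  have hI := abs_le.mp ((abs_integral_riesz_sub_le hβ hS T).trans hP)
  have hV : ∀ j, ∫ t in T..(2 * T), Q j t ≤ (2 * G + 1) * T := by
    intro j
    refine (integral_riesz_mul_sq_le hβ hS hβS hS' (d j) hT.le).trans ?_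
    have h1 : 4 * (∑ p ∈ S', ‖d j p‖ ^ 2) * (∫ t in T..(2 * T), riesz β S t) ≤ G * (2 * T) := by
      refine mul_le_mul (hd2 j) (by linarith) ?_ hG
      exact intervalIntegral.integral_nonneg hTT fun t _ => hP0 t
    linarith [hd1 j]
  have hsum : ∫ t in Set.Ioc T (2 * T), ∑ j, Q j t ≤ k * ((2 * G + 1) * T) := by
    rw [← intervalIntegral.integral_of_le hTT,
      intervalIntegral.integral_finsetSum fun j _ => (hQc j).intervalIntegrable _ _]
    calc _ ≤ ∑ _j : Fin k, (2 * G + 1) * T := Finset.sum_le_sum fun j _ => hV j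
      _ = _ := by simp
  have hlow : K * ∫ t in Set.Ioc T (2 * T) \ Bad, P t ≤ k * ((2 * G + 1) * T) := by
    rw [← MeasureTheory.integral_const_mul]
    calc ∫ t in Set.Ioc T (2 * T) \ Bad, K * P t
        ≤ ∫ t in Set.Ioc T (2 * T) \ Bad, ∑ j, Q j t :=
          MeasureTheory.setIntegral_mono_on
            ((hInt _ (continuous_const.mul hPc)).mono_set Set.sdiff_subset)
            ((hInt _ hQsc).mono_set Set.sdiff_subset) (measurableSet_Ioc.diff hBadm) hgood
      _ ≤ ∫ t in Set.Ioc T (2 * T), ∑ j, Q j t :=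
          MeasureTheory.setIntegral_mono_set (hInt _ hQsc)
            (Eventually.of_forall fun t => Finset.sum_nonneg fun j _ => hQ0 j t)
            (Set.sdiff_subset.eventuallyLE)
      _ ≤ _ := hsum
  have hbad : ∫ t in Set.Ioc T (2 * T) ∩ Bad, P t ≤ T / 8 := by
    have hfin : MeasureTheory.volume Bad < ⊤ := by
      refine (MeasureTheory.measure_biUnion_lt_top F.finite_toSet fun x _ => ?_)
      simp
    have h1 := MeasureTheory.norm_setIntegral_le_of_norm_le_const (f := P) (C := 2 ^ S.card)
      (s := Set.Ioc T (2 * T) ∩ Bad) (μ := MeasureTheory.volume)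
      ((MeasureTheory.measure_mono Set.inter_subset_right).trans_lt hfin) (fun t _ => by
        rw [Real.norm_of_nonneg (hP0 t)]; exact riesz_le hβ S t)
    refine (Real.le_norm_self _).trans (h1.trans (le_trans ?_ hF))
    gcongr
    exact (MeasureTheory.measureReal_mono Set.inter_subset_right hfin.ne).trans
      (measureReal_biUnion_Icc_le F hh)
  have hsplit := MeasureTheory.integral_inter_add_sdiff (μ := MeasureTheory.volume)
    (s := Set.Ioc T (2 * T)) hBadm (hInt P hPc)
  rw [← intervalIntegral.integral_of_le hTT] at hsplit
  have hrest : 3 / 4 * T ≤ ∫ t in Set.Ioc T (2 * T) \ Bad, P t := by linarith [hI.1]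
  have h1 := (mul_le_mul_of_nonneg_left hrest hK0).trans hlow
  have h2 : 0 ≤ (k : ℝ) * (2 * G + 1) := by positivity
  rw [hK] at h1
  nlinarith

/-! ### The size of the means -/

/-- **Abel's inequality** for sums over an interval of natural numbers. -/
lemma norm_sum_Ioc_mul_le {m n : ℕ} (hmn : m < n) {c : ℕ → ℂ} {g : ℕ → ℝ} {E : ℝ}
    (hg : ∀ i, m < i → g (i + 1) ≤ g i) (hgn : 0 ≤ g n)
    (hc : ∀ l, m < l → l ≤ n → ‖∑ i ∈ Finset.Ioc m l, c i‖ ≤ E) :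
    ‖∑ i ∈ Finset.Ioc m n, c i * (g i : ℂ)‖ ≤ E * g (m + 1) := by
  -- Summation by parts as an induction on l: each step adds g l - g (l + 1) times a partial sum of
  -- norm at most E, and these decrements telescope.
  have key : ∀ l, m + 1 ≤ l → l ≤ n →
      ‖∑ i ∈ Finset.Ioc m l, c i * (g i : ℂ) - (∑ i ∈ Finset.Ioc m l, c i) * (g l : ℂ)‖ ≤
        E * (g (m + 1) - g l) := by
    intro l hl
    induction l, hl using Nat.le_induction with
    | base => intro _; simp
    | succ l hl ih =>
      intro hln
      have h1 := ih (by omega)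
      have h2 := hc l (by omega) (by omega)
      have h3 : 0 ≤ g l - g (l + 1) := by linarith [hg l (by omega)]
      rw [Finset.sum_Ioc_succ_top (by omega), Finset.sum_Ioc_succ_top (by omega)]
      have h4 : ∑ i ∈ Finset.Ioc m l, c i * (g i : ℂ) + c (l + 1) * (g (l + 1) : ℂ) -
          (∑ i ∈ Finset.Ioc m l, c i + c (l + 1)) * (g (l + 1) : ℂ) =
          (∑ i ∈ Finset.Ioc m l, c i * (g i : ℂ) - (∑ i ∈ Finset.Ioc m l, c i) * (g l : ℂ)) +
            (∑ i ∈ Finset.Ioc m l, c i) * ((g l - g (l + 1) : ℝ) : ℂ) := by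
        push_cast; ring
      rw [h4]
      refine (norm_add_le _ _).trans ?_
      rw [norm_mul, Complex.norm_real, Real.norm_of_nonneg h3]
      have h5 := mul_le_mul_of_nonneg_right h2 h3
      linarith
  have h1 := key n (by omega) le_rfl
  have h2 : ‖(∑ i ∈ Finset.Ioc m n, c i) * (g n : ℂ)‖ ≤ E * g n := by
    rw [norm_mul, Complex.norm_real, Real.norm_of_nonneg hgn]
    exact mul_le_mul_of_nonneg_right (hc n hmn le_rfl) hgn
  have h3 := norm_le_norm_sub_add (∑ i ∈ Finset.Ioc m n, c i * (g i : ℂ))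
    ((∑ i ∈ Finset.Ioc m n, c i) * (g n : ℂ))
  linarith

/-- Primes in `(x / 2, x]`. -/
noncomputable def dyadicPrimes (x : ℝ) : Finset ℕ := {p ∈ Finset.Ioc ⌊x / 2⌋₊ ⌊x⌋₊ | p.Prime}

lemma primeCorr_sub {a b : ℕ → ℂ} {x y : ℝ} (hxy : x ≤ y) :
    primeCorr a b y - primeCorr a b x =
      ∑ p ∈ Finset.Ioc ⌊x⌋₊ ⌊y⌋₊, if p.Prime then a p * conj (b p) else 0 := by
  simp only [primeCorr, Finset.sum_filter]
  have h := Nat.floor_le_floor hxy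
  have hd : Finset.Icc 1 ⌊y⌋₊ = Finset.Icc 1 ⌊x⌋₊ ∪ Finset.Ioc ⌊x⌋₊ ⌊y⌋₊ := by
    ext n; simp only [Finset.mem_Icc, Finset.mem_union, Finset.mem_Ioc]; omega
  rw [hd, Finset.sum_union, add_sub_cancel_left]
  rw [Finset.disjoint_left]
  intro n hn hn'
  simp only [Finset.mem_Icc, Finset.mem_Ioc] at hn hn'
  omega

lemma Li_sub_Li_ge {x : ℝ} (hx : 4 ≤ x) : x / 2 / Real.log x ≤ Li x - Li (x / 2) := by
  have hc : ∀ a b : ℝ, 2 ≤ a → 2 ≤ b →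
      IntervalIntegrable (fun t => (Real.log t)⁻¹) MeasureTheory.volume a b := by
    intro a b ha hb
    refine ContinuousOn.intervalIntegrable fun t ht => ?_
    have ht2 : 2 ≤ t := (le_min ha hb).trans ht.1
    exact ((Real.continuousAt_log (by linarith)).inv₀
      (Real.log_pos (by linarith)).ne').continuousWithinAt
  have h1 : Li x - Li (x / 2) = ∫ t in (x / 2)..x, (Real.log t)⁻¹ :=
    intervalIntegral.integral_interval_sub_left (hc 2 x le_rfl (by linarith))
      (hc 2 (x / 2) le_rfl (by linarith))
  rw [h1]
  have h2 : ∫ _t in (x / 2)..x, (Real.log x)⁻¹ ≤ ∫ t in (x / 2)..x, (Real.log t)⁻¹ := by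
    refine intervalIntegral.integral_mono_on (by linarith) (by simp)
      (hc _ _ (by linarith) (by linarith)) fun t ht => ?_
    exact inv_anti₀ (Real.log_pos (by linarith [ht.1])) (Real.log_le_log (by linarith [ht.1]) ht.2)
  rw [intervalIntegral.integral_const, smul_eq_mul] at h2
  rw [div_eq_mul_inv (x / 2)]
  linarith

/-- The weight `p^{-σ} exp (-(log p)² / (4 * A))`. -/
noncomputable def weight (A σ : ℝ) (p : ℕ) : ℝ :=
  (p : ℝ) ^ (-σ) * Real.exp (-(Real.log p ^ 2 / (4 * A)))

lemma weight_nonneg (A σ : ℝ) (p : ℕ) : 0 ≤ weight A σ p := by unfold weight; positivity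

lemma weight_antitone {A σ : ℝ} (hA : 0 < A) (hσ : 0 ≤ σ) {m n : ℕ} (hm : 0 < m) (hmn : m ≤ n) :
    weight A σ n ≤ weight A σ m := by
  have hm1 : (1 : ℝ) ≤ m := by exact_mod_cast hm
  have hmn' : (m : ℝ) ≤ n := by exact_mod_cast hmn
  have hl : Real.log m ≤ Real.log n := Real.log_le_log (by linarith) hmn'
  have hl0 : 0 ≤ Real.log m := Real.log_nonneg hm1
  unfold weight
  refine mul_le_mul ?_ ?_ (Real.exp_pos _).le (by positivity)
  · exact Real.rpow_le_rpow_of_nonpos (by linarith) hmn' (by linarith)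
  · rw [Real.exp_le_exp]
    gcongr

lemma weight_le (A σ : ℝ) (hA : 0 < A) (p : ℕ) : weight A σ p ≤ (p : ℝ) ^ (-σ) := by
  unfold weight
  refine mul_le_of_le_one_right (by positivity) ?_
  rw [Real.exp_le_one_iff, neg_nonpos]
  positivity

/-- The exponent 2 already saves one logarithm over the main term, which is of order u / log u.
Constants and thresholds are made uniform over the finitely many pairs. -/
lemma SSOC.exists_bound {k : ℕ} {a : Fin k → ℕ → ℂ} {κ : Fin k → ℝ} (h : SSOC a κ) :
    ∃ C u₀ : ℝ, 0 ≤ C ∧ ∀ u, u₀ ≤ u → ∀ i j,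
      ‖primeCorr (a i) (a j) u - if i = j then ((κ j * Li u : ℝ) : ℂ) else 0‖ ≤
        C * (u / Real.log u ^ 2) := by
  have h1 : ∀ i j, ∃ C : ℝ, 0 ≤ C ∧ ∀ᶠ u : ℝ in atTop,
      ‖primeCorr (a i) (a j) u - if i = j then ((κ j * Li u : ℝ) : ℂ) else 0‖ ≤
        C * (u / Real.log u ^ 2) := by
    intro i j
    obtain ⟨C, hC0, hC⟩ := (h 2 two_pos i j).exists_nonneg
    refine ⟨C, hC0, ?_⟩
    filter_upwards [hC.bound, eventually_gt_atTop 1] with u hu hu1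
    rwa [Real.norm_of_nonneg (div_nonneg (by linarith)
      (Real.rpow_nonneg (Real.log_pos hu1).le _)), Real.rpow_two] at hu
  choose C hC0 hC using h1
  have h2 : ∀ᶠ u : ℝ in atTop, ∀ i j, ‖primeCorr (a i) (a j) u -
      if i = j then ((κ j * Li u : ℝ) : ℂ) else 0‖ ≤ C i j * (u / Real.log u ^ 2) :=
    eventually_all.mpr fun i => eventually_all.mpr fun j => hC i j
  obtain ⟨u₀, hu₀⟩ := eventually_atTop.mp h2
  refine ⟨∑ i, ∑ j, C i j, max u₀ 0,
    Finset.sum_nonneg fun i _ => Finset.sum_nonneg fun j _ => hC0 i j, fun u hu i j => ?_⟩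
  refine (hu₀ u ((le_max_left _ _).trans hu) i j).trans ?_
  have hu0 : 0 ≤ u := (le_max_right _ _).trans hu
  gcongr
  calc C i j ≤ ∑ j, C i j :=
        Finset.single_le_sum (f := fun j => C i j) (fun j _ => hC0 i j) (Finset.mem_univ j)
    _ ≤ _ := Finset.single_le_sum (f := fun i => ∑ j, C i j)
        (fun i _ => Finset.sum_nonneg fun j _ => hC0 i j) (Finset.mem_univ i)

lemma exists_pos_le {ι : Type*} [Finite ι] {f : ι → ℝ} (hf : ∀ i, 0 < f i) :
    ∃ c > 0, ∀ i, c ≤ f i := by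
  have h : ∀ᶠ c : ℝ in 𝓝[>] 0, ∀ i, c ≤ f i := eventually_all.mpr fun i =>
    ((eventually_le_nhds (hf i)).filter_mono nhdsWithin_le_nhds)
  obtain ⟨c, hc, hc0⟩ := (h.and self_mem_nhdsWithin).exists
  exact ⟨c, hc0, hc⟩

/-- Correlations of the coefficients over dyadic primes, with weights. -/
lemma SSOC.exists_weighted {k : ℕ} {a : Fin k → ℕ → ℂ} {κ : Fin k → ℝ} (h : SSOC a κ)
    (hκ : ∀ j, 0 < κ j) {σ : ℝ} (hσ0 : 0 ≤ σ) (hσ1 : σ ≤ 1) :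
    ∃ c : ℝ, 0 < c ∧ ∃ x₀ : ℝ, ∀ x, x₀ ≤ x → ∀ A, 0 < A → Real.log x ^ 2 ≤ A →
      (∀ j, 2 * c * (x ^ (1 - σ) / Real.log x) ≤
        (∑ p ∈ dyadicPrimes x, a j p * conj (a j p) * (weight A σ p : ℂ)).re) ∧
      ∀ i j, i ≠ j → ‖∑ p ∈ dyadicPrimes x, a i p * conj (a j p) * (weight A σ p : ℂ)‖ ≤
        c / (k + 1) * (x ^ (1 - σ) / Real.log x) := by
  obtain ⟨C, u₀, hC0, hC⟩ := h.exists_bound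
  obtain ⟨κ₀, hκ₀, hκle⟩ := exists_pos_le hκ
  -- At least κ₀ x / (4 log x) for the unweighted diagonal sum, times the least weight x^(-σ) / 2,
  -- gives κ₀ / 8 = 2c.
  set c : ℝ := κ₀ / 16 with hc
  -- The first threshold makes the error E at most half of the diagonal main term. The second brings
  -- the off-diagonal sums below the fraction c / (k + 1).
  obtain ⟨x₁, hx₁⟩ := eventually_atTop.mp
    ((Real.tendsto_log_atTop.eventually_ge_atTop (32 * C / κ₀)).and
      (Real.tendsto_log_atTop.eventually_ge_atTop (16 * C * (k + 1) / c)))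
  refine ⟨c, by positivity, max x₁ (max (2 * u₀) 4), fun x hx A hA hlA => ?_⟩
  have hx4 : 4 ≤ x := (le_max_right _ _).trans ((le_max_right _ _).trans hx)
  have hxu : u₀ ≤ x / 2 := by
    have := (le_max_left _ _).trans ((le_max_right _ _).trans hx)
    linarith
  obtain ⟨hl1, hl2⟩ := hx₁ x ((le_max_left _ _).trans hx)
  have hx0 : 0 < x := by linarith
  have hlx : 0 < Real.log x := Real.log_pos (by linarith)
  set m := ⌊x / 2⌋₊ with hm
  set n := ⌊x⌋₊ with hn
  have hmx : (m : ℝ) ≤ x / 2 := Nat.floor_le (by linarith)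
  have hmx' : x / 2 < m + 1 := Nat.lt_floor_add_one _
  have hnx : (n : ℝ) ≤ x := Nat.floor_le (by linarith)
  have hnx' : x < n + 1 := Nat.lt_floor_add_one _
  have hmn : m < n := by
    have : (m : ℝ) < n := by linarith
    exact_mod_cast this
  -- the error term at points of `[x / 2, x]`
  have herr : ∀ u, x / 2 ≤ u → u ≤ x → u / Real.log u ^ 2 ≤ 4 * (x / Real.log x ^ 2) := by
    intro u hu1 hu2
    have hlu : Real.log x / 2 ≤ Real.log u := by
      have h1 : Real.log (x / 2) ≤ Real.log u := Real.log_le_log (by linarith) hu1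
      rw [Real.log_div hx0.ne' two_ne_zero] at h1
      have h2 : 2 * Real.log 2 ≤ Real.log x := by
        have : Real.log 4 = 2 * Real.log 2 := by
          rw [show (4 : ℝ) = 2 ^ 2 by norm_num, Real.log_pow]; norm_num
        rw [← this]
        exact Real.log_le_log (by norm_num) hx4
      linarith
    calc u / Real.log u ^ 2 ≤ x / (Real.log x / 2) ^ 2 := by
          gcongr
      _ = 4 * (x / Real.log x ^ 2) := by field_simp; norm_num
  set E : ℝ := 8 * C * (x / Real.log x ^ 2) with hE
  have hE0 : 0 ≤ E := by positivity
  have hdiff : ∀ i j, ∀ u, x / 2 ≤ u → u ≤ x →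
      ‖(primeCorr (a i) (a j) u - primeCorr (a i) (a j) (x / 2)) -
        if i = j then ((κ j * (Li u - Li (x / 2)) : ℝ) : ℂ) else 0‖ ≤ E := by
    intro i j u hu1 hu2
    have h1 := (hC u (hxu.trans hu1) i j).trans
      (mul_le_mul_of_nonneg_left (herr u hu1 hu2) hC0)
    have h2 := (hC (x / 2) hxu i j).trans
      (mul_le_mul_of_nonneg_left (herr (x / 2) le_rfl (by linarith)) hC0)
    have h3 : (primeCorr (a i) (a j) u - primeCorr (a i) (a j) (x / 2)) -
        (if i = j then ((κ j * (Li u - Li (x / 2)) : ℝ) : ℂ) else 0) =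
        (primeCorr (a i) (a j) u - if i = j then ((κ j * Li u : ℝ) : ℂ) else 0) -
        (primeCorr (a i) (a j) (x / 2) - if i = j then ((κ j * Li (x / 2) : ℝ) : ℂ) else 0) := by
      split_ifs
      · push_cast; ring
      · ring
    rw [h3]
    refine (norm_sub_le _ _).trans ((add_le_add h1 h2).trans (le_of_eq ?_))
    rw [hE]; ring
  have hdy : ∀ f : ℕ → ℂ, ∑ p ∈ dyadicPrimes x, f p =
      ∑ p ∈ Finset.Ioc m n, if p.Prime then f p else 0 := fun f => by
    rw [dyadicPrimes, Finset.sum_filter]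
  have hxσ : x * x ^ (-σ) = x ^ (1 - σ) := by
    rw [sub_eq_add_neg, Real.rpow_add hx0, Real.rpow_one]
  constructor
  · intro j
    have hsum : ∑ p ∈ dyadicPrimes x, (‖a j p‖ ^ 2 : ℝ) =
        (primeCorr (a j) (a j) x - primeCorr (a j) (a j) (x / 2)).re := by
      rw [primeCorr_sub (by linarith), ← hdy, Complex.re_sum]
      refine Finset.sum_congr rfl fun p _ => ?_
      rw [Complex.mul_conj, Complex.ofReal_re, Complex.normSq_eq_norm_sq]
    have h1 : κ₀ * x / (4 * Real.log x) ≤ ∑ p ∈ dyadicPrimes x, (‖a j p‖ ^ 2 : ℝ) := by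
      have h2 := hdiff j j x (by linarith) le_rfl
      rw [if_pos rfl] at h2
      have h3 := (abs_le.mp ((Complex.abs_re_le_norm _).trans h2)).1
      rw [Complex.sub_re, Complex.ofReal_re, ← hsum] at h3
      have h4 := Li_sub_Li_ge hx4
      have h5 : κ₀ * (x / 2 / Real.log x) ≤ κ j * (Li x - Li (x / 2)) := by
        refine mul_le_mul (hκle j) h4 (by positivity) (hκ j).le
      have h6 : E ≤ κ₀ * x / (4 * Real.log x) := by
        rw [hE]
        rw [div_le_iff₀ hκ₀] at hl1
        rw [mul_div_assoc', div_le_div_iff₀ (by positivity) (by positivity)]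
        have : 0 < x * Real.log x := by positivity
        nlinarith
      have h7 : κ₀ * (x / 2 / Real.log x) = 2 * (κ₀ * x / (4 * Real.log x)) := by
        field_simp; norm_num
      linarith
    -- As (log x)² ≤ A, the Gaussian factor is at least 1/2 up to x. The diagonal terms are
    -- nonnegative, so bounding every weight below by the one at n is enough; the off-diagonal terms
    -- oscillate and need Abel's inequality.
    have hw : x ^ (-σ) / 2 ≤ weight A σ n := by
      have hn0 : (0 : ℝ) < n := by
        have : 0 < n := by omega
        exact_mod_cast this
      unfold weight
      have e1 : x ^ (-σ) ≤ (n : ℝ) ^ (-σ) :=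
        Real.rpow_le_rpow_of_nonpos hn0 hnx (by linarith)
      have e2 : (1 : ℝ) / 2 ≤ Real.exp (-(Real.log n ^ 2 / (4 * A))) := by
        have hln : Real.log n ≤ Real.log x := Real.log_le_log hn0 hnx
        have hln0 : 0 ≤ Real.log n := Real.log_nonneg (by
          have : 1 ≤ n := by omega
          exact_mod_cast this)
        have h8 : Real.log n ^ 2 / (4 * A) ≤ 1 / 4 := by
          rw [div_le_iff₀ (by positivity)]
          nlinarith
        have h9 := Real.add_one_le_exp (-(Real.log n ^ 2 / (4 * A)))
        linarith
      calc x ^ (-σ) / 2 = x ^ (-σ) * (1 / 2) := by ring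
        _ ≤ _ := mul_le_mul e1 e2 (by norm_num) (by positivity)
    have hre : (∑ p ∈ dyadicPrimes x, a j p * conj (a j p) * (weight A σ p : ℂ)).re =
        ∑ p ∈ dyadicPrimes x, ‖a j p‖ ^ 2 * weight A σ p := by
      rw [Complex.re_sum]
      refine Finset.sum_congr rfl fun p _ => ?_
      rw [Complex.mul_conj, ← Complex.ofReal_mul, Complex.ofReal_re, Complex.normSq_eq_norm_sq]
    rw [hre]
    calc 2 * c * (x ^ (1 - σ) / Real.log x)
        = κ₀ * x / (4 * Real.log x) * (x ^ (-σ) / 2) := by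
          rw [hc, ← hxσ]; field_simp; norm_num
      _ ≤ (∑ p ∈ dyadicPrimes x, (‖a j p‖ ^ 2 : ℝ)) * weight A σ n :=
          mul_le_mul h1 hw (by positivity) (Finset.sum_nonneg fun p _ => by positivity)
      _ = ∑ p ∈ dyadicPrimes x, ‖a j p‖ ^ 2 * weight A σ n := Finset.sum_mul _ _ _
      _ ≤ _ := by
          refine Finset.sum_le_sum fun p hp => ?_
          have hp' := (Finset.mem_filter.mp hp)
          exact mul_le_mul_of_nonneg_left
            (weight_antitone hA hσ0 hp'.2.pos (Finset.mem_Ioc.mp hp'.1).2) (by positivity)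
  · intro i j hij
    rw [hdy]
    have hconv : ∀ p, (if p.Prime then a i p * conj (a j p) * (weight A σ p : ℂ) else 0) =
        (if p.Prime then a i p * conj (a j p) else 0) * (weight A σ p : ℂ) := fun p => by
      split_ifs <;> simp
    simp_rw [hconv]
    have habel := norm_sum_Ioc_mul_le hmn (g := weight A σ) (E := E)
      (c := fun p => if p.Prime then a i p * conj (a j p) else 0)
      (fun l hl => weight_antitone hA hσ0 (by omega) (Nat.le_succ l)) (weight_nonneg _ _ _)
      (fun l hl1 hl2 => by
        have hl1' : x / 2 ≤ (l : ℝ) := by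
          have : (m : ℝ) + 1 ≤ l := by exact_mod_cast hl1
          linarith
        have hl2' : (l : ℝ) ≤ x := by
          have : (l : ℝ) ≤ n := by exact_mod_cast hl2
          linarith
        have h1 := hdiff i j l hl1' hl2'
        rw [if_neg hij, sub_zero, primeCorr_sub hl1', Nat.floor_natCast] at h1
        exact h1)
    refine habel.trans ?_
    have hw : weight A σ (m + 1) ≤ 2 * x ^ (-σ) := by
      refine (weight_le A σ hA _).trans ?_
      calc (((m + 1 : ℕ) : ℝ)) ^ (-σ) ≤ (x / 2) ^ (-σ) :=
            Real.rpow_le_rpow_of_nonpos (by linarith) (by push_cast; linarith) (by linarith)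
        _ = x ^ (-σ) * 2 ^ σ := by
            rw [Real.div_rpow hx0.le (by norm_num), Real.rpow_neg (by norm_num : (0 : ℝ) ≤ 2),
              div_inv_eq_mul]
        _ ≤ x ^ (-σ) * 2 := by
            gcongr
            calc (2 : ℝ) ^ σ ≤ 2 ^ (1 : ℝ) := Real.rpow_le_rpow_of_exponent_le (by norm_num) hσ1
              _ = 2 := Real.rpow_one 2
        _ = _ := by ring
    have hc0 : 0 < c := by positivity
    have hk0 : (0 : ℝ) < k + 1 := by positivity
    calc E * weight A σ (m + 1) ≤ E * (2 * x ^ (-σ)) := mul_le_mul_of_nonneg_left hw hE0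
      _ = 16 * C / Real.log x * (x ^ (1 - σ) / Real.log x) := by
          rw [hE, ← hxσ]; field_simp; ring
      _ ≤ _ := by
          refine mul_le_mul_of_nonneg_right ?_ (by positivity)
          rw [div_le_div_iff₀ hlx hk0]
          rw [div_le_iff₀ hc0] at hl2
          linarith

/-- The direction `∑ e^{iθ_i} conj (a_i(p)) / B` on the dyadic primes. -/
noncomputable def direction {k : ℕ} (a : Fin k → ℕ → ℂ) (θ : Fin k → ℝ) (B x : ℝ) (p : ℕ) : ℂ :=
  if p ∈ dyadicPrimes x then
    (∑ i, Complex.exp ((θ i : ℂ) * Complex.I) * conj (a i p)) / B else 0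

lemma norm_direction_le {k : ℕ} {a : Fin k → ℕ → ℂ} {B : ℝ} (hB : 0 < B)
    (ha : ∀ p, p.Prime → ∑ i, ‖a i p‖ ≤ B) (θ : Fin k → ℝ) (x : ℝ) (p : ℕ) :
    ‖direction a θ B x p‖ ≤ 1 := by
  unfold direction
  split_ifs with hp
  · rw [norm_div, Complex.norm_real, Real.norm_of_nonneg hB.le, div_le_one hB]
    refine le_trans (norm_sum_le_of_le _ fun i _ => ?_) (ha p (Finset.mem_filter.mp hp).2)
    rw [norm_mul, Complex.norm_exp_ofReal_mul_I, one_mul, Complex.norm_conj]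
  · simp

/-- One direction serves every j. The phase e^{-iθ_j} cancels exactly the i = j term, which
contributes at least 2cX; the other terms together are at most cX in norm. The factor 1 / (2B)
combines the normalisation by B with the mean β_p / 2. -/
lemma re_mean_ge {k : ℕ} {a : Fin k → ℕ → ℂ} {B x A σ c X : ℝ} (hB : 0 < B) (hX : 0 ≤ X)
    (hc : 0 < c)
    (hdiag : ∀ j, 2 * c * X ≤
        (∑ p ∈ dyadicPrimes x, a j p * conj (a j p) * (weight A σ p : ℂ)).re)
    (hoff : ∀ i j, i ≠ j → ‖∑ p ∈ dyadicPrimes x, a i p * conj (a j p) * (weight A σ p : ℂ)‖ ≤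
        c / (k + 1) * X) (θ : Fin k → ℝ) (j : Fin k) :
    c / (2 * B) * X ≤ (Complex.exp (-(θ j : ℂ) * Complex.I) *
      ∑ p ∈ dyadicPrimes x, a j p * (weight A σ p : ℂ) * (direction a θ B x p / 2)).re := by
  classical
  set W : Fin k → ℂ := fun i => ∑ p ∈ dyadicPrimes x, a j p * conj (a i p) * (weight A σ p : ℂ)
    with hW
  have hBc : (B : ℂ) ≠ 0 := by exact_mod_cast hB.ne'
  have hexp : Complex.exp (-(θ j : ℂ) * Complex.I) *
      ∑ p ∈ dyadicPrimes x, a j p * (weight A σ p : ℂ) * (direction a θ B x p / 2) =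
      ((1 / (2 * B) : ℝ) : ℂ) * ∑ i, Complex.exp (((θ i - θ j : ℝ) : ℂ) * Complex.I) * W i := by
    have h1 : ∀ p ∈ dyadicPrimes x,
        a j p * (weight A σ p : ℂ) * (direction a θ B x p / 2) = ∑ i, 1 / (2 * (B : ℂ)) *
          (Complex.exp ((θ i : ℂ) * Complex.I) * (a j p * conj (a i p) * (weight A σ p : ℂ))) := by
      intro p hp
      rw [direction, if_pos hp, Finset.sum_div, Finset.sum_div, Finset.mul_sum]
      refine Finset.sum_congr rfl fun i _ => ?_
      field_simp
    rw [Finset.sum_congr rfl h1, Finset.sum_comm, Finset.mul_sum, Finset.mul_sum]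
    refine Finset.sum_congr rfl fun i _ => ?_
    have h2 : Complex.exp (((θ i - θ j : ℝ) : ℂ) * Complex.I) =
        Complex.exp (-(θ j : ℂ) * Complex.I) * Complex.exp ((θ i : ℂ) * Complex.I) := by
      rw [← Complex.exp_add]; congr 1; push_cast; ring
    rw [h2, ← Finset.mul_sum, ← Finset.mul_sum]
    simp only [hW]
    push_cast
    ring
  rw [hexp, Complex.re_ofReal_mul, ← Finset.add_sum_erase _ _ (Finset.mem_univ j), sub_self,
    Complex.ofReal_zero, zero_mul, Complex.exp_zero, one_mul, Complex.add_re]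
  have hrest : ‖∑ i ∈ Finset.univ.erase j,
      Complex.exp (((θ i - θ j : ℝ) : ℂ) * Complex.I) * W i‖ ≤ c * X := by
    have hk0 : (0 : ℝ) < k + 1 := by positivity
    calc _ ≤ ∑ _i ∈ Finset.univ.erase j, c / (k + 1) * X := by
          refine norm_sum_le_of_le _ fun i hi => ?_
          rw [norm_mul, Complex.norm_exp_ofReal_mul_I, one_mul]
          exact hoff j i (Finset.ne_of_mem_erase hi).symm
      _ = ((Finset.univ.erase j).card : ℝ) * (c / (k + 1) * X) := by
          rw [Finset.sum_const, nsmul_eq_mul]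
      _ ≤ (k + 1) * (c / (k + 1) * X) := by
          gcongr
          have : (Finset.univ.erase j).card ≤ k := (Finset.card_le_univ _).trans (by simp)
          have : ((Finset.univ.erase j).card : ℝ) ≤ k := by exact_mod_cast this
          linarith
      _ = c * X := by field_simp
  have h1 := (abs_le.mp ((Complex.abs_re_le_norm _).trans hrest)).1
  have h2 := hdiag j
  calc c / (2 * B) * X = 1 / (2 * B) * (c * X) := by ring
    _ ≤ _ := by
      gcongr
      simp only [hW]
      linarith

/-! ### Truncation of the smoothed sum -/

/-- Primes up to `N`. -/
def primesUpTo (N : ℕ) : Finset ℕ := {p ∈ Finset.Icc 1 N | p.Prime}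

lemma tsum_primes_ite (N : ℕ) (f : ℕ → ℂ) :
    HasSum (fun p : Nat.Primes => if (p : ℕ) ≤ N then f p else 0) (∑ p ∈ primesUpTo N, f p) := by
  have h1 : HasSum (fun n : ℕ => if n ∈ primesUpTo N then f n else 0)
      (∑ p ∈ primesUpTo N, f p) := by
    have h2 : HasSum (fun n : ℕ => if n ∈ primesUpTo N then f n else 0)
        (∑ p ∈ primesUpTo N, if p ∈ primesUpTo N then f p else 0) :=
      hasSum_sum_of_ne_finset_zero fun b hb => if_neg hb
    rwa [Finset.sum_congr rfl fun p hp => if_pos hp] at h2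
  have h3 : Function.support (fun n : ℕ => if n ∈ primesUpTo N then f n else 0) ⊆
      {p : ℕ | p.Prime} := by
    intro n hn
    by_contra hcon
    refine hn (if_neg fun hmem => hcon ?_)
    exact (Finset.mem_filter.mp hmem).2
  have h4 := (hasSum_subtype_iff_of_support_subset h3).mpr h1
  refine h4.congr_fun fun p => ?_
  have hp : (p : ℕ).Prime := p.2
  have hiff : (p : ℕ) ∈ primesUpTo N ↔ (p : ℕ) ≤ N := by
    simp [primesUpTo, hp, hp.one_le]
  simp only [Function.comp, hiff]

/-- Once log p ≥ 8A, the exponent (log p)² / (4A) is at least 2 log p. The discarded terms are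
therefore dominated by ∑ p^(-2), uniformly in A, σ and t. -/
lemma exists_norm_smoothSum_sub_le {a : ℕ → ℂ} {B : ℝ} (ha : ∀ p, p.Prime → ‖a p‖ ≤ B) :
    ∃ C : ℝ, 0 ≤ C ∧ ∀ A σ t : ℝ, 0 < A → 0 ≤ σ → ∀ N : ℕ, Real.exp (8 * A) < N + 1 →
      ‖smoothSum a A σ t - ∑ p ∈ primesUpTo N, a p * (weight A σ p : ℂ) *
        (Complex.exp ((t * Real.log p : ℝ) * Complex.I))⁻¹‖ ≤ C := by
  have hB : 0 ≤ B := (norm_nonneg _).trans (ha 2 Nat.prime_two)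
  have hs := (summable_primes_rpow (x := 2) (by norm_num)).mul_left B
  refine ⟨∑' p : Nat.Primes, B * ((p : ℕ) : ℝ) ^ (-2 : ℝ), tsum_nonneg fun p => by positivity,
    fun A σ t hA hσ N hN => ?_⟩
  set f : ℕ → ℂ := fun p => a p * (weight A σ p : ℂ) *
        (Complex.exp ((t * Real.log p : ℝ) * Complex.I))⁻¹ with hf
  have hterm : ∀ p : Nat.Primes, a p / ((p : ℕ) : ℂ) ^ (σ + t * Complex.I : ℂ) *
      (Real.exp (-(Real.log p ^ 2 / (4 * A))) : ℂ) = f p := by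
    intro p
    have hp0 : ((p : ℕ) : ℂ) ≠ 0 := by exact_mod_cast p.2.ne_zero
    simp only [hf, weight]
    rw [Complex.cpow_add _ _ hp0, Complex.ofReal_mul, Complex.ofReal_cpow (by positivity),
      Complex.ofReal_natCast, Complex.ofReal_neg, Complex.cpow_neg,
      Complex.cpow_def_of_ne_zero hp0 (t * Complex.I), ← Complex.natCast_log, div_eq_mul_inv,
      mul_inv]
    have : (Real.log (p : ℕ) : ℂ) * (t * Complex.I) =
        ((t * Real.log (p : ℕ) : ℝ) : ℂ) * Complex.I := by
      push_cast; ring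
    rw [this]
    ring
  have hbound : ∀ p : Nat.Primes, ‖f p - if (p : ℕ) ≤ N then f p else 0‖ ≤
      B * ((p : ℕ) : ℝ) ^ (-2 : ℝ) := by
    intro p
    split_ifs with hpN
    · rw [sub_self, norm_zero]; positivity
    · have hp1 : (1 : ℝ) ≤ (p : ℕ) := by exact_mod_cast p.2.one_le
      have hpN' : (N : ℝ) + 1 ≤ (p : ℕ) := by exact_mod_cast Nat.lt_of_not_le hpN
      have hlog : 8 * A ≤ Real.log (p : ℕ) := by
        rw [Real.le_log_iff_exp_le (by linarith)]; linarith
      simp only [hf]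
      rw [sub_zero, norm_mul, norm_mul, norm_inv, Complex.norm_exp_ofReal_mul_I, inv_one, mul_one,
        Complex.norm_real, Real.norm_of_nonneg (weight_nonneg _ _ _)]
      refine mul_le_mul (ha p p.2) ?_ (weight_nonneg _ _ _) hB
      unfold weight
      calc ((p : ℕ) : ℝ) ^ (-σ) * Real.exp (-(Real.log (p : ℕ) ^ 2 / (4 * A)))
          ≤ 1 * Real.exp (Real.log (p : ℕ) * (-2)) := by
            refine mul_le_mul ?_ ?_ (Real.exp_pos _).le zero_le_one
            · exact Real.rpow_le_one_of_one_le_of_nonpos hp1 (by linarith)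
            · rw [Real.exp_le_exp]
              have : Real.log (p : ℕ) * 2 ≤ Real.log (p : ℕ) ^ 2 / (4 * A) := by
                rw [le_div_iff₀ (by positivity)]
                nlinarith [Real.log_nonneg hp1]
              linarith
        _ = ((p : ℕ) : ℝ) ^ (-2 : ℝ) := by
            rw [one_mul, Real.rpow_def_of_pos (by linarith)]
  have h1 := tsum_primes_ite N f
  have h2 : Summable fun p : Nat.Primes => f p - if (p : ℕ) ≤ N then f p else 0 :=
    Summable.of_norm_bounded hs hbound
  have h3 : smoothSum a A σ t = ∑ p ∈ primesUpTo N, f p +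
      ∑' p : Nat.Primes, (f p - if (p : ℕ) ≤ N then f p else 0) := by
    have h4 := (h1.add h2.hasSum).tsum_eq
    rw [← h4, smoothSum]
    refine tsum_congr fun p => ?_
    rw [hterm p]; ring
  rw [h3, add_sub_cancel_left]
  exact tsum_of_norm_bounded hs.hasSum hbound

/-! ### Growth comparisons -/

lemma eventually_mul_sqrt_le_exp (C : ℝ) {b : ℝ} (hb : 0 < b) :
    ∀ᶠ l : ℝ in atTop, C * (√l + 3) ≤ Real.exp (b * l) := by
  have h1 : (fun l : ℝ => l ^ 1) =o[atTop] fun l => Real.exp (b * l) :=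
    isLittleO_pow_exp_pos_mul_atTop 1 hb
  have hC : (0 : ℝ) < (4 * (|C| + 1))⁻¹ := by positivity
  filter_upwards [h1.bound hC, eventually_ge_atTop 1] with l hl hl1
  rw [pow_one, Real.norm_of_nonneg (by linarith), Real.norm_of_nonneg (Real.exp_pos _).le,
    ← div_eq_inv_mul, le_div_iff₀ (by positivity)] at hl
  have h2 : √l ≤ l := Real.sqrt_le_iff.mpr ⟨by linarith, by nlinarith⟩
  have h3 : 0 ≤ √l := Real.sqrt_nonneg l
  calc C * (√l + 3) ≤ (|C| + 1) * (4 * l) := by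
        have := le_abs_self C
        gcongr
        · linarith
        · linarith
    _ ≤ _ := by linarith

/-- The constant 48 is 6 · 8: the errors contain N^6 with N ≤ exp(8A) and A = (log l)². -/
lemma eventually_mul_sq_log_le {C b : ℝ} (hb : 0 < b) :
    ∀ᶠ l : ℝ in atTop, C + 48 * Real.log l ^ 2 ≤ b * l := by
  have h1 : (fun l : ℝ => Real.log l ^ 2) =o[atTop] (id : ℝ → ℝ) := Real.isLittleO_pow_log_id_atTop
  have hb' : 0 < b / 96 := by positivity
  filter_upwards [h1.bound hb', eventually_ge_atTop (2 * C / b), eventually_ge_atTop 0]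
    with l hl hlC hl0
  rw [id, Real.norm_of_nonneg (by positivity), Real.norm_of_nonneg hl0] at hl
  rw [div_le_iff₀ hb] at hlC
  linarith

lemma eventually_le_rpow_div_log (M : ℝ) {s : ℝ} (hs : 0 < s) :
    ∀ᶠ l : ℝ in atTop, M ≤ l ^ s / Real.log l := by
  have h1 := isLittleO_log_rpow_atTop hs
  have hM : (0 : ℝ) < (|M| + 1)⁻¹ := by positivity
  filter_upwards [h1.bound hM, eventually_gt_atTop 1] with l hl hl1
  have hlog : 0 < Real.log l := Real.log_pos hl1
  rw [Real.norm_of_nonneg hlog.le, Real.norm_of_nonneg (by positivity), ← div_eq_inv_mul,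
    le_div_iff₀ (by positivity)] at hl
  rw [le_div_iff₀ hlog]
  have := le_abs_self M
  nlinarith

/-- Here l = log T, A = (log l)² and H = √l. From l ≥ 400 on, 4 + 4H - H²/2 ≤ -l/4, so the
exponential is at most exp(-A l / 4). Since A → ∞ this beats t^B ≤ exp(B l + B) for any fixed B. -/
lemma eventually_error_le (D B : ℝ) (hD : 0 < D) (hB : 0 < B) :
    ∀ᶠ l : ℝ in atTop, ∀ t : ℝ, 0 < t → t ≤ 2 * Real.exp l →
      D * t ^ B * ((Real.log l ^ 2) ^ 2 * (√l + 1) *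
        Real.exp (Real.log l ^ 2 * (4 + 4 * √l - √l ^ 2 / 2))) ≤ 1 := by
  filter_upwards [eventually_mul_sqrt_le_exp D (b := 1 / 2) (by norm_num),
    eventually_mul_sq_log_le (C := 0) (b := 1 / 4) (by norm_num),
    Real.tendsto_log_atTop.eventually_ge_atTop (4 * B + 2 * B + 8), eventually_ge_atTop 400]
    with l h1 h2 h3 h4 t ht ht2
  set y := Real.log l with hy
  have hl0 : 0 ≤ l := by linarith
  have hsq : √l ^ 2 = l := Real.sq_sqrt hl0
  have hs20 : 20 ≤ √l := Real.le_sqrt_of_sq_le (by linarith)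
  have e1 : t ^ B ≤ Real.exp (B * l + B) := by
    calc t ^ B ≤ (2 * Real.exp l) ^ B := by gcongr
      _ ≤ (Real.exp 1 * Real.exp l) ^ B := by
          have := Real.add_one_le_exp (1 : ℝ)
          have h2e : (2 : ℝ) ≤ Real.exp 1 := by linarith
          gcongr
      _ = _ := by rw [← Real.exp_add, ← Real.exp_mul]; ring_nf
  have e2 : (y ^ 2) ^ 2 ≤ Real.exp (l / 2) := by
    have h5 := Real.add_one_le_exp (y ^ 2)
    have h6 : y ^ 2 ≤ Real.exp (y ^ 2) := by linarith
    calc (y ^ 2) ^ 2 ≤ Real.exp (y ^ 2) ^ 2 := by gcongr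
      _ = Real.exp (2 * y ^ 2) := by rw [← Real.exp_nat_mul]; norm_num
      _ ≤ _ := by
        rw [Real.exp_le_exp]
        nlinarith [sq_nonneg y]
  have e3 : D * (√l + 1) ≤ Real.exp (l / 2) := by
    have : D * (√l + 1) ≤ D * (√l + 3) := by gcongr; norm_num
    refine this.trans (h1.trans (le_of_eq ?_))
    ring_nf
  have e4 : Real.exp (y ^ 2 * (4 + 4 * √l - √l ^ 2 / 2)) ≤ Real.exp (-(y ^ 2 * (l / 4))) := by
    rw [Real.exp_le_exp]
    have : 4 + 4 * √l - √l ^ 2 / 2 ≤ -(l / 4) := by nlinarith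
    nlinarith [sq_nonneg y]
  calc D * t ^ B * ((y ^ 2) ^ 2 * (√l + 1) * Real.exp (y ^ 2 * (4 + 4 * √l - √l ^ 2 / 2)))
      = t ^ B * (y ^ 2) ^ 2 * (D * (√l + 1)) *
          Real.exp (y ^ 2 * (4 + 4 * √l - √l ^ 2 / 2)) := by ring
    _ ≤ Real.exp (B * l + B) * Real.exp (l / 2) * Real.exp (l / 2) *
          Real.exp (-(y ^ 2 * (l / 4))) := by gcongr
    _ = Real.exp (B * l + B + l / 2 + l / 2 + -(y ^ 2 * (l / 4))) := by
        rw [← Real.exp_add, ← Real.exp_add, ← Real.exp_add]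
    _ ≤ 1 := by
        rw [Real.exp_le_one_iff]
        have h7 : 4 * (B + B + 1) ≤ y ^ 2 := by nlinarith
        have h8 : 4 * (B + B + 1) * (l / 4) ≤ y ^ 2 * (l / 4) := by gcongr
        nlinarith

/-! ### A good central ordinate -/

lemma card_dyadicPrimes_le (x : ℝ) : (dyadicPrimes x).card ≤ ⌊x⌋₊ := by
  refine (Finset.card_filter_le _ _).trans ?_
  rw [Nat.card_Ioc]
  exact Nat.sub_le _ _

lemma two_pow_card_dyadicPrimes_le {x : ℝ} (hx : 0 ≤ x) :
    (2 : ℝ) ^ (dyadicPrimes x).card ≤ Real.exp x := by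
  calc (2 : ℝ) ^ (dyadicPrimes x).card ≤ 2 ^ ⌊x⌋₊ :=
        pow_le_pow_right₀ one_le_two (card_dyadicPrimes_le x)
    _ ≤ Real.exp 1 ^ ⌊x⌋₊ := by
        have := Real.add_one_le_exp (1 : ℝ)
        gcongr; linarith
    _ = Real.exp ⌊x⌋₊ := by rw [← Real.exp_nat_mul, mul_one]
    _ ≤ Real.exp x := Real.exp_le_exp.mpr (Nat.floor_le hx)

/-- Chebyshev's bound 4^n for the primorial, squared, with 16 < e³. The Riesz product over primes up
to x thus has errors exponential in x, which is why x may be a small multiple of log T. -/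
lemma prod_sq_dyadicPrimes_le {x : ℝ} (hx : 0 ≤ x) :
    ((∏ p ∈ dyadicPrimes x, p ^ 2 : ℕ) : ℝ) ≤ Real.exp (3 * x) := by
  have h1 : ∏ p ∈ dyadicPrimes x, p ≤ primorial ⌊x⌋₊ := by
    unfold primorial dyadicPrimes
    refine Finset.prod_le_prod_of_subset_of_one_le' (fun p hp => ?_) fun p hp _ => ?_
    · simp only [Finset.mem_filter, Finset.mem_Ioc, Finset.mem_range] at hp ⊢
      exact ⟨by omega, hp.2⟩
    · exact (Finset.mem_filter.mp hp).2.one_le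
  have h2 : ∏ p ∈ dyadicPrimes x, p ^ 2 ≤ 16 ^ ⌊x⌋₊ := by
    rw [Finset.prod_pow]
    calc _ ≤ (4 ^ ⌊x⌋₊) ^ 2 := Nat.pow_le_pow_left (h1.trans (primorial_le_four_pow _)) 2
      _ = 16 ^ ⌊x⌋₊ := by rw [← pow_mul, mul_comm, pow_mul]; norm_num
  calc ((∏ p ∈ dyadicPrimes x, p ^ 2 : ℕ) : ℝ) ≤ 16 ^ ⌊x⌋₊ := by exact_mod_cast h2
    _ ≤ Real.exp 3 ^ ⌊x⌋₊ := by
        have h3 : (2.7 : ℝ) ≤ Real.exp 1 := by linarith [Real.exp_one_gt_d9]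
        have h4 : Real.exp 3 = Real.exp 1 ^ 3 := by rw [← Real.exp_nat_mul]; norm_num
        have h5 : (2.7 : ℝ) ^ 3 ≤ Real.exp 1 ^ 3 := by gcongr
        gcongr
        rw [h4]; norm_num at h5 ⊢; linarith
    _ = Real.exp (⌊x⌋₊ * 3) := by rw [← Real.exp_nat_mul]
    _ ≤ Real.exp (3 * x) := by
        rw [Real.exp_le_exp]; linarith [Nat.floor_le hx]

lemma sum_primesUpTo_le_tsum {s : ℝ} (hs : 1 < s) (N : ℕ) :
    ∑ p ∈ primesUpTo N, (p : ℝ) ^ (-s) ≤ ∑' p : Nat.Primes, ((p : ℕ) : ℝ) ^ (-s) := by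
  have h1 : ∑ p ∈ primesUpTo N, (p : ℝ) ^ (-s) =
      ∑ p ∈ (primesUpTo N).subtype Nat.Prime, ((p : ℕ) : ℝ) ^ (-s) :=
    (Finset.sum_subtype_of_mem _ fun p hp => (Finset.mem_filter.mp hp).2).symm
  rw [h1]
  exact Summable.sum_le_tsum (f := fun p : Nat.Primes => ((p : ℕ) : ℝ) ^ (-s)) _
    (fun p _ => by positivity) (summable_primes_rpow hs)

lemma dyadicPrimes_subset_primesUpTo {x : ℝ} {N : ℕ} (h : ⌊x⌋₊ ≤ N) :
    dyadicPrimes x ⊆ primesUpTo N := by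
  intro p hp
  simp only [dyadicPrimes, primesUpTo, Finset.mem_filter, Finset.mem_Ioc, Finset.mem_Icc] at hp ⊢
  exact ⟨⟨hp.2.one_le, by omega⟩, hp.2⟩

/-- An ordinate far from a sparse set, at which all smoothed sums point in the prescribed
directions. -/
lemma SSOC.exists_centre {k : ℕ} {a : Fin k → ℕ → ℂ} {κ : Fin k → ℝ} (h : SSOC a κ)
    (hκ : ∀ j, 0 < κ j) {σ : ℝ} (hσ : 1 / 2 < σ) (hσ1 : σ < 1) {B : ℝ} (hB : 0 < B)
    (ha : ∀ p, p.Prime → ∑ i, ‖a i p‖ ≤ B) {η : ℝ} (hη : 0 < η) (hη1 : η ≤ 1 / 16) (K : ℝ) :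
    ∃ c M : ℝ, 0 < c ∧ ∀ᶠ T : ℝ in atTop, ∀ θ : Fin k → ℝ, ∀ F : Finset ℝ,
      (F.card : ℝ) ≤ K * T ^ (1 - 8 * η) →
      ∃ t ∈ Set.Ioc T (2 * T), (∀ y ∈ F, √(Real.log T) + 3 < |t - y|) ∧
        ∀ j, c * (Real.log T ^ (1 - σ) / Real.log (Real.log T)) - M ≤
          (Complex.exp (-(θ j : ℂ) * Complex.I) *
            smoothSum (a j) (Real.log (Real.log T) ^ 2) σ t).re := by
  obtain ⟨c, hc, x₀, hx₀⟩ := h.exists_weighted hκ (by linarith) hσ1.le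
  have haj : ∀ j p, p.Prime → ‖a j p‖ ≤ B := fun j p hp =>
    (Finset.single_le_sum (f := fun i => ‖a i p‖) (fun i _ => norm_nonneg _)
      (Finset.mem_univ j)).trans (ha p hp)
  choose C hC0 hC using fun j => exists_norm_smoothSum_sub_le (haj j)
  set Z : ℝ := ∑' p : Nat.Primes, ((p : ℕ) : ℝ) ^ (-(2 * σ)) with hZ
  have hZ0 : 0 ≤ Z := tsum_nonneg fun p => by positivity
  set G : ℝ := 4 * (B ^ 2 * Z) with hG
  have hG0 : 0 ≤ G := by positivity
  refine ⟨c / (2 * B) * η ^ (1 - σ), √(2 * (k * (2 * G + 1)) + 1) + ∑ j, C j, by positivity, ?_⟩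
  have hlog := Real.tendsto_log_atTop
  filter_upwards [hlog.eventually (eventually_mul_sqrt_le_exp (16 * |K|)
      (b := 7 * η) (by positivity)),
    hlog.eventually (eventually_mul_sq_log_le (C := 8 * B ^ 2) (b := 1 / 2) (by norm_num)),
    (hlog.comp hlog).eventually_ge_atTop 1, hlog.eventually_ge_atTop (x₀ / η),
    hlog.eventually_ge_atTop (3 / η), hlog.eventually_ge_atTop 4, eventually_gt_atTop 0]
    with T e1 e2 e3 e4 e5 e6 hT θ F hF
  simp only [Function.comp] at e3
  set l := Real.log T with hl
  -- The smoothing must keep the primes up to x = η l, so (log x)² ≤ A is needed. It must also be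
  -- strong enough that N = exp(8A) is a subpolynomial cutoff; N^6 is then negligible against T.
  set A := Real.log l ^ 2 with hA
  set x := η * l with hx
  set N := ⌊Real.exp (8 * A)⌋₊ with hN
  have hTl : T = Real.exp l := (Real.exp_log hT).symm
  have hl0 : 0 < l := by linarith
  have hA1 : 1 ≤ A := by rw [hA]; nlinarith
  rw [div_le_iff₀ hη] at e4 e5
  have hx0 : x₀ ≤ x := by rw [hx]; linarith
  have hx3 : 3 ≤ x := by rw [hx]; linarith
  have hxl : x ≤ l / 16 := by rw [hx]; nlinarith
  have hlogx : 0 < Real.log x := Real.log_pos (by linarith)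
  have hlogxl : Real.log x ≤ Real.log l := Real.log_le_log (by linarith) (by linarith)
  obtain ⟨hdiag, hoff⟩ := hx₀ x hx0 A (by linarith) (by rw [hA]; gcongr)
  have hNle : (N : ℝ) ≤ Real.exp (8 * A) := Nat.floor_le (Real.exp_pos _).le
  have hxN : ⌊x⌋₊ ≤ N := by
    refine Nat.floor_le_floor ?_
    calc x ≤ Real.exp (Real.log l) := by rw [Real.exp_log hl0]; linarith
      _ ≤ Real.exp (8 * A) := by rw [Real.exp_le_exp, hA]; nlinarith
  have hcard := two_pow_card_dyadicPrimes_le (x := x) (by linarith)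
  have hprod := prod_sq_dyadicPrimes_le (x := x) (by linarith)
  have hPx : ((∏ p ∈ dyadicPrimes x, p ^ 2 : ℕ) : ℝ) * 2 ^ (dyadicPrimes x).card ≤
      Real.exp (l / 4) := by
    calc _ ≤ Real.exp (3 * x) * Real.exp x := by gcongr
      _ = Real.exp (4 * x) := by rw [← Real.exp_add]; ring_nf
      _ ≤ _ := by rw [Real.exp_le_exp]; linarith
  have hd : ∀ j p, p.Prime → ‖a j p * (weight A σ p : ℂ)‖ ≤ B * (p : ℝ) ^ (-σ) := by
    intro j p hp
    rw [norm_mul, Complex.norm_real, Real.norm_of_nonneg (weight_nonneg _ _ _)]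
    exact mul_le_mul (haj j p hp) (weight_le _ _ (by linarith) _) (weight_nonneg _ _ _) hB.le
  have hT8 : Real.exp (l - 8 * η * l) = T ^ (1 - 8 * η) := by
    rw [Real.rpow_def_of_pos hT, ← hl]; ring_nf
  obtain ⟨t, ht, htF, htd⟩ := exists_ordinate (β := direction a θ B x) (S := dyadicPrimes x)
    (S' := primesUpTo N) (N := N) (T := T) (h := √l + 3) (G := G)
    (norm_direction_le hB ha θ x) (fun p hp => (Finset.mem_filter.mp hp).2)
    (fun p hp => by rw [direction, if_neg hp])
    (fun p hp => ⟨(Finset.mem_filter.mp hp).2,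
      (Finset.mem_Icc.mp (Finset.mem_filter.mp hp).1).2⟩)
    (fun j p => a j p * (weight A σ p : ℂ)) hT (by positivity) hG0 F
    (by
      -- The weight costs e^x = T^η, so the excluded set contributes about T^(1-7η) √l. The
      -- remaining T^(7η) absorbs √l and the constants.
      have h1 : (F.card : ℝ) ≤ |K| * Real.exp (l - 8 * η * l) := by
        rw [hT8]
        refine hF.trans ?_
        gcongr
        exact le_abs_self K
      calc (2 : ℝ) ^ (dyadicPrimes x).card * (F.card * (2 * (√l + 3)))
          ≤ Real.exp x * (|K| * Real.exp (l - 8 * η * l) * (2 * (√l + 3))) :=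
            mul_le_mul hcard (mul_le_mul_of_nonneg_right h1 (by positivity))
              (mul_nonneg (Nat.cast_nonneg _) (by positivity)) (Real.exp_pos _).le
        _ = Real.exp x * Real.exp (l - 8 * η * l) * (16 * |K| * (√l + 3)) / 8 := by ring
        _ ≤ Real.exp x * Real.exp (l - 8 * η * l) * Real.exp (7 * η * l) / 8 := by gcongr
        _ = Real.exp l / 8 := by
          rw [← Real.exp_add, ← Real.exp_add, hx]; congr 2; ring
        _ = T / 8 := by rw [← hTl])
    (by
      have h16 : (16 : ℝ) ≤ Real.exp (3 * l / 4) := by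
        have h3 : (2.7 : ℝ) ≤ Real.exp 1 := by linarith [Real.exp_one_gt_d9]
        have h4 : Real.exp 3 = Real.exp 1 ^ 3 := by rw [← Real.exp_nat_mul]; norm_num
        have h5 : (2.7 : ℝ) ^ 3 ≤ Real.exp 1 ^ 3 := by gcongr
        have h6 : Real.exp 3 ≤ Real.exp (3 * l / 4) := by
          rw [Real.exp_le_exp]; linarith
        norm_num at h5
        linarith
      calc 2 * ((∏ p ∈ dyadicPrimes x, p ^ 2 : ℕ) : ℝ) * 2 ^ (dyadicPrimes x).card
          = 16 * (((∏ p ∈ dyadicPrimes x, p ^ 2 : ℕ) : ℝ) * 2 ^ (dyadicPrimes x).card) / 8 := by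
            ring
        _ ≤ Real.exp (3 * l / 4) * Real.exp (l / 4) / 8 := by gcongr
        _ = Real.exp l / 8 := by rw [← Real.exp_add]; congr 2; ring
        _ = T / 8 := by rw [← hTl])
    (by
      intro j
      rw [hG]
      refine mul_le_mul_of_nonneg_left ?_ (by norm_num)
      calc ∑ p ∈ primesUpTo N, ‖a j p * (weight A σ p : ℂ)‖ ^ 2
          ≤ ∑ p ∈ primesUpTo N, B ^ 2 * (p : ℝ) ^ (-(2 * σ)) := by
            refine Finset.sum_le_sum fun p hp => ?_
            have h1 := hd j p (Finset.mem_filter.mp hp).2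
            calc _ ≤ (B * (p : ℝ) ^ (-σ)) ^ 2 := by gcongr
              _ = _ := by
                rw [mul_pow, ← Real.rpow_natCast (_ ^ (-σ)), ← Real.rpow_mul (by positivity)]
                congr 2; push_cast; ring
        _ ≤ B ^ 2 * Z := by
            rw [← Finset.mul_sum]
            gcongr
            exact sum_primesUpTo_le_tsum (by linarith) N)
    (by
      intro j
      have h1 : ∑ p ∈ primesUpTo N, ‖a j p * (weight A σ p : ℂ)‖ ≤ B * N := by
        calc _ ≤ ∑ p ∈ primesUpTo N, B := by
              refine Finset.sum_le_sum fun p hp => ?_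
              have hp := (Finset.mem_filter.mp hp).2
              refine (hd j p hp).trans (mul_le_of_le_one_right hB.le ?_)
              exact Real.rpow_le_one_of_one_le_of_nonpos (by exact_mod_cast hp.one_le)
                (by linarith)
          _ = (primesUpTo N).card * B := by rw [Finset.sum_const, nsmul_eq_mul]
          _ ≤ B * N := by
              rw [mul_comm]
              gcongr
              refine (Finset.card_filter_le _ _).trans ?_
              rw [Nat.card_Icc]; omega
      have h2 : 8 * B ^ 2 ≤ Real.exp (8 * B ^ 2) := by
        linarith [Real.add_one_le_exp (8 * B ^ 2)]
      calc (∑ p ∈ primesUpTo N, ‖a j p * (weight A σ p : ℂ)‖) ^ 2 * (8 * (N : ℝ) ^ 4 *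
            ((∏ p ∈ dyadicPrimes x, p ^ 2 : ℕ) : ℝ) * 2 ^ (dyadicPrimes x).card)
          ≤ (B * N) ^ 2 * (8 * (N : ℝ) ^ 4 *
            ((∏ p ∈ dyadicPrimes x, p ^ 2 : ℕ) : ℝ) * 2 ^ (dyadicPrimes x).card) := by gcongr
        _ = 8 * B ^ 2 * (N : ℝ) ^ 6 *
            (((∏ p ∈ dyadicPrimes x, p ^ 2 : ℕ) : ℝ) * 2 ^ (dyadicPrimes x).card) := by ring
        _ ≤ Real.exp (8 * B ^ 2) * Real.exp (8 * A) ^ 6 * Real.exp (l / 4) := by gcongr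
        _ = Real.exp (8 * B ^ 2 + 48 * A + l / 4) := by
            rw [← Real.exp_nat_mul, ← Real.exp_add, ← Real.exp_add]; push_cast; ring_nf
        _ ≤ T := by
            conv_rhs => rw [hTl]
            rw [Real.exp_le_exp]; linarith)
  refine ⟨t, ht, htF, fun j => ?_⟩
  set ζ := Complex.exp (-(θ j : ℂ) * Complex.I) with hζ
  have hζ1 : ‖ζ‖ = 1 := by
    rw [hζ, ← Complex.ofReal_neg, Complex.norm_exp_ofReal_mul_I]
  have hmain := re_mean_ge hB (div_nonneg (Real.rpow_nonneg (by linarith) _) hlogx.le) hc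
    hdiag hoff θ j
  have hX : η ^ (1 - σ) * (l ^ (1 - σ) / Real.log l) ≤ x ^ (1 - σ) / Real.log x := by
    rw [← mul_div_assoc, ← Real.mul_rpow hη.le hl0.le]
    gcongr
  set E₁ := ∑ p ∈ primesUpTo N, a j p * (weight A σ p : ℂ) * centred (direction a θ B x) p t
  set E₂ := ∑ p ∈ dyadicPrimes x, a j p * (weight A σ p : ℂ) * (direction a θ B x p / 2)
  set P := ∑ p ∈ primesUpTo N, a j p * (weight A σ p : ℂ) *
    (Complex.exp ((t * Real.log p : ℝ) * Complex.I))⁻¹ with hP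
  -- Fluctuation plus mean. The mean is supported on the dyadic primes, because the direction
  -- vanishes elsewhere.
  have hsplit : P = E₁ + E₂ := by
    have h1 : E₂ = ∑ p ∈ primesUpTo N,
        a j p * (weight A σ p : ℂ) * (direction a θ B x p / 2) := by
      refine Finset.sum_subset (dyadicPrimes_subset_primesUpTo hxN) fun p _ hp => ?_
      rw [direction, if_neg hp]; simp
    rw [h1, ← Finset.sum_add_distrib]
    refine Finset.sum_congr rfl fun p _ => ?_
    rw [centred]; ring
  have hE₁ : ‖E₁‖ ≤ √(2 * (k * (2 * G + 1)) + 1) := Real.le_sqrt_of_sq_le (htd j)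
  have hCj : C j ≤ ∑ j, C j :=
    Finset.single_le_sum (fun i _ => hC0 i) (Finset.mem_univ j)
  have hR := hC j A σ t (by linarith) (by linarith) N (Nat.lt_floor_add_one _)
  have hre : ∀ z : ℂ, -‖z‖ ≤ (ζ * z).re := by
    intro z
    have := (abs_le.mp (Complex.abs_re_le_norm (ζ * z))).1
    rwa [norm_mul, hζ1, one_mul] at this
  have heq : ζ * smoothSum (a j) A σ t =
      ζ * E₂ + ζ * E₁ + ζ * (smoothSum (a j) A σ t - P) := by
    rw [hsplit]; ring
  rw [heq, Complex.add_re, Complex.add_re]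
  have h1 := hre E₁
  have h2 := hre (smoothSum (a j) A σ t - P)
  have h3 : c / (2 * B) * η ^ (1 - σ) * (l ^ (1 - σ) / Real.log l) ≤ (ζ * E₂).re := by
    refine le_trans ?_ hmain
    rw [mul_assoc]
    gcongr
  linarith

/-! ### Joint extreme values -/

/-- If all coefficients vanished, the diagonal prime sums would be 0, against κ_j > 0. -/
lemma SSOC.exists_coeff_ne_zero {k : ℕ} {a : Fin k → ℕ → ℂ} {κ : Fin k → ℝ} (h : SSOC a κ)
    (hκ : ∀ j, 0 < κ j) (j : Fin k) : ∃ n ≠ 0, a j n ≠ 0 := by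
  obtain ⟨c, hc, x₀, hx₀⟩ := h.exists_weighted hκ (σ := 1) zero_le_one le_rfl
  set x := max x₀ 2
  have hx2 : 2 ≤ x := le_max_right _ _
  have hlog : 0 < Real.log x := Real.log_pos (by linarith)
  have h1 := (hx₀ x (le_max_left _ _) (Real.log x ^ 2) (by positivity) le_rfl).1 j
  by_contra! hcon
  rw [Finset.sum_eq_zero fun p hp => ?_, Complex.zero_re] at h1
  · have : 0 < 2 * c * (x ^ (1 - 1 : ℝ) / Real.log x) := by positivity
    linarith
  · rw [hcon p (Finset.mem_filter.mp hp).2.ne_zero]; simp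

/-- The ordinates of the zeros up to height `2 * T`, together with `T` and `2 * T`, form a sparse
set. -/
lemma exists_sparse_ordinates {k : ℕ} {L : Fin k → ℂ → ℂ} {σ δ δ' : ℝ}
    (hzero : ∀ j, ZeroDensity (L j) σ δ) (hδ : δ' ≤ δ) (hδ0 : 0 ≤ δ') (hδ1 : δ' ≤ 1) :
    ∃ K : ℝ, ∀ᶠ T : ℝ in atTop, ∃ F : Finset ℝ, T ∈ F ∧ 2 * T ∈ F ∧
      (∀ j, ∀ ρ ∈ zeroSet (L j) σ (2 * T), ρ.im ∈ F) ∧ (F.card : ℝ) ≤ K * T ^ (1 - δ') := by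
  classical
  choose C hC using hzero
  have h2 : Tendsto (fun T : ℝ => 2 * T) atTop atTop := tendsto_id.const_mul_atTop two_pos
  refine ⟨2 + ∑ j, 2 * |C j|, ?_⟩
  filter_upwards [eventually_all.mpr fun j => h2.eventually (hC j), eventually_ge_atTop 1]
    with T hT hT1
  refine ⟨{T, 2 * T} ∪ Finset.univ.biUnion fun j => (hT j).1.toFinset.image Complex.im,
    by simp, by simp, fun j ρ hρ => ?_, ?_⟩
  · refine Finset.mem_union_right _ (Finset.mem_biUnion.mpr ⟨j, Finset.mem_univ j, ?_⟩)
    exact Finset.mem_image_of_mem _ ((hT j).1.mem_toFinset.mpr hρ)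
  -- The condition δ' ≤ 1 makes the power at least 1, so that it covers the two added points T and
  -- 2T.
  · have hpow : 1 ≤ T ^ (1 - δ') := Real.one_le_rpow hT1 (by linarith)
    have hj : ∀ j, (((hT j).1.toFinset.image Complex.im).card : ℝ) ≤
        2 * |C j| * T ^ (1 - δ') := by
      intro j
      have h3 : ((hT j).1.toFinset.image Complex.im).card ≤ (zeroSet (L j) σ (2 * T)).ncard := by
        exact Finset.card_image_le.trans (Set.ncard_eq_toFinset_card _ (hT j).1).ge
      calc (((hT j).1.toFinset.image Complex.im).card : ℝ)
          ≤ (zeroSet (L j) σ (2 * T)).ncard := by exact_mod_cast h3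
        _ ≤ C j * (2 * T) ^ (1 - δ) := (hT j).2
        _ ≤ |C j| * (2 * T) ^ (1 - δ') := by
            gcongr
            · exact le_abs_self _
            · linarith
        _ = |C j| * (2 ^ (1 - δ') * T ^ (1 - δ')) := by
            rw [Real.mul_rpow (by norm_num) (by linarith)]
        _ ≤ |C j| * (2 * T ^ (1 - δ')) := by
            gcongr
            calc (2 : ℝ) ^ (1 - δ') ≤ 2 ^ (1 : ℝ) :=
                  Real.rpow_le_rpow_of_exponent_le one_le_two (by linarith)
              _ = 2 := Real.rpow_one 2
        _ = _ := by ring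
    have hcard : (({T, 2 * T} ∪ Finset.univ.biUnion fun j =>
        (hT j).1.toFinset.image Complex.im : Finset ℝ).card : ℝ) ≤
        2 + ∑ j, (((hT j).1.toFinset.image Complex.im).card : ℝ) := by
      have h4 := Finset.card_union_le ({T, 2 * T} : Finset ℝ)
        (Finset.univ.biUnion fun j => (hT j).1.toFinset.image Complex.im)
      have h5 : (Finset.univ.biUnion fun j => (hT j).1.toFinset.image Complex.im).card ≤
        ∑ j, ((hT j).1.toFinset.image Complex.im).card := Finset.card_biUnion_le
      have h6 : ({T, 2 * T} : Finset ℝ).card ≤ 2 := Finset.card_le_two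
      exact_mod_cast h4.trans (add_le_add h6 h5)
    refine hcard.trans ?_
    rw [add_mul, Finset.sum_mul]
    refine add_le_add (by linarith) (Finset.sum_le_sum fun j _ => hj j)

lemma IsSelberg.analyticAt {L : ℂ → ℂ} {a : ℕ → ℂ} (h : IsSelberg L a) {s : ℂ}
    (hs : s ≠ 1) : AnalyticAt ℂ L s := by
  have h1 : DifferentiableOn ℂ L {1}ᶜ := fun z hz =>
    (h.differentiableAt hz).differentiableWithinAt
  exact h1.analyticAt (isOpen_compl_singleton.mem_nhds hs)

end JointExtreme

open JointExtreme

theorem theorem1 (σ₀ : ℝ) (hσ : 1 / 2 < σ₀) (hσ' : σ₀ < 1)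
    (k : ℕ) (L : Fin k → ℂ → ℂ) (a : Fin k → ℕ → ℂ)
    (hL : ∀ j, JointExtreme.IsSelbergPoly (L j) (a j))
    (hdistinct : Function.Injective L)
    (κ : Fin k → ℝ) (hκ : ∀ j, 0 < κ j) (hssoc : JointExtreme.SSOC a κ)
    (δ : ℝ) (hδ : 0 < δ) (hzero : ∀ j, JointExtreme.ZeroDensity (L j) σ₀ δ) :
    ∃ c : ℝ, 0 < c ∧ ∀ θ : Fin k → ℝ, ∃ T₀ : ℝ, ∀ T : ℝ, T₀ ≤ T →
      ∃ t : Fin k → ℝ,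
        (∀ j, t j ∈ Set.Icc T (2 * T)) ∧
        (∀ i j, |t i - t j| ≤
          2 * Real.log T ^ ((1 + σ₀) / 2) * Real.log (Real.log T) ^ ((1 : ℝ) / 2)) ∧
        ∀ j, ∃ w : ℂ, JointExtreme.IsLogValue (L j) (σ₀ + t j * Complex.I) w ∧
          c * (Real.log T ^ (1 - σ₀) / Real.log (Real.log T)) ≤
            (Complex.exp (-(θ j : ℂ) * Complex.I) * w).re := by
  choose r ν hν haν hprod using fun j =>
    exists_local_roots (hL j) (hssoc.exists_coeff_ne_zero hκ j)
  have ha : ∀ p, p.Prime → ∑ i, ‖a i p‖ ≤ ∑ i, (r i : ℝ) + 1 := by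
    intro p hp
    have h1 : ∑ i, ‖a i p‖ ≤ ∑ i, (r i : ℝ) := by
      refine Finset.sum_le_sum fun i _ => ?_
      rw [haν i p hp]
      refine (norm_sum_le_of_le _ fun j _ => hν i j p hp).trans ?_
      simp
    linarith
  choose D B R hD hB hlarge using fun j =>
    exists_large_logValue (hL j).toIsSelberg (hν j) (haν j) (hprod j) hσ hσ'
  -- Then 8η ≤ δ, as the zero density requires, and η ≤ 1/16, which keeps the Riesz errors below
  -- T^(1/4).
  set η : ℝ := min δ (1 / 2) / 8 with hη
  have h8η : 8 * η = min δ (1 / 2) := by rw [hη]; ring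
  have hη0 : 0 < η := by positivity
  have hη1 : η ≤ 1 / 16 := by linarith [min_le_right δ (1 / 2)]
  obtain ⟨K, hK⟩ := exists_sparse_ordinates (δ' := 8 * η) hzero
    (by rw [h8η]; exact min_le_left _ _) (by positivity) (by linarith)
  obtain ⟨c, M, hc, hcentre⟩ := hssoc.exists_centre hκ hσ hσ'
    (B := ∑ i, (r i : ℝ) + 1) (by positivity) ha hη0 hη1 K
  -- Half of the main term is given up to absorb the bounded losses D + 1 + M for large T.
  refine ⟨c / 2, by positivity, fun θ => ?_⟩
  have hlog := Real.tendsto_log_atTop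
  have hev : ∀ j, ∀ᶠ T : ℝ in atTop, R j ≤ T / 2 ∧
      (D j + 1 + M) / (c / 2) ≤ Real.log T ^ (1 - σ₀) / Real.log (Real.log T) ∧
      ∀ t : ℝ, 0 < t → t ≤ 2 * Real.exp (Real.log T) →
        D j * t ^ B j * ((Real.log (Real.log T) ^ 2) ^ 2 * (√(Real.log T) + 1) *
          Real.exp (Real.log (Real.log T) ^ 2 *
            (4 + 4 * √(Real.log T) - √(Real.log T) ^ 2 / 2))) ≤ 1 := by
    intro j
    filter_upwards [eventually_ge_atTop (2 * R j),
      hlog.eventually (eventually_le_rpow_div_log ((D j + 1 + M) / (c / 2)) (sub_pos.mpr hσ')),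
      hlog.eventually (eventually_error_le (D j) (B j) (hD j) (hB j))] with T h1 h2 h3
    exact ⟨by linarith, h2, h3⟩
  refine eventually_atTop.mp ?_
  filter_upwards [hK, hcentre, eventually_all.mpr hev,
    hlog.eventually (eventually_mul_sqrt_le_exp 2 (b := 1) one_pos),
    (hlog.comp hlog).eventually_ge_atTop 1, hlog.eventually_ge_atTop 1, eventually_gt_atTop 0]
    with T hKT hcT hevT hsqrt hll hl hT
  simp only [Function.comp] at hll
  obtain ⟨F, hTF, h2TF, hzF, hcard⟩ := hKT
  obtain ⟨t, ⟨ht1, ht2⟩, htF, htj⟩ := hcT θ F hcard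
  rw [one_mul, Real.exp_log hT] at hsqrt
  set l := Real.log T with hl_def
  set H := √l with hH
  have hH1 : 1 ≤ H := Real.one_le_sqrt.mpr hl
  -- The endpoints T and 2T belong to F, so staying away from F puts the whole window inside (T,
  -- 2T). It then contains only ordinates covered by `zeroSet` up to 2T, and every y in it is
  -- admissible.
  have hlow : T + (H + 3) < t := by
    have := htF T hTF
    rw [abs_of_pos (by linarith)] at this
    linarith
  have hhigh : t + (H + 3) < 2 * T := by
    have := htF (2 * T) h2TF
    rw [abs_of_nonpos (by linarith)] at this
    linarith
  have hfree : ∀ j, ∀ s : ℂ, σ₀ ≤ s.re → |s.im - t| ≤ H + 3 → L j s ≠ 0 := by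
    intro j s hs him h0
    have him' := abs_le.mp him
    have hs1 : s ≠ 1 := by
      rintro rfl
      simp only [Complex.one_im] at him'
      linarith
    have := htF s.im (hzF j s ⟨(hL j).toIsSelberg.analyticAt hs1, h0, hs, by linarith,
      by linarith⟩)
    rw [abs_sub_comm] at this
    linarith
  have hX : 0 ≤ l ^ (1 - σ₀) / Real.log l := by positivity
  have key : ∀ j, ∃ y ∈ Set.Icc (t - H) (t + H), ∃ w, IsLogValue (L j) (σ₀ + y * Complex.I) w ∧
      c / 2 * (l ^ (1 - σ₀) / Real.log l) ≤
        (Complex.exp (-(θ j : ℂ) * Complex.I) * w).re := by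
    intro j
    obtain ⟨hR, hbig, herr⟩ := hevT j
    rw [div_le_iff₀ (by positivity)] at hbig
    have he := herr t (by linarith) (by rw [Real.exp_log hT]; exact ht2)
    refine hlarge j (Real.log l ^ 2) H t _ _ (by nlinarith) hH1 (by linarith) (by positivity)
      ?_ (hfree j) ?_
    · rw [← Complex.ofReal_neg, Complex.norm_exp_ofReal_mul_I]
    · have := htj j
      linarith
  choose y hy w hw using key
  refine ⟨y, fun j => ⟨by linarith [(hy j).1], by linarith [(hy j).2]⟩, fun i j => ?_,
    fun j => ⟨w j, hw j⟩⟩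
  -- All windows share the centre t, so the spread is at most 2 √(log T). This is within the stated
  -- bound because (1 + σ₀) / 2 ≥ 1/2 and log log T ≥ 1.
  have h1 : |y i - y j| ≤ 2 * H := by
    rw [abs_le]
    constructor <;> linarith [(hy i).1, (hy i).2, (hy j).1, (hy j).2]
  have h2 : H ≤ l ^ ((1 + σ₀) / 2) := by
    rw [hH, Real.sqrt_eq_rpow]
    exact Real.rpow_le_rpow_of_exponent_le hl (by linarith)
  have h3 : 1 ≤ Real.log l ^ ((1 : ℝ) / 2) := Real.one_le_rpow hll (by norm_num)
  calc |y i - y j| ≤ 2 * l ^ ((1 + σ₀) / 2) * 1 := by linarith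
    _ ≤ _ := by gcongr
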